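/- Let $(\mathcal A,\Phi)$ be a non-commutative probability space: a unital associative algebra $\mathcal A$ over $\mathbb C$ with a linear form $\Phi$ such that $\Phi(1)=1$ and $\Phi(ab)=\Phi(ba)$. Let $\kappa$ denote the free cumulants of $\Phi$, defined by $\Phi(a_1\cdots a_K)=\sum_{\pi\in \mathrm{NC}(K)}\prod_{\{i_1<\dots<i_L\}\in\pi}\kappa(a_{i_1},\dots,a_{i_L})$. *Graph polynomials.* An $n$-graph monomial is a finite connected directed multigraph with edges labelled by elements of $\mathcal A$ and $n$ distinguished vertices, up to isomorphism; $\mathbb C\mathcal G^{(n)}\langle\mathcal A\rangle$ is the vector space with basis the $n$-graph monomials. For $n=2$ the distinguished vertices are called output and input. A $K$-graph operation $g$ (a finite connected directed multigraph with $K$ ordered edges, an input and an output) acts multilinearly on $\mathbb C\mathcal G^{(2)}\langle\mathcal A\rangle$ by $Z_g$, which replaces the $k$-th edge of $g$ by the $k$-th argument, its source becoming the input and its target the output of that argument. With the product $t\cdot s$ that identifies the input of $t$ with the output of $s$, $\mathbb C\mathcal G^{(2)}\langle\mathcal A\rangle$ is a unital algebra. Write $\cdot\overset{a}{\leftarrow}\cdot$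 for an edge labelled $a$ from the input to the output, $\cdot\overset{a}{\rightarrow}\cdot$ for an edge labelled $a$ from the output to the input, and ${}^{\uparrow a}_{\ \cdot}$ for an edge labelled $a$ from a vertex that is both input and output to another vertex. *The algebra $\mathcal G(\mathcal A)$* is the quotient of $\mathbb C\mathcal G^{(2)}\langle\mathcal A\rangle$ by the relations $$Z_g(\cdot\overset{P(a_1,\dots,a_k)}{\longleftarrow}\cdot\otimes\cdot\overset{b_2}{\leftarrow}\cdot\otimes\cdots\otimes\cdot\overset{b_K}{\leftarrow}\cdot)=Z_g(P(\cdot\overset{a_1}{\leftarrow}\cdot,\dots,\cdot\overset{a_k}{\leftarrow}\cdot)\otimes\cdot\overset{b_2}{\leftarrow}\cdot\otimes\cdots\otimes\cdot\overset{b_K}{\leftarrow}\cdot)$$ for all graph operations $g$, non-commutative polynomials $P$ and elements $a_i,b_j\in\mathcal A$. In $\mathcal G(\mathcal A)$, $a$ denotes the class of $\cdot\overset{a}{\leftarrow}\cdot$, and ${}^ta=Z_{\cdot\to\cdot}(a)$ and $\deg(a)$ denote the classes of $\cdot\overset{a}{\rightarrow}\cdot$ and of ${}^{\uparrow a}_{\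 \cdot}$. *The functional $\tau_\Phi$.* For a $0$-graph monomial $T$, call $T$ a cactus if each edge belongs to exactly one simple cycle (orientations being ignored). Put $\tau^0_\Phi[T]=\prod_C\kappa(a^C_1,\dots,a^C_{n_C})$ if $T$ is a cactus all of whose cycles are oriented, where $C$ runs over the cycles of $T$ and $C=(\cdot\overset{a^C_1}{\leftarrow}\cdot\overset{a^C_2}{\leftarrow}\cdots\overset{a^C_{n_C}}{\leftarrow}\cdot)$ closed up cyclically, and $\tau^0_\Phi[T]=0$ otherwise. Put $\tau_\Phi[T]=\sum_\pi\tau^0_\Phi[T^\pi]$, summing over all partitions $\pi$ of the vertex set of $T$, where $T^\pi$ is $T$ with the vertices in each block identified; extend linearly. For a $2$-graph polynomial $t$ let $\Psi(t)=\tau_\Phi(\tilde\Delta(t))$, where $\tilde\Delta$ identifies input and output and forgets them. Unital subalgebras $(\mathcal B_i)_i$ of a unital algebra with linear form $\psi$ are *free in the sense of Voiculescu* if $\psi(c_1\cdots c_n)=0$ whenever $n\ge1$, $c_k\in\mathcal B_{i_k}$, $\psi(c_k)=0$ for all $k$, and $i_k\ne i_{k+1}$ for all $k<n$. **Statement.**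 The three unital subalgebras of $\mathbb C\mathcal G^{(2)}\langle\mathcal A\rangle$ generated respectively by $\{\cdot\overset{a}{\leftarrow}\cdot : a\in\mathcal A\}$, by $\{\cdot\overset{a}{\rightarrow}\cdot : a\in\mathcal A\}$ and by $\{{}^{\uparrow a}_{\ \cdot} : a\in\mathcal A\}$ are free in the sense of Voiculescu with respect to $\Psi$. Moreover $\Psi$ induces a linear form on $\mathcal G(\mathcal A)$, and with respect to it the unital subalgebras of $\mathcal G(\mathcal A)$ generated respectively by $\{a : a\in\mathcal A\}$, by $\{{}^ta : a\in\mathcal A\}$ and by $\{\deg(a) : a\in\mathcal A\}$ are free in the sense of Voiculescu. -/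

import Mathlib

universe u

/-! ### Graph monomials and graph operations

Graphs are finite connected directed multigraphs; loops and multiple edges are allowed.
Vertex and edge sets are taken in `Type`, which costs nothing since they are finite and monomials
are considered up to isomorphism. -/

namespace Traffic

/-- Connectedness of a directed multigraph, regardless of the orientation of the edges. -/
def GraphConnected {V E : Type} (src tgt : E → V) : Prop :=
  Nonempty V ∧ ∀ x y : V, Relation.EqvGen (fun v w => ∃ e, src e = v ∧ tgt e = w) x y

/-- An `n`-graph monomial indexed by `J`: a finite connected directed graph, edges labelled by `J`,
with an `n`-tuple `port` of distinguished vertices. For `n = 2` the vertex `port 0` is the output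
and `port 1` is the input. -/
structure GraphMonomial (J : Type u) (n : ℕ) where
  V : Type
  E : Type
  finV : Finite V
  finE : Finite E
  src : E → V
  tgt : E → V
  label : E → J
  port : Fin n → V
  conn : GraphConnected src tgt

/-- A `K`-graph operation: a finite connected directed graph with `K` ordered edges, one input
and one output (possibly equal). -/
structure GraphOp (K : ℕ) where
  V : Type
  finV : Finite V
  src : Fin K → V
  tgt : Fin K → V
  inp : V
  out : V
  conn : GraphConnected src tgt

namespace GraphMonomial

variable {J : Type u} {n : ℕ}

/-- The output of a `2`-graph monomial. -/
def out (t : GraphMonomial J 2) : t.V := t.port 0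

/-- The input of a `2`-graph monomial. -/
def inp (t : GraphMonomial J 2) : t.V := t.port 1

/-- Isomorphism of `n`-graph monomials. -/
def Iso (t s : GraphMonomial J n) : Prop :=
  ∃ (f : t.V ≃ s.V) (g : t.E ≃ s.E), (∀ e, s.src (g e) = f (t.src e)) ∧
    (∀ e, s.tgt (g e) = f (t.tgt e)) ∧ (∀ e, s.label (g e) = t.label e) ∧
    ∀ i, s.port i = f (t.port i)

theorem Iso.refl (t : GraphMonomial J n) : Iso t t :=
  ⟨Equiv.refl _, Equiv.refl _, fun _ => rfl, fun _ => rfl, fun _ => rfl, fun _ => rfl⟩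

theorem Iso.symm {t s : GraphMonomial J n} : Iso t s → Iso s t := by
  rintro ⟨f, g, h1, h2, h3, h4⟩
  refine ⟨f.symm, g.symm, fun e => ?_, fun e => ?_, fun e => ?_, fun i => ?_⟩
  · rw [Equiv.eq_symm_apply, ← h1, Equiv.apply_symm_apply]
  · rw [Equiv.eq_symm_apply, ← h2, Equiv.apply_symm_apply]
  · rw [← h3, Equiv.apply_symm_apply]
  · rw [Equiv.eq_symm_apply, ← h4]

theorem Iso.trans {t s r : GraphMonomial J n} : Iso t s → Iso s r → Iso t r := by
  rintro ⟨f, g, h1, h2, h3, h4⟩ ⟨f', g', h1', h2', h3', h4'⟩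
  exact ⟨f.trans f', g.trans g', fun e => by simp [h1', h1], fun e => by simp [h2', h2],
    fun e => by simp [h3', h3], fun i => by simp [h4', h4]⟩

instance isoSetoid (J : Type u) (n : ℕ) : Setoid (GraphMonomial J n) :=
  ⟨Iso, Iso.refl, Iso.symm, Iso.trans⟩

end GraphMonomial

/-- `n`-graph monomials up to isomorphism. -/
def GraphClass (J : Type u) (n : ℕ) := Quotient (GraphMonomial.isoSetoid J n)

/-- The class of a graph monomial. -/
def GraphMonomial.cls {J : Type u} {n : ℕ} (t : GraphMonomial J n) : GraphClass J n :=
  Quotient.mk _ t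

/-! ### Quotients and connectedness -/

theorem eqvGen_of_map {α β : Type} {r : α → α → Prop} {s : β → β → Prop} (f : α → β)
    (h : ∀ x y, r x y → Relation.EqvGen s (f x) (f y)) {x y : α} (hxy : Relation.EqvGen r x y) :
    Relation.EqvGen s (f x) (f y) := by
  induction hxy with
  | rel x y hr => exact h x y hr
  | refl x => exact .refl _
  | symm x y _ ih => exact .symm _ _ ih
  | trans x y z _ _ ih1 ih2 => exact .trans _ _ _ ih1 ih2

theorem GraphConnected.map {V W E : Type} {src tgt : E → V} (h : GraphConnected src tgt)
    (f : V → W) (hf : Function.Surjective f) :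
    GraphConnected (fun e => f (src e)) (fun e => f (tgt e)) := by
  refine ⟨h.1.map f, fun x y => ?_⟩
  obtain ⟨x, rfl⟩ := hf x
  obtain ⟨y, rfl⟩ := hf y
  refine eqvGen_of_map f ?_ (h.2 x y)
  rintro _ _ ⟨e, rfl, rfl⟩
  exact .rel _ _ ⟨e, rfl, rfl⟩

theorem GraphConnected.reindex {V : Type} {s t : V}
    (h : GraphConnected (fun _ : Unit => s) (fun _ : Unit => t)) :
    GraphConnected (fun _ : Fin 1 => s) (fun _ : Fin 1 => t) :=
  ⟨h.1, fun x y => eqvGen_of_map id (fun _ _ ⟨_, h1, h2⟩ => .rel _ _ ⟨0, h1, h2⟩) (h.2 x y)⟩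

namespace GraphMonomial

variable {J : Type u} {n : ℕ}

/-- `t^π`: the graph obtained from `t` by identifying the vertices in a same block of `π`. -/
def quot (t : GraphMonomial J n) (π : Setoid t.V) : GraphMonomial J n where
  V := Quotient π
  E := t.E
  finV := have := t.finV; inferInstance
  finE := t.finE
  src e := Quotient.mk π (t.src e)
  tgt e := Quotient.mk π (t.tgt e)
  label := t.label
  port i := Quotient.mk π (t.port i)
  conn := t.conn.map _ Quotient.mk_surjective

/-- Identify input and output, then forget them. -/
def close (t : GraphMonomial J 2) : GraphMonomial J 0 where
  V := Quot (fun x y => x = t.out ∧ y = t.inp)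
  E := t.E
  finV := have := t.finV; inferInstance
  finE := t.finE
  src e := Quot.mk _ (t.src e)
  tgt e := Quot.mk _ (t.tgt e)
  label := t.label
  port := Fin.elim0
  conn := t.conn.map _ Quot.mk_surjective

theorem close_iso {t s : GraphMonomial J 2} (h : Iso t s) : Iso t.close s.close := by
  obtain ⟨f, g, h1, h2, h3, h4⟩ := h
  refine ⟨Quot.congr f fun x y => ?_, g, fun e => ?_, fun e => ?_, h3, fun i => i.elim0⟩
  · show _ ↔ f x = s.port 0 ∧ f y = s.port 1
    rw [h4, h4, f.injective.eq_iff, f.injective.eq_iff]; rfl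
  · exact congrArg (Quot.mk _) (h1 e)
  · exact congrArg (Quot.mk _) (h2 e)

/-- The graph with one vertex and no edge. -/
def unit (J : Type u) : GraphMonomial J 2 where
  V := Unit
  E := Empty
  finV := inferInstance
  finE := inferInstance
  src := Empty.elim
  tgt := Empty.elim
  label := Empty.elim
  port _ := ()
  conn := ⟨⟨()⟩, fun _ _ => .refl _⟩

theorem conn_two (s t : Fin 2) (h : s ≠ t) :
    GraphConnected (fun _ : Unit => s) (fun _ : Unit => t) := by
  refine ⟨⟨s⟩, fun x y => ?_⟩
  have key : Relation.EqvGen (fun v w => ∃ _ : Unit, s = v ∧ t = w) s t := .rel _ _ ⟨(), rfl, rfl⟩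
  have hx : ∀ x, Relation.EqvGen (fun v w => ∃ _ : Unit, s = v ∧ t = w) s x := by
    intro x
    by_cases hxs : x = s
    · rw [hxs]; exact .refl _
    · have : x = t := by omega
      rw [this]; exact key
  exact .trans _ _ _ (.symm _ _ (hx x)) (hx y)

/-- One edge labelled `a`, from the input to the output: `· ←a ·`. -/
def edge (a : J) : GraphMonomial J 2 where
  V := Fin 2
  E := Unit
  finV := inferInstance
  finE := inferInstance
  src _ := 1
  tgt _ := 0
  label _ := a
  port := ![0, 1]
  conn := conn_two 1 0 (by decide)

/-- One edge labelled `a`, from the output to the input: `· →a ·`. -/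
def revEdge (a : J) : GraphMonomial J 2 where
  V := Fin 2
  E := Unit
  finV := inferInstance
  finE := inferInstance
  src _ := 0
  tgt _ := 1
  label _ := a
  port := ![0, 1]
  conn := conn_two 0 1 (by decide)

/-- One edge labelled `a`, from a vertex which is both input and output to another vertex. -/
def degGraph (a : J) : GraphMonomial J 2 where
  V := Fin 2
  E := Unit
  finV := inferInstance
  finE := inferInstance
  src _ := 0
  tgt _ := 1
  label _ := a
  port := ![0, 0]
  conn := conn_two 0 1 (by decide)

end GraphMonomial

/-! ### Substitution of graph monomials in a graph operation -/

namespace GraphOp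

variable {J : Type u} {K : ℕ}

/-- The identifications made when the `k`-th edge of `g` is replaced by `t k`. -/
inductive SubstRel (g : GraphOp K) (t : Fin K → GraphMonomial J 2) :
    g.V ⊕ (Σ k, (t k).V) → g.V ⊕ (Σ k, (t k).V) → Prop
  | source (k : Fin K) : SubstRel g t (.inl (g.src k)) (.inr ⟨k, (t k).inp⟩)
  | target (k : Fin K) : SubstRel g t (.inl (g.tgt k)) (.inr ⟨k, (t k).out⟩)

theorem subst_conn (g : GraphOp K) (t : Fin K → GraphMonomial J 2) :
    GraphConnected
      (fun e : Σ k, (t k).E => Quot.mk (SubstRel g t) (.inr ⟨e.1, (t e.1).src e.2⟩))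
      (fun e => Quot.mk (SubstRel g t) (.inr ⟨e.1, (t e.1).tgt e.2⟩)) := by
  set R : Quot (SubstRel g t) → Quot (SubstRel g t) → Prop := fun v w =>
    ∃ e : Σ k, (t k).E, Quot.mk (SubstRel g t) (.inr ⟨e.1, (t e.1).src e.2⟩) = v ∧
      Quot.mk (SubstRel g t) (.inr ⟨e.1, (t e.1).tgt e.2⟩) = w with hR
  have hin : ∀ k (x y : (t k).V), Relation.EqvGen R (Quot.mk _ (.inr ⟨k, x⟩))
      (Quot.mk _ (.inr ⟨k, y⟩)) := by
    intro k x y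
    refine eqvGen_of_map (fun x => Quot.mk (SubstRel g t) (.inr ⟨k, x⟩)) ?_ ((t k).conn.2 x y)
    rintro _ _ ⟨e, rfl, rfl⟩
    exact .rel _ _ ⟨⟨k, e⟩, rfl, rfl⟩
  have hout : ∀ x y : g.V, Relation.EqvGen R (Quot.mk _ (.inl x)) (Quot.mk _ (.inl y)) := by
    intro x y
    refine eqvGen_of_map (fun x => Quot.mk (SubstRel g t) (.inl x)) ?_ (g.conn.2 x y)
    rintro _ _ ⟨k, rfl, rfl⟩
    show Relation.EqvGen R (Quot.mk _ (.inl (g.src k))) (Quot.mk _ (.inl (g.tgt k)))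
    rw [Quot.sound (SubstRel.source k), Quot.sound (SubstRel.target k)]
    exact hin k _ _
  have hall : ∀ x, Relation.EqvGen R (Quot.mk _ (.inl g.inp)) x := by
    rintro ⟨x | ⟨k, x⟩⟩
    · exact hout _ _
    · have h2 := hin k (t k).inp x
      rw [← Quot.sound (SubstRel.source k)] at h2
      exact .trans _ _ _ (hout _ _) h2
  exact ⟨⟨Quot.mk _ (.inl g.inp)⟩, fun x y => .trans _ _ _ (.symm _ _ (hall x)) (hall y)⟩

/-- Replace, for all `k`, the `k`-th edge of `g` by the `2`-graph monomial `t k`: the source of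
the edge is identified with the input of `t k` and its target with the output of `t k`. -/
def subst (g : GraphOp K) (t : Fin K → GraphMonomial J 2) : GraphMonomial J 2 where
  V := Quot (SubstRel g t)
  E := Σ k, (t k).E
  finV := by
    have := g.finV
    have := fun k => (t k).finV
    infer_instance
  finE := by
    have := fun k => (t k).finE
    infer_instance
  src e := Quot.mk _ (.inr ⟨e.1, (t e.1).src e.2⟩)
  tgt e := Quot.mk _ (.inr ⟨e.1, (t e.1).tgt e.2⟩)
  label e := (t e.1).label e.2
  port := ![Quot.mk _ (.inl g.out), Quot.mk _ (.inl g.inp)]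
  conn := subst_conn g t

theorem subst_iso (g : GraphOp K) {t s : Fin K → GraphMonomial J 2}
    (h : ∀ k, GraphMonomial.Iso (t k) (s k)) : GraphMonomial.Iso (g.subst t) (g.subst s) := by
  choose f φ h1 h2 h3 h4 using h
  have hmap : ∀ x y, SubstRel g t x y ↔
      SubstRel g s (Equiv.sumCongr (Equiv.refl _) (Equiv.sigmaCongrRight f) x)
        (Equiv.sumCongr (Equiv.refl _) (Equiv.sigmaCongrRight f) y) := by
    have hi : ∀ k, f k (t k).inp = (s k).inp := fun k => (h4 k 1).symm
    have ho : ∀ k, f k (t k).out = (s k).out := fun k => (h4 k 0).symm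
    intro x y
    constructor
    · rintro (k | k)
      · have := SubstRel.source (g := g) (t := s) k
        rw [← hi] at this; exact this
      · have := SubstRel.target (g := g) (t := s) k
        rw [← ho] at this; exact this
    · intro hs
      generalize hx : Equiv.sumCongr (Equiv.refl _) (Equiv.sigmaCongrRight f) x = x' at hs
      generalize hy : Equiv.sumCongr (Equiv.refl _) (Equiv.sigmaCongrRight f) y = y' at hs
      have inj := (Equiv.sumCongr (Equiv.refl g.V) (Equiv.sigmaCongrRight f)).injective
      rcases hs with k | k
      · have hx' : x = .inl (g.src k) := inj (hx.trans rfl)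
        have hy' : y = .inr ⟨k, (t k).inp⟩ := inj (hy.trans (by rw [← hi]; rfl))
        rw [hx', hy']
        exact .source k
      · have hx' : x = .inl (g.tgt k) := inj (hx.trans rfl)
        have hy' : y = .inr ⟨k, (t k).out⟩ := inj (hy.trans (by rw [← ho]; rfl))
        rw [hx', hy']
        exact .target k
  refine ⟨Quot.congr (Equiv.sumCongr (Equiv.refl _) (Equiv.sigmaCongrRight f)) hmap,
    Equiv.sigmaCongrRight φ, fun e => ?_, fun e => ?_, fun e => h3 _ _, fun i => ?_⟩
  · exact congrArg (fun v => Quot.mk (SubstRel g s) (Sum.inr ⟨e.1, v⟩)) (h1 e.1 e.2)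
  · exact congrArg (fun v => Quot.mk (SubstRel g s) (Sum.inr ⟨e.1, v⟩)) (h2 e.1 e.2)
  · fin_cases i <;> rfl

/-- Substitution on isomorphism classes. -/
noncomputable def substCls (g : GraphOp K) (x : Fin K → GraphClass J 2) : GraphClass J 2 :=
  (g.subst fun k => (x k).out).cls

theorem substCls_cls (g : GraphOp K) (t : Fin K → GraphMonomial J 2) :
    g.substCls (fun k => (t k).cls) = (g.subst t).cls :=
  Quotient.sound (g.subst_iso fun k => Quotient.mk_out (t k))

/-- The product graph operation `· ←1 · ←2 ·`; the left vertex is the output. -/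
def prodOp : GraphOp 2 where
  V := Fin 3
  finV := inferInstance
  src := ![1, 2]
  tgt := ![0, 1]
  inp := 2
  out := 0
  conn := by
    have h0 : Relation.EqvGen
        (fun v w : Fin 3 => ∃ e, ![1, 2] e = v ∧ ![0, 1] e = w) 1 0 := .rel _ _ ⟨0, rfl, rfl⟩
    have h1 : Relation.EqvGen
        (fun v w : Fin 3 => ∃ e, ![1, 2] e = v ∧ ![0, 1] e = w) 2 1 := .rel _ _ ⟨1, rfl, rfl⟩
    have hall : ∀ x, Relation.EqvGen
        (fun v w : Fin 3 => ∃ e, ![1, 2] e = v ∧ ![0, 1] e = w) 1 x := by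
      intro x
      fin_cases x
      · exact h0
      · exact .refl _
      · exact .symm _ _ h1
    exact ⟨⟨0⟩, fun x y => .trans _ _ _ (.symm _ _ (hall x)) (hall y)⟩

/-- The transpose `· → ·`: one edge from the output to the input. -/
def transposeOp : GraphOp 1 where
  V := Fin 2
  finV := inferInstance
  src _ := 0
  tgt _ := 1
  inp := 1
  out := 0
  conn := (GraphMonomial.conn_two 0 1 (by decide)).reindex

/-- The degree: one edge from a vertex, which is both input and output, to another vertex. -/
def degOp : GraphOp 1 where
  V := Fin 2
  finV := inferInstance
  src _ := 0
  tgt _ := 1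
  inp := 0
  out := 0
  conn := (GraphMonomial.conn_two 0 1 (by decide)).reindex

end GraphOp

/-! ### The algebra of `2`-graph polynomials -/

namespace GraphMonomial

variable {J : Type u}

/-- The vertices of the product: the input of `t` is identified with the output of `s`. -/
def GlueRel (t s : GraphMonomial J 2) (x y : t.V ⊕ s.V) : Prop :=
  x = .inl t.inp ∧ y = .inr s.out

theorem glue_conn (t s : GraphMonomial J 2) :
    GraphConnected
      (fun e : t.E ⊕ s.E => Quot.mk (GlueRel t s) (Sum.map t.src s.src e))
      (fun e => Quot.mk (GlueRel t s) (Sum.map t.tgt s.tgt e)) := by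
  set R : Quot (GlueRel t s) → Quot (GlueRel t s) → Prop := fun v w =>
    ∃ e : t.E ⊕ s.E, Quot.mk (GlueRel t s) (Sum.map t.src s.src e) = v ∧
      Quot.mk (GlueRel t s) (Sum.map t.tgt s.tgt e) = w with hR
  have hl : ∀ x y, Relation.EqvGen R (Quot.mk _ (.inl x)) (Quot.mk _ (.inl y)) := fun x y => by
    refine eqvGen_of_map (fun x => Quot.mk (GlueRel t s) (.inl x)) ?_ (t.conn.2 x y)
    rintro _ _ ⟨e, rfl, rfl⟩
    exact .rel _ _ ⟨.inl e, rfl, rfl⟩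
  have hr : ∀ x y, Relation.EqvGen R (Quot.mk _ (.inr x)) (Quot.mk _ (.inr y)) := fun x y => by
    refine eqvGen_of_map (fun x => Quot.mk (GlueRel t s) (.inr x)) ?_ (s.conn.2 x y)
    rintro _ _ ⟨e, rfl, rfl⟩
    exact .rel _ _ ⟨.inr e, rfl, rfl⟩
  have hall : ∀ x, Relation.EqvGen R (Quot.mk _ (.inl t.inp)) x := by
    rintro ⟨x | x⟩
    · exact hl _ _
    · have h2 := hr s.out x
      rwa [← Quot.sound (r := GlueRel t s) (a := .inl t.inp) ⟨rfl, rfl⟩] at h2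
  exact ⟨⟨Quot.mk _ (.inl t.inp)⟩, fun x y => .trans _ _ _ (.symm _ _ (hall x)) (hall y)⟩

/-- The product of two `2`-graph monomials. -/
def glue (t s : GraphMonomial J 2) : GraphMonomial J 2 where
  V := Quot (GlueRel t s)
  E := t.E ⊕ s.E
  finV := by
    have := t.finV
    have := s.finV
    infer_instance
  finE := by
    have := t.finE
    have := s.finE
    infer_instance
  src e := Quot.mk _ (Sum.map t.src s.src e)
  tgt e := Quot.mk _ (Sum.map t.tgt s.tgt e)
  label := Sum.elim t.label s.label
  port := ![Quot.mk _ (.inl t.out), Quot.mk _ (.inr s.inp)]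
  conn := glue_conn t s

theorem glue_iso {t t' s s' : GraphMonomial J 2} (ht : Iso t t') (hs : Iso s s') :
    Iso (t.glue s) (t'.glue s') := by
  obtain ⟨f, g, h1, h2, h3, h4⟩ := ht
  obtain ⟨f', g', h1', h2', h3', h4'⟩ := hs
  refine ⟨Quot.congr (Equiv.sumCongr f f') fun x y => ?_, Equiv.sumCongr g g', ?_, ?_, ?_, ?_⟩
  · have inj := (Equiv.sumCongr f f').injective
    have e1 : Sum.inl t'.inp = Equiv.sumCongr f f' (.inl t.inp) := congrArg Sum.inl (h4 1)
    have e2 : Sum.inr s'.out = Equiv.sumCongr f f' (.inr s.out) := congrArg Sum.inr (h4' 0)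
    unfold GlueRel
    rw [e1, e2, inj.eq_iff, inj.eq_iff]
  · rintro (e | e)
    · exact congrArg (fun v => Quot.mk (GlueRel t' s') (.inl v)) (h1 e)
    · exact congrArg (fun v => Quot.mk (GlueRel t' s') (.inr v)) (h1' e)
  · rintro (e | e)
    · exact congrArg (fun v => Quot.mk (GlueRel t' s') (.inl v)) (h2 e)
    · exact congrArg (fun v => Quot.mk (GlueRel t' s') (.inr v)) (h2' e)
  · rintro (e | e)
    · exact h3 e
    · exact h3' e
  · intro i
    fin_cases i
    · exact congrArg (fun v => Quot.mk (GlueRel t' s') (.inl v)) (h4 0)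
    · exact congrArg (fun v => Quot.mk (GlueRel t' s') (.inr v)) (h4' 1)

theorem glue_assoc (t s r : GraphMonomial J 2) :
    Iso ((t.glue s).glue r) (t.glue (s.glue r)) := by
  refine ⟨⟨Quot.lift (Sum.elim (Quot.lift (Sum.elim
        (fun x => Quot.mk _ (.inl x)) (fun x => Quot.mk _ (.inr (Quot.mk _ (.inl x))))) ?_)
        (fun x => Quot.mk _ (.inr (Quot.mk _ (.inr x))))) ?_,
      Quot.lift (Sum.elim (fun x => Quot.mk _ (.inl (Quot.mk _ (.inl x))))
        (Quot.lift (Sum.elim (fun x => Quot.mk _ (.inl (Quot.mk _ (.inr x))))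
          (fun x => Quot.mk _ (.inr x))) ?_)) ?_, ?_, ?_⟩,
    Equiv.sumAssoc _ _ _, ?_, ?_, ?_, ?_⟩
  · rintro _ _ ⟨rfl, rfl⟩
    exact Quot.sound ⟨rfl, rfl⟩
  · rintro _ _ ⟨rfl, rfl⟩
    exact congrArg (fun v => Quot.mk (GlueRel t (s.glue r)) (.inr v))
      (Quot.sound (r := GlueRel s r) ⟨rfl, rfl⟩)
  · rintro _ _ ⟨rfl, rfl⟩
    exact Quot.sound ⟨rfl, rfl⟩
  · rintro _ _ ⟨rfl, rfl⟩
    exact congrArg (fun v => Quot.mk (GlueRel (t.glue s) r) (.inl v))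
      (Quot.sound (r := GlueRel t s) ⟨rfl, rfl⟩)
  · rintro ⟨x | x⟩
    · obtain ⟨x⟩ := x
      rcases x with x | x <;> rfl
    · rfl
  · rintro ⟨x | x⟩
    · rfl
    · obtain ⟨x⟩ := x
      rcases x with x | x <;> rfl
  · rintro ((e | e) | e) <;> rfl
  · rintro ((e | e) | e) <;> rfl
  · rintro ((e | e) | e) <;> rfl
  · intro i
    fin_cases i <;> rfl

theorem unit_glue (t : GraphMonomial J 2) : Iso ((unit J).glue t) t := by
  refine ⟨⟨Quot.lift (Sum.elim (fun _ => t.out) id) ?_, fun x => Quot.mk _ (.inr x), ?_,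
    fun _ => rfl⟩, Equiv.emptySum Empty t.E, ?_, ?_, ?_, ?_⟩
  · rintro _ _ ⟨rfl, rfl⟩
    rfl
  · rintro ⟨x | x⟩
    · exact (Quot.sound (r := GlueRel (unit J) t) ⟨rfl, rfl⟩).symm
    · rfl
  · rintro (e | e)
    · exact e.elim
    · rfl
  · rintro (e | e)
    · exact e.elim
    · rfl
  · rintro (e | e)
    · exact e.elim
    · rfl
  · intro i
    fin_cases i <;> rfl

theorem glue_unit (t : GraphMonomial J 2) : Iso (t.glue (unit J)) t := by
  refine ⟨⟨Quot.lift (Sum.elim id (fun _ => t.inp)) ?_, fun x => Quot.mk _ (.inl x), ?_,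
    fun _ => rfl⟩, Equiv.sumEmpty t.E Empty, ?_, ?_, ?_, ?_⟩
  · rintro _ _ ⟨rfl, rfl⟩
    rfl
  · rintro ⟨x | x⟩
    · rfl
    · exact Quot.sound (r := GlueRel t (unit J)) ⟨rfl, rfl⟩
  · rintro (e | e)
    · rfl
    · exact e.elim
  · rintro (e | e)
    · rfl
    · exact e.elim
  · rintro (e | e)
    · rfl
    · exact e.elim
  · intro i
    fin_cases i <;> rfl

/-- The product `glue` is the substitution in the product graph operation. -/
theorem subst_prodOp (t s : GraphMonomial J 2) :
    Iso (GraphOp.prodOp.subst ![t, s]) (t.glue s) := by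
  refine ⟨⟨Quot.lift (Sum.elim
      (![Quot.mk _ (.inl t.out), Quot.mk _ (.inl t.inp), Quot.mk _ (.inr s.inp)])
      (fun x => match x with
        | ⟨0, v⟩ => Quot.mk _ (.inl v)
        | ⟨1, v⟩ => Quot.mk _ (.inr v))) ?_,
      Quot.lift (Sum.elim (fun v => Quot.mk _ (.inr ⟨0, v⟩)) (fun v => Quot.mk _ (.inr ⟨1, v⟩))) ?_,
      ?_, ?_⟩,
    ⟨fun x => match x with
        | ⟨0, e⟩ => .inl e
        | ⟨1, e⟩ => .inr e,
      Sum.elim (fun e => ⟨0, e⟩) (fun e => ⟨1, e⟩), ?_, ?_⟩, ?_, ?_, ?_, ?_⟩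
  · rintro _ _ (k | k) <;> fin_cases k
    · rfl
    · rfl
    · rfl
    · exact Quot.sound (r := GlueRel t s) ⟨rfl, rfl⟩
  · rintro _ _ ⟨rfl, rfl⟩
    exact (Quot.sound (GraphOp.SubstRel.source (g := GraphOp.prodOp) (t := ![t, s]) 0)).symm.trans
      (Quot.sound (GraphOp.SubstRel.target (g := GraphOp.prodOp) (t := ![t, s]) 1))
  · rintro ⟨x | ⟨k, x⟩⟩
    · change Fin 3 at x
      fin_cases x
      · exact (Quot.sound
          (GraphOp.SubstRel.target (g := GraphOp.prodOp) (t := ![t, s]) 0)).symm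
      · exact (Quot.sound
          (GraphOp.SubstRel.source (g := GraphOp.prodOp) (t := ![t, s]) 0)).symm
      · exact (Quot.sound
          (GraphOp.SubstRel.source (g := GraphOp.prodOp) (t := ![t, s]) 1)).symm
    · fin_cases k <;> rfl
  · rintro ⟨x | x⟩ <;> rfl
  · rintro ⟨k, e⟩
    fin_cases k <;> rfl
  · rintro (e | e) <;> rfl
  · rintro ⟨k, e⟩
    fin_cases k <;> rfl
  · rintro ⟨k, e⟩
    fin_cases k <;> rfl
  · rintro ⟨k, e⟩
    fin_cases k <;> rfl
  · intro i
    fin_cases i <;> rfl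

end GraphMonomial

namespace GraphClass

variable {J : Type u}

instance : Monoid (GraphClass J 2) where
  mul := Quotient.map₂ GraphMonomial.glue fun _ _ h _ _ h' => GraphMonomial.glue_iso h h'
  one := (GraphMonomial.unit J).cls
  mul_assoc := by
    rintro ⟨t⟩ ⟨s⟩ ⟨r⟩
    exact Quotient.sound (GraphMonomial.glue_assoc t s r)
  one_mul := by
    rintro ⟨t⟩
    exact Quotient.sound (GraphMonomial.unit_glue t)
  mul_one := by
    rintro ⟨t⟩
    exact Quotient.sound (GraphMonomial.glue_unit t)

theorem mul_eq_substCls (x y : GraphClass J 2) : x * y = GraphOp.prodOp.substCls ![x, y] := by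
  obtain ⟨t, rfl⟩ := Quotient.exists_rep x
  obtain ⟨s, rfl⟩ := Quotient.exists_rep y
  have h : (![Quotient.mk _ t, Quotient.mk _ s] : Fin 2 → GraphClass J 2) =
      fun k => (![t, s] k : GraphMonomial J 2).cls := by
    funext k
    fin_cases k <;> rfl
  rw [h, GraphOp.substCls_cls]
  exact (Quotient.sound (GraphMonomial.subst_prodOp t s)).symm

end GraphClass

/-- The algebra of `2`-graph polynomials indexed by `J`: finite linear combinations of `2`-graph
monomials, with the product given by the product graph operation. -/
abbrev GraphAlgebra (J : Type u) := MonoidAlgebra ℂ (GraphClass J 2)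

/-- The `2`-graph polynomial given by a single `2`-graph monomial. -/
noncomputable def GraphMonomial.toPoly {J : Type u} (t : GraphMonomial J 2) : GraphAlgebra J :=
  MonoidAlgebra.single t.cls 1

namespace GraphOp

variable {J : Type u} {K : ℕ}

open Classical in
/-- The action `Z_g` of a graph operation on `2`-graph polynomials: the multilinear extension of
the substitution of graph monomials. -/
noncomputable def act (g : GraphOp K) :
    MultilinearMap ℂ (fun _ : Fin K => GraphAlgebra J) (GraphAlgebra J) :=
  (((MonoidAlgebra.coeffLinearEquiv ℂ).symm.toLinearMap ∘ₗ Finsupp.lmapDomain ℂ ℂ g.substCls ∘ₗ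
    (PiTensorProduct.ofFinsuppEquiv' (R := ℂ) (κ := fun _ : Fin K => GraphClass J 2)).toLinearMap
      ).compMultilinearMap (PiTensorProduct.tprod ℂ)).compLinearMap
    fun _ => (MonoidAlgebra.coeffLinearEquiv ℂ).toLinearMap

theorem act_single (g : GraphOp K) (x : Fin K → GraphClass J 2) (c : Fin K → ℂ) :
    g.act (fun k => MonoidAlgebra.single (x k) (c k)) =
      MonoidAlgebra.single (g.substCls x) (∏ k, c k) := by
  have h : ∀ k, MonoidAlgebra.coeffLinearEquiv ℂ (MonoidAlgebra.single (x k) (c k)) =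
      Finsupp.single (x k) (c k) := fun _ => rfl
  simp only [act, MultilinearMap.compLinearMap_apply, LinearMap.compMultilinearMap_apply,
    LinearMap.comp_apply, LinearEquiv.coe_coe, h, PiTensorProduct.ofFinsuppEquiv'_tprod_single,
    Finsupp.lmapDomain_apply, Finsupp.mapDomain_single]
  rfl

end GraphOp

/-! ### The free `𝒢`-algebra generated by an algebra -/

section FreeGAlgebra

variable (A : Type u) [Ring A] [Algebra ℂ A]

/-- The relations defining the free `𝒢`-algebra: in `Z_g` applied to edges, an edge labelled by
`P(a₁, …, aₖ)` may be replaced by `P` evaluated at the edges labelled `a₁, …, aₖ`. -/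
inductive FreeRel : GraphAlgebra A → GraphAlgebra A → Prop
  | intro {K k : ℕ} (g : GraphOp K) (i : Fin K) (b : Fin K → A) (P : FreeAlgebra ℂ (Fin k))
      (a : Fin k → A) :
      FreeRel
        (g.act (Function.update (fun j => (GraphMonomial.edge (b j)).toPoly) i
          (GraphMonomial.edge (FreeAlgebra.lift ℂ a P)).toPoly))
        (g.act (Function.update (fun j => (GraphMonomial.edge (b j)).toPoly) i
          (FreeAlgebra.lift ℂ (fun l => (GraphMonomial.edge (a l)).toPoly) P)))

/-- The algebra `𝒢(A)`: the quotient of the algebra of `2`-graph polynomials indexed by `A` by the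
relations `FreeRel`. Multiplying both sides of a relation by a graph monomial gives a relation
again (with a larger `g`), so the ideal generated by the relations is their linear span. -/
abbrev FreeGAlgebra := RingQuot (FreeRel A)

variable {A}

/-- The quotient map onto `𝒢(A)`. -/
noncomputable def toFreeGAlgebra : GraphAlgebra A →ₐ[ℂ] FreeGAlgebra A :=
  RingQuot.mkAlgHom ℂ (FreeRel A)

/-- The canonical image of `a` in `𝒢(A)`: the class of `· ←a ·`. -/
noncomputable def FreeGAlgebra.of (a : A) : FreeGAlgebra A :=
  toFreeGAlgebra (GraphMonomial.edge a).toPoly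

/-- The transpose of `a` in `𝒢(A)`: the graph operation `· → ·` applied to `a`. -/
noncomputable def FreeGAlgebra.transpose (a : A) : FreeGAlgebra A :=
  toFreeGAlgebra (GraphOp.transposeOp.act fun _ => (GraphMonomial.edge a).toPoly)

/-- The degree of `a` in `𝒢(A)`: the graph operation `deg` applied to `a`. -/
noncomputable def FreeGAlgebra.deg (a : A) : FreeGAlgebra A :=
  toFreeGAlgebra (GraphOp.degOp.act fun _ => (GraphMonomial.edge a).toPoly)

end FreeGAlgebra

/-! ### Free cumulants -/

section Cumulants

/-- A partition of `{1, …, n}` is non-crossing if there are no `i < j < k < l` with `i, k` in one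
block and `j, l` in another one. -/
def NonCrossing {n : ℕ} (π : Finpartition (Finset.univ : Finset (Fin n))) : Prop :=
  ∀ i j k l : Fin n, i < j → j < k → k < l → ∀ B ∈ π.parts, ∀ C ∈ π.parts,
    i ∈ B → k ∈ B → j ∈ C → l ∈ C → B = C

variable {A : Type u} [Ring A] [Algebra ℂ A]

open Classical in
/-- The free cumulants `κ(a₁, …, aₙ)`, `n ≥ 1`: the moment-cumulant formula
`Φ(a₁ ⋯ aₙ) = ∑_{π ∈ NC(n)} ∏_{B ∈ π} κ(a_B)` solved for the term of the one-block partition. -/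
noncomputable def freeCumulant (Φ : A →ₗ[ℂ] ℂ) (n : ℕ) (a : Fin n → A) : ℂ :=
  Φ (List.ofFn a).prod -
    ∑ π : {π : Finpartition (Finset.univ : Finset (Fin n)) //
        NonCrossing π ∧ Finset.univ ∉ π.parts},
      ∏ B : {B // B ∈ π.1.parts},
        freeCumulant Φ B.1.card fun i => a (B.1.orderEmbOfFin rfl i)
termination_by n
decreasing_by
  have h : B.1 ≠ Finset.univ := fun h => π.2.2 ((congrArg (· ∈ π.1.parts) h).mp B.2)
  simpa using (Finset.card_lt_iff_ne_univ B.1).2 h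

open Classical in
/-- The implicit definition of the free cumulants. -/
theorem moment_cumulant (Φ : A →ₗ[ℂ] ℂ) (n : ℕ) (hn : n ≠ 0) (a : Fin n → A) :
    Φ (List.ofFn a).prod =
      ∑ π : {π : Finpartition (Finset.univ : Finset (Fin n)) // NonCrossing π},
      ∏ B : {B // B ∈ π.1.parts}, freeCumulant Φ B.1.card fun i => a (B.1.orderEmbOfFin rfl i) := by
  have hne : (Finset.univ : Finset (Fin n)) ≠ ⊥ := by
    have : NeZero n := ⟨hn⟩
    exact Finset.univ_nonempty.ne_empty
  set F : Finpartition (Finset.univ : Finset (Fin n)) → ℂ := fun π => ∏ B : {B // B ∈ π.parts}, freeCumulant Φ B.1.card fun i => a (B.1.orderEmbOfFin rfl i) with hF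
  have hone : ∀ π : Finpartition (Finset.univ : Finset (Fin n)), Finset.univ ∈ π.parts ↔ π = Finpartition.indiscrete hne := by
    intro π
    constructor
    · intro h
      ext B
      simp only [Finpartition.indiscrete, Finset.mem_singleton]
      constructor
      · intro hB
        by_contra hc
        have := π.disjoint hB h hc
        have hB' := π.ne_bot hB
        exact hB' (this.eq_bot_of_le (Finset.subset_univ B))
      · rintro rfl; exact h
    · rintro rfl; simp [Finpartition.indiscrete]
  have hNC : NonCrossing (Finpartition.indiscrete hne) := by
    intro i j k l _ _ _ B hB C hC _ _ _ _
    simp [Finpartition.indiscrete] at hB hC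
    rw [hB, hC]
  have h1 : F (Finpartition.indiscrete hne) = freeCumulant Φ n a := by
    simp only [hF]
    have : ∀ B : {B // B ∈ (Finpartition.indiscrete hne).parts}, B = ⟨Finset.univ, by simp [Finpartition.indiscrete]⟩ := by
      rintro ⟨B, hB⟩
      simp [Finpartition.indiscrete] at hB
      simp [hB]
    rw [Fintype.prod_eq_single ⟨Finset.univ, by simp [Finpartition.indiscrete]⟩ (fun B hB => absurd (this B) hB)]
    have key : ∀ (m : ℕ) (h : (Finset.univ : Finset (Fin n)).card = m), freeCumulant Φ m (fun i => a (Finset.univ.orderEmbOfFin h i)) = freeCumulant Φ n a := by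
      intro m h
      obtain rfl : n = m := by simpa using h
      congr 1
      funext i
      congr 1
      have := Finset.orderEmbOfFin_unique (s := (Finset.univ : Finset (Fin n))) h (f := id) (by simp) strictMono_id
      exact (congrFun this i).symm
    exact key _ rfl
  have h2 : ∑ π : {π // NonCrossing π}, F π.1 = ∑ π ∈ Finset.univ.filter NonCrossing, F π := by
    exact (Finset.sum_subtype (Finset.univ.filter NonCrossing) (by simp) F).symm
  have h3 : ∑ π : {π // NonCrossing π ∧ Finset.univ ∉ π.parts}, F π.1 = ∑ π ∈ (Finset.univ.filter NonCrossing).erase (Finpartition.indiscrete hne), F π := by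
    symm
    rw [Finset.sum_subtype]
    intro π
    simp only [Finset.mem_erase, Finset.mem_filter, Finset.mem_univ, true_and]
    rw [hone, and_comm]
  have h4 := Finset.add_sum_erase (Finset.univ.filter NonCrossing) F (a := Finpartition.indiscrete hne) (by simpa using hNC)
  have h5 : freeCumulant Φ n a = Φ (List.ofFn a).prod - ∑ π : {π // NonCrossing π ∧ Finset.univ ∉ π.parts}, F π.1 := by
    rw [freeCumulant]
  show _ = ∑ π : {π // NonCrossing π}, F π.1
  rw [h2, ← h4, h1, ← h3, h5]; ring

end Cumulants

/-! ### The distribution of traffics `τ_Φ` -/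

namespace GraphMonomial

variable {J : Type u} {n : ℕ} (t : GraphMonomial J n)

/-- `C` is the edge set of a (simple) cycle of `t`, the orientation of the edges being ignored.
A loop is a cycle of length one, two parallel or opposite edges are a cycle of length two. -/
def IsCycle (C : Set t.E) : Prop :=
  ∃ (m : ℕ) (e : Fin (m + 1) → t.E) (v : Fin (m + 1) → t.V),
    Function.Injective e ∧ Function.Injective v ∧ Set.range e = C ∧
    ∀ i, (t.src (e i) = v i ∧ t.tgt (e i) = v (i + 1)) ∨
      (t.src (e i) = v (i + 1) ∧ t.tgt (e i) = v i)

/-- `e 0, …, e m` is a cyclic enumeration `· ←(e 0) · ←(e 1) · ⋯ · ←(e m) ·` of the edges of an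
oriented cycle, listed in the order in which a product of their labels is written. -/
def IsOrientedListing {m : ℕ} (e : Fin (m + 1) → t.E) : Prop :=
  Function.Injective e ∧ Function.Injective (fun i => t.tgt (e i)) ∧
    ∀ i, t.src (e i) = t.tgt (e (i + 1))

/-- `C` is the edge set of an oriented cycle. -/
def IsOrientedCycle (C : Set t.E) : Prop :=
  ∃ p : (m : ℕ) × (Fin (m + 1) → t.E), t.IsOrientedListing p.2 ∧ Set.range p.2 = C

/-- A cactus: every edge belongs to exactly one cycle. -/
def IsCactus : Prop :=
  ∀ e : t.E, ∃! C : Set t.E, t.IsCycle C ∧ e ∈ C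

end GraphMonomial

section Distribution

variable {A : Type u} [Ring A] [Algebra ℂ A]

open Classical in
/-- `κ(a₁, …, aₙ)` where `a₁, …, aₙ` are the labels along the oriented cycle `C`. The starting
point is irrelevant when `Φ` is a trace. -/
noncomputable def cycleCumulant (Φ : A →ₗ[ℂ] ℂ) (t : GraphMonomial A 0) (C : Set t.E) : ℂ :=
  if h : t.IsOrientedCycle C then
    freeCumulant Φ (h.choose.1 + 1) fun i => t.label (h.choose.2 i)
  else 0

open Classical in
/-- The injective version `τ⁰_Φ` of `τ_Φ` on `0`-graph monomials. -/
noncomputable def injTau (Φ : A →ₗ[ℂ] ℂ) (t : GraphMonomial A 0) : ℂ :=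
  if t.IsCactus ∧ ∀ C, t.IsCycle C → t.IsOrientedCycle C then
    ∏ᶠ C : {C : Set t.E // t.IsCycle C}, cycleCumulant Φ t C.1
  else 0

/-- `τ_Φ[t] = ∑_π τ⁰_Φ[t^π]`, the sum being over all partitions `π` of the (finite) vertex set. -/
noncomputable def tauMonomial (Φ : A →ₗ[ℂ] ℂ) (t : GraphMonomial A 0) : ℂ :=
  ∑ᶠ π : Setoid t.V, injTau Φ (t.quot π)

/-- The distribution of traffics `τ_Φ`, as a linear form on `0`-graph polynomials. It is evaluated
on a representative of the isomorphism class; the choice is irrelevant when `Φ` is a trace. -/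
noncomputable def tau (Φ : A →ₗ[ℂ] ℂ) : (GraphClass A 0 →₀ ℂ) →ₗ[ℂ] ℂ :=
  Finsupp.linearCombination ℂ fun x : GraphClass A 0 => tauMonomial Φ (Quotient.out x)

/-- Identify input and output in a `2`-graph polynomial and forget them. -/
noncomputable def closePoly : GraphAlgebra A →ₗ[ℂ] (GraphClass A 0 →₀ ℂ) :=
  Finsupp.lmapDomain ℂ ℂ (Quotient.map GraphMonomial.close fun _ _ h => GraphMonomial.close_iso h)
    ∘ₗ (MonoidAlgebra.coeffLinearEquiv ℂ).toLinearMap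

/-- The linear form on `2`-graph polynomials associated with `τ_Φ`. -/
noncomputable def trafficTrace (Φ : A →ₗ[ℂ] ℂ) : GraphAlgebra A →ₗ[ℂ] ℂ :=
  tau Φ ∘ₗ closePoly

end Distribution

/-! ### Freeness -/

/-- Freeness in the sense of Voiculescu of a family of unital subalgebras with respect to a linear
form `φ`: `φ(c₀ ⋯ cₙ) = 0` whenever all `φ(cₖ) = 0` and neighbouring factors come from
different subalgebras. -/
def AreFree {B ι : Type*} [Ring B] [Algebra ℂ B] (φ : B →ₗ[ℂ] ℂ) (S : ι → Subalgebra ℂ B) : Prop :=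
  ∀ (n : ℕ) (i : Fin (n + 1) → ι) (c : Fin (n + 1) → B),
    (∀ k : Fin n, i k.castSucc ≠ i k.succ) → (∀ k, c k ∈ S (i k)) → (∀ k, φ (c k) = 0) →
      φ (List.ofFn c).prod = 0

end Traffic

set_option linter.unusedSectionVars false

/-! The sum over vertex partitions defining `τ_Φ` becomes a sum over permutations of the edges. In
an oriented cactus each edge `e` has a successor `σ e` in the cyclic product along its cycle, so
that `src e = tgt (σ e)`. Conversely, a permutation `σ` of the edges of a connected graph imposes
the smallest vertex identification with this property. Joining each edge's target to the `σ`-cycle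
of that edge gives a connected incidence graph, hence (number of classes) + (number of cycles) ≤
(number of edges) + 1. Equality (`Tight`) says that the incidence graph is a tree, that is, the
quotient is a cactus whose cycles are those of `σ`. Each tight `σ` comes from exactly one partition,
so `τ_Φ[T]` is the sum over tight `σ` of the product of the cumulants along its cycles
(`tauMonomial_eq`). Almost every combinatorial step then uses `Tight.exists_cut`: removing two edges
of one `σ`-cycle disconnects the quotient.

Why `Ψ` descends to `𝒢(A)`. An edge labelled `ab` may be subdivided into two edges
(`permTau_subdivide`): the tight permutations of the subdivision arise from those of the original
graph either by inserting the new half-edge after the old one or by then splitting the cycle so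
obtained, and summing them gives the formula for a free cumulant with a product as entry. An edge
labelled `1` may be contracted, and values are linear in each label. Since this holds inside any
surrounding graph, the edges satisfy the relations of `A` modulo the ideal of elements killed by
every context (`edgeHom`), and all relations of `𝒢(A)` lie in that ideal.

The list cumulants `cum` are defined by the product formula. To compare them with `freeCumulant`,
evaluate an oriented cycle twice: merging its edges gives the moment of the product of the labels,
while its tight permutations are the non-crossing partitions (`tight_cycle_iff`). Hence `cum`
satisfies the moment-cumulant formula, whose solution is unique (`freeCumulant_eq_cum`).

Freeness. A tight permutation must fix a pendant edge attached at the root of an anchored graph, so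
`Ψ(xd) = Ψ(x)Ψ(d)` for `d` in the degree algebra (`trivial_functional_mul_degAlg`); with traciality,
a centred degree factor kills the word. Without degree factors, each letter is modulo null elements
a single edge or reversed edge with centred label, and the closed word is a cycle with alternating
orientations. There every tight permutation has a fixed point (`Tight.exists_fixed`), which
contributes a factor `Φ(a k) = 0`. -/

namespace Traffic

/-! ### Cumulants of lists -/

section ListCumulant

variable {A : Type u}

/-- The sum of `f u v` over all decompositions `w = u ++ v`. -/
def splitSum (f : List A → List A → ℂ) : List A → ℂ
  | [] => f [] []
  | a :: w => f [] (a :: w) + splitSum (fun u v => f (a :: u) v) w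

theorem splitSum_eq_sum (f : List A → List A → ℂ) (w : List A) :
    splitSum f w = ∑ i ∈ Finset.range (w.length + 1), f (w.take i) (w.drop i) := by
  induction w generalizing f with
  | nil => simp [splitSum]
  | cons a w ih =>
    rw [splitSum, ih, List.length_cons, Finset.sum_range_succ' _ (w.length + 1), add_comm]
    simp

theorem splitSum_congr {f g : List A → List A → ℂ} {w : List A}
    (h : ∀ u v, u ++ v = w → f u v = g u v) : splitSum f w = splitSum g w := by
  rw [splitSum_eq_sum, splitSum_eq_sum]
  exact Finset.sum_congr rfl fun i _ => h _ _ (List.take_append_drop i w)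

theorem splitSum_add (f g : List A → List A → ℂ) (w : List A) :
    splitSum (fun u v => f u v + g u v) w = splitSum f w + splitSum g w := by
  simp only [splitSum_eq_sum, Finset.sum_add_distrib]

theorem splitSum_mul_right (f : List A → List A → ℂ) (c : ℂ) (w : List A) :
    splitSum (fun u v => f u v * c) w = splitSum f w * c := by
  simp only [splitSum_eq_sum, Finset.sum_mul]

theorem splitSum_mul_left (f : List A → List A → ℂ) (c : ℂ) (w : List A) :
    splitSum (fun u v => c * f u v) w = c * splitSum f w := by
  simp only [splitSum_eq_sum, Finset.mul_sum]

theorem splitSum_concat (f : List A → List A → ℂ) (w : List A) (a : A) :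
    splitSum f (w ++ [a]) = splitSum (fun u v => f u (v ++ [a])) w + f (w ++ [a]) [] := by
  induction w generalizing f with
  | nil => simp [splitSum]
  | cons b w ih => simp only [List.cons_append, splitSum, ih, add_assoc]

/-- Both sides run over the cuts of `w` into three consecutive pieces. -/
theorem splitSum_splitSum (f : List A → List A → List A → ℂ) (w : List A) :
    splitSum (fun u v => splitSum (fun v' v'' => f u v' v'') v) w =
      splitSum (fun u v => splitSum (fun u' u'' => f u' u'' v) u) w := by
  induction w generalizing f with
  | nil => rfl
  | cons a w ih =>
    have h : splitSum (fun u v => splitSum (fun u' u'' => f u' u'' v) (a :: u)) w =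
        splitSum (fun u v => f [] (a :: u) v) w +
          splitSum (fun u v => splitSum (fun u' u'' => f (a :: u') u'' v) u) w := by
      rw [← splitSum_add]
      rfl
    simp only [splitSum] at h ⊢
    rw [h, ih fun u v v' => f (a :: u) v v']
    ring

variable [Ring A] [Algebra ℂ A]

/-- The free cumulants as a function of lists, defined by the formula for cumulants with a product
of two elements as one of the entries. -/
noncomputable def cum (Φ : A →ₗ[ℂ] ℂ) : List A → ℂ
  | [] => 0
  | [a] => Φ a
  | a :: b :: w => cum Φ (a * b :: w) -
      ∑ i ∈ Finset.range (w.length + 1), cum Φ (b :: w.take i) * cum Φ (a :: w.drop i)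
termination_by l => l.length
decreasing_by
  all_goals simp only [List.length_cons, List.length_take, List.length_drop]; omega

variable (Φ : A →ₗ[ℂ] ℂ)

@[simp] theorem cum_singleton (a : A) : cum Φ [a] = Φ a := by rw [cum]

theorem cum_cons_cons (a b : A) (w : List A) :
    cum Φ (a :: b :: w) =
      cum Φ (a * b :: w) - splitSum (fun u v => cum Φ (b :: u) * cum Φ (a :: v)) w := by
  rw [cum, splitSum_eq_sum]

/-- The product formula: either `a` and `b` stay in one block, or the cyclic word splits into the
part starting at `b` and the part starting at `a`. It is matched term by term with the permutations
of a subdivided graph. -/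
theorem cum_mul_cons (a b : A) (w : List A) :
    cum Φ (a * b :: w) = cum Φ (a :: b :: w) +
      splitSum (fun u v => cum Φ (b :: u) * cum Φ (a :: v)) w := by
  rw [cum_cons_cons]; ring

/-- Linearity in the first entry is enough: cyclic invariance brings any entry to the front. -/
theorem cum_add_cons (a a' : A) (w : List A) :
    cum Φ ((a + a') :: w) = cum Φ (a :: w) + cum Φ (a' :: w) := by
  induction hn : w.length using Nat.strong_induction_on generalizing a a' w with
  | _ n ih =>
  cases w with
  | nil => simp
  | cons b w =>
    simp only [cum_cons_cons, add_mul]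
    have h : splitSum (fun u v => cum Φ (b :: u) * cum Φ ((a + a') :: v)) w =
        splitSum (fun u v => cum Φ (b :: u) * cum Φ (a :: v)) w +
          splitSum (fun u v => cum Φ (b :: u) * cum Φ (a' :: v)) w := by
      rw [← splitSum_add]
      refine splitSum_congr fun u v huv => ?_
      have := congrArg List.length huv
      simp only [List.length_append, List.length_cons] at this hn
      rw [ih v.length (by omega) _ _ v rfl, mul_add]
    rw [h, ih w.length (by simp at hn; omega) _ _ w rfl]
    ring

theorem cum_smul_cons (c : ℂ) (a : A) (w : List A) :
    cum Φ (c • a :: w) = c * cum Φ (a :: w) := by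
  induction hn : w.length using Nat.strong_induction_on generalizing a w with
  | _ n ih =>
  cases w with
  | nil => simp
  | cons b w =>
    simp only [cum_cons_cons, smul_mul_assoc]
    have h : splitSum (fun u v => cum Φ (b :: u) * cum Φ (c • a :: v)) w =
        c * splitSum (fun u v => cum Φ (b :: u) * cum Φ (a :: v)) w := by
      rw [← splitSum_mul_left]
      refine splitSum_congr fun u v huv => ?_
      have := congrArg List.length huv
      simp only [List.length_append, List.length_cons] at this hn
      rw [ih v.length (by omega) _ v rfl]
      ring
    rw [h, ih w.length (by simp at hn; omega) _ w rfl]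
    ring

variable {Φ}

/-- In the recursion for `1 :: b :: w` all splittings with nonempty second piece vanish by
induction. The remaining one is `cum (b :: w) * Φ 1`, which cancels the merged term `cum (1 * b ::
w)`. Writing `w` with its last letter isolates that splitting. -/
theorem cum_one_cons_cons (h1 : Φ 1 = 1) (b : A) (w : List A) : cum Φ (1 :: b :: w) = 0 := by
  induction hn : w.length using Nat.strong_induction_on generalizing b w with
  | _ n ih =>
  rw [cum_cons_cons, one_mul]
  rcases w.eq_nil_or_concat with rfl | ⟨w, c, rfl⟩
  · simp [splitSum, h1]
  · simp only [List.concat_eq_append] at hn ⊢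
    rw [splitSum_concat, cum_singleton, h1]
    have h : splitSum (fun u v => cum Φ (b :: u) * cum Φ (1 :: (v ++ [c]))) w =
        splitSum (fun _ _ => (0 : ℂ) * 0) w := by
      refine splitSum_congr fun u v huv => ?_
      have := congrArg List.length huv
      simp only [List.length_append, List.length_cons, List.length_nil] at this hn
      cases v with
      | nil => rw [List.nil_append, ih 0 (by omega) c [] rfl]; simp
      | cons d v =>
        rw [List.cons_append, ih (v ++ [c]).length (by simp at this ⊢; omega) _ _ rfl]; simp
    rw [h, splitSum_mul_left]
    ring

/-- Traciality enters only for words of length two. For longer words, merge the first two letters,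
apply induction to the shorter words and compare the expansions of `a * (b * c)` and `(a * b) * c`.
-/
theorem cum_concat (htr : ∀ a b : A, Φ (a * b) = Φ (b * a)) (a : A) (w : List A) :
    cum Φ (w ++ [a]) = cum Φ (a :: w) := by
  induction hn : w.length using Nat.strong_induction_on generalizing a w with
  | _ n ih =>
  match w with
  | [] => rfl
  | [b] => simp [cum_cons_cons, splitSum, htr b a, mul_comm]
  | b :: c :: w =>
    simp only [List.length_cons] at hn
    have e1 : cum Φ (b * c :: (w ++ [a])) = cum Φ (a :: b * c :: w) :=
      ih (w.length + 1) (by omega) a (b * c :: w) rfl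
    have e2 : splitSum (fun u v => cum Φ (c :: u) * cum Φ (b :: (v ++ [a]))) w =
        splitSum (fun u v => cum Φ (c :: u) * cum Φ (a :: b :: v)) w := by
      refine splitSum_congr fun u v huv => ?_
      have := congrArg List.length huv
      simp only [List.length_append] at this
      rw [show b :: (v ++ [a]) = (b :: v) ++ [a] from rfl,
        ih (v.length + 1) (by omega) a (b :: v) rfl]
    have e3 : cum Φ (c :: (w ++ [a])) = cum Φ (a :: c :: w) :=
      ih (w.length + 1) (by omega) a (c :: w) rfl
    -- The triple products of cumulants on the two sides differ only in the order in which the word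
    -- is cut.
    have e4 := splitSum_splitSum
      (fun u v v' => cum Φ (c :: u) * (cum Φ (b :: v) * cum Φ (a :: v'))) w
    simp only [List.cons_append]
    rw [cum_cons_cons, e1, splitSum_concat, e2, e3, cum_singleton, cum_cons_cons _ a (b * c),
      cum_cons_cons _ a b, splitSum, cum_cons_cons _ (a * b) c, mul_assoc]
    simp only [cum_mul_cons, mul_add, add_mul, splitSum_add, ← splitSum_mul_left,
      ← splitSum_mul_right, cum_singleton] at e4 ⊢
    rw [e4]
    simp only [mul_assoc]
    ring

/-- The cumulant of a cycle. -/
noncomputable def cycCum (Φ : A →ₗ[ℂ] ℂ) (C : Cycle A) : ℂ := cum Φ (Quotient.out C)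

theorem cum_rotate (htr : ∀ a b : A, Φ (a * b) = Φ (b * a)) (l : List A) (n : ℕ) :
    cum Φ (l.rotate n) = cum Φ l := by
  induction n generalizing l with
  | zero => simp
  | succ n ih =>
    cases l with
    | nil => simp
    | cons a l => rw [List.rotate_cons_succ, ih, cum_concat htr]

theorem cycCum_coe (htr : ∀ a b : A, Φ (a * b) = Φ (b * a)) (l : List A) :
    cycCum Φ (l : Cycle A) = cum Φ l := by
  have h : List.IsRotated (Quotient.out (l : Cycle A)) l :=
    Quotient.exact (Quotient.out_eq (l : Cycle A))
  obtain ⟨n, hn⟩ := h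
  exact (cum_rotate htr _ n).symm.trans (congrArg (cum Φ) hn)

end ListCumulant

/-! ### Cycles of permutations -/

section Cycles

open Equiv Function

variable {E : Type} {σ : Perm E}

/-- `a :: w` lists, without repetition, a cycle of the permutation `σ`. -/
def IsOrbit (σ : Perm E) (a : E) (w : List E) : Prop :=
  (a :: w).Nodup ∧ (a :: w).map σ = w ++ [a]

/-- The cycles of a permutation, fixed points included. -/
def cycles (σ : Perm E) : Set (Cycle E) := Set.range (periodicOrbit σ)

/-- The number of cycles of a permutation. -/
noncomputable def ncyc (σ : Perm E) : ℕ := (cycles σ).ncard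

theorem map_cons_append {f : E → E} {a x b : E} {s t : List E}
    (h : (a :: (s ++ x :: t)).map f = s ++ x :: t ++ [b]) :
    (a :: s).map f = s ++ [x] ∧ (x :: t).map f = t ++ [b] := by
  have h' : (a :: s).map f ++ (x :: t).map f = (s ++ [x]) ++ (t ++ [b]) := by
    simpa using h
  exact List.append_inj h' (by simp)

theorem IsOrbit.rotate {a x : E} {s t : List E} (h : IsOrbit σ a (s ++ x :: t)) :
    IsOrbit σ x (t ++ a :: s) := by
  obtain ⟨h1, h2⟩ := map_cons_append h.2
  refine ⟨?_, ?_⟩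
  · have hp : (x :: (t ++ a :: s)).Perm (a :: (s ++ x :: t)) := by
      have : ((x :: t) ++ (a :: s)).Perm ((a :: s) ++ (x :: t)) := List.perm_append_comm
      simpa using this
    exact hp.nodup_iff.2 h.1
  · have : (x :: (t ++ a :: s)).map σ = (x :: t).map σ ++ (a :: s).map σ := by simp
    rw [this, h1, h2]
    simp

/-- Either word lists the iterates of `f` from `a` on, stopping just before the first occurrence of
`b`. -/
theorem eq_of_map_cons {f : E → E} {b : E} {w : List E} : ∀ {w' : List E} {a : E},
    (a :: w).map f = w ++ [b] → (a :: w').map f = w' ++ [b] → b ∉ w → b ∉ w' → w = w' := by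
  induction w with
  | nil =>
    rintro (_ | ⟨c, w'⟩) a h h' hb hb'
    · rfl
    · simp only [List.map_cons, List.map_nil, List.nil_append, List.cons_append,
        List.cons.injEq] at h h'
      exact absurd (h.1.symm.trans h'.1) (fun e => hb' (by simp [e]))
  | cons c w ih =>
    rintro (_ | ⟨c', w'⟩) a h h' hb hb'
    · simp only [List.map_cons, List.map_nil, List.nil_append, List.cons_append,
        List.cons.injEq] at h h'
      exact absurd (h'.1.symm.trans h.1) (fun e => hb (by simp [e]))
    · rw [List.map_cons, List.cons_append, List.cons.injEq] at h h'
      obtain rfl : c = c' := h.1.symm.trans h'.1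
      rw [ih h.2 h'.2 (fun hm => hb (List.mem_cons_of_mem _ hm))
        (fun hm => hb' (List.mem_cons_of_mem _ hm))]

theorem IsOrbit.unique {a : E} {w w' : List E} (h : IsOrbit σ a w) (h' : IsOrbit σ a w') :
    w = w' :=
  eq_of_map_cons h.2 h'.2 (List.nodup_cons.1 h.1).1 (List.nodup_cons.1 h'.1).1

variable [Finite E]

theorem mem_periodicPts_perm (σ : Perm E) (e : E) : e ∈ periodicPts σ :=
  σ.injective.mem_periodicPts e

theorem exists_isOrbit (σ : Perm E) (e : E) :
    ∃ w, IsOrbit σ e w ∧ periodicOrbit σ e = ((e :: w : List E) : Cycle E) := by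
  have hpos : 0 < minimalPeriod σ e := minimalPeriod_pos_of_mem_periodicPts
    (mem_periodicPts_perm σ e)
  obtain ⟨m, hm⟩ : ∃ m, minimalPeriod σ e = m + 1 := ⟨_, (Nat.succ_pred_eq_of_pos hpos).symm⟩
  have h1 : (List.range (m + 1)).map (fun n => σ^[n] e) =
      e :: (List.range m).map (fun n => σ^[n + 1] e) := by
    rw [List.range_succ_eq_map]
    simp [comp_def]
  have h2 : periodicOrbit σ e =
      ((e :: (List.range m).map (fun n => σ^[n + 1] e) : List E) : Cycle E) := by
    rw [periodicOrbit_def, hm, h1]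
  refine ⟨_, ⟨?_, ?_⟩, h2⟩
  · have := nodup_periodicOrbit (f := σ) (x := e)
    rwa [h2, Cycle.nodup_coe_iff] at this
  · rw [← h1, List.map_map, List.range_succ, List.map_append]
    have h3 : σ^[m + 1] e = e := hm ▸ iterate_minimalPeriod
    simp only [comp_def, ← Function.iterate_succ_apply', List.map_cons, List.map_nil]
    rw [h3]

theorem IsOrbit.periodicOrbit_eq {a : E} {w : List E} (h : IsOrbit σ a w) :
    periodicOrbit σ a = ((a :: w : List E) : Cycle E) := by
  obtain ⟨w', h1, h2⟩ := exists_isOrbit σ a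
  rw [h2, h.unique h1]

theorem IsOrbit.mem_cycles {a : E} {w : List E} (h : IsOrbit σ a w) :
    ((a :: w : List E) : Cycle E) ∈ cycles σ :=
  ⟨a, h.periodicOrbit_eq⟩

theorem IsOrbit.of_mem {a x : E} {w : List E} (h : IsOrbit σ a w) (hx : x ∈ a :: w) :
    ∃ u, IsOrbit σ x u ∧ ((x :: u : List E) : Cycle E) = ((a :: w : List E) : Cycle E) := by
  rcases List.mem_cons.1 hx with rfl | hx
  · exact ⟨w, h, rfl⟩
  · obtain ⟨s, t, rfl⟩ := List.append_of_mem hx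
    refine ⟨_, h.rotate, ?_⟩
    rw [Cycle.coe_eq_coe]
    have : List.IsRotated ((x :: t) ++ (a :: s)) ((a :: s) ++ (x :: t)) :=
      List.isRotated_append
    simpa using this

theorem mem_orbit_iff {x e : E} :
    x ∈ periodicOrbit σ e ↔ periodicOrbit σ x = periodicOrbit σ e := by
  obtain ⟨w, h1, h2⟩ := exists_isOrbit σ e
  constructor
  · intro h
    rw [h2, Cycle.mem_coe_iff] at h
    obtain ⟨u, h3, h4⟩ := h1.of_mem h
    rw [h3.periodicOrbit_eq, h4, h2]
  · intro h
    rw [← h]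
    exact self_mem_periodicOrbit (mem_periodicPts_perm σ x)

theorem eq_periodicOrbit {C : Cycle E} (hC : C ∈ cycles σ) {x : E} (hx : x ∈ C) :
    C = periodicOrbit σ x := by
  obtain ⟨e, rfl⟩ := hC
  exact (mem_orbit_iff.1 hx).symm

theorem orbit_apply (σ : Perm E) (x : E) : periodicOrbit σ (σ x) = periodicOrbit σ x :=
  periodicOrbit_apply_eq (mem_periodicPts_perm σ x)

theorem apply_mem_orbit {x e : E} (h : x ∈ periodicOrbit σ e) : σ x ∈ periodicOrbit σ e := by
  rw [mem_orbit_iff] at h ⊢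
  rw [orbit_apply, h]

/-- Distinct cycles are disjoint, so no cycle can be missing from a family that covers. This is how
the cycles of every modified permutation are found. -/
theorem cycles_eq_of_cover {F : Set (Cycle E)} (hF : F ⊆ cycles σ)
    (hc : ∀ e, ∃ C ∈ F, e ∈ C) : cycles σ = F := by
  refine Set.Subset.antisymm ?_ hF
  rintro _ ⟨e, rfl⟩
  obtain ⟨C, hC, he⟩ := hc e
  rwa [← eq_periodicOrbit (hF hC) he]

theorem finite_cycles (σ : Perm E) : (cycles σ).Finite := Set.finite_range _

theorem cycle_map_id (C : Cycle E) : C.map id = C := by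
  induction C using Quotient.inductionOn' with
  | h l => exact congrArg (fun l : List E => (l : Cycle E)) (List.map_id l)

/-- If a permutation agrees with `σ` on a cycle of `σ`, up to an injection, the image of the cycle
is a cycle. -/
theorem IsOrbit.map {E' : Type} {σ' : Perm E'} {a : E} {w : List E} (h : IsOrbit σ a w)
    {f : E → E'} (hf : Injective f) (hσ : ∀ x ∈ a :: w, σ' (f x) = f (σ x)) :
    IsOrbit σ' (f a) (w.map f) := by
  refine ⟨?_, ?_⟩
  · have := h.1.map hf
    simpa using this
  · have h1 : (f a :: w.map f).map σ' = ((a :: w).map σ).map f := by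
      rw [← List.map_cons, List.map_map, List.map_map]
      exact List.map_congr_left hσ
    rw [h1, h.2]
    simp

theorem map_mem_cycles {E' : Type} [Finite E'] {σ' : Perm E'} {C : Cycle E} (hC : C ∈ cycles σ)
    {f : E → E'} (hf : Injective f) (hσ : ∀ x ∈ C, σ' (f x) = f (σ x)) :
    C.map f ∈ cycles σ' := by
  obtain ⟨e, rfl⟩ := hC
  obtain ⟨w, h1, h2⟩ := exists_isOrbit σ e
  rw [h2] at hσ ⊢
  exact (h1.map hf hσ).mem_cycles

/-- The new permutation sends `e` to `σ x` and `x` to `σ e`, which cuts the cycle `(e U x V)` into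
`(e V)` and `(x U)`. -/
theorem IsOrbit.split [DecidableEq E] {e x : E} {U V : List E} (h : IsOrbit σ e (U ++ x :: V)) :
    IsOrbit (σ * swap e x) e V ∧ IsOrbit (σ * swap e x) x U := by
  obtain ⟨h1, h2⟩ := map_cons_append h.2
  have hn := h.1
  simp only [List.nodup_cons, List.nodup_append, List.mem_append, List.mem_cons] at hn
  have key : ∀ L : List E, e ∉ L → x ∉ L → L.map (σ * swap e x) = L.map σ := by
    intro L he hx
    refine List.map_congr_left fun z hz => ?_
    rw [Perm.mul_apply, swap_apply_of_ne_of_ne]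
    · rintro rfl; exact he hz
    · rintro rfl; exact hx hz
  refine ⟨⟨?_, ?_⟩, ⟨?_, ?_⟩⟩
  · simp only [List.nodup_cons]; tauto
  · rw [List.map_cons, key V (by tauto) (by tauto), Perm.mul_apply, swap_apply_left]
    simpa using h2
  · simp only [List.nodup_cons]
    refine ⟨fun hx => hn.2.2.2 x hx x (Or.inl rfl) rfl, hn.2.1⟩
  · rw [List.map_cons, key U (by tauto) (fun hx => hn.2.2.2 x hx x (Or.inl rfl) rfl),
      Perm.mul_apply, swap_apply_right]
    simpa using h1

theorem cycles_mul_swap [DecidableEq E] {e x : E} {U V : List E}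
    (h : IsOrbit σ e (U ++ x :: V)) :
    cycles (σ * swap e x) = insert ((e :: V : List E) : Cycle E)
      (insert ((x :: U : List E) : Cycle E)
        (cycles σ \ {((e :: (U ++ x :: V) : List E) : Cycle E)})) := by
  obtain ⟨h1, h2⟩ := h.split
  refine cycles_eq_of_cover ?_ ?_
  · rintro C (rfl | rfl | ⟨hC, hne⟩)
    · exact h1.mem_cycles
    · exact h2.mem_cycles
    · have := map_mem_cycles (σ' := σ * swap e x) hC injective_id ?_
      · rwa [cycle_map_id] at this
      · intro z hz
        have hmem : z ∉ e :: (U ++ x :: V) := fun hz' => hne <| by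
          rw [Set.mem_singleton_iff, eq_periodicOrbit hC hz]
          exact (eq_periodicOrbit h.mem_cycles hz').symm
        simp only [List.mem_cons, List.mem_append, not_or] at hmem
        simp [Perm.mul_apply, swap_apply_of_ne_of_ne hmem.1 hmem.2.2.1]
  · intro z
    by_cases hz : z ∈ e :: (U ++ x :: V)
    · simp only [List.mem_cons, List.mem_append] at hz
      by_cases hz' : z ∈ e :: V
      · exact ⟨_, Or.inl rfl, hz'⟩
      · refine ⟨_, Or.inr (Or.inl rfl), ?_⟩
        simp only [List.mem_cons, Cycle.mem_coe_iff] at hz' ⊢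
        tauto
    · refine ⟨periodicOrbit σ z, Or.inr (Or.inr ⟨⟨z, rfl⟩, ?_⟩),
        self_mem_periodicOrbit (mem_periodicPts_perm σ z)⟩
      intro h3
      apply hz
      have := self_mem_periodicOrbit (mem_periodicPts_perm σ z)
      rwa [h3] at this

theorem disjoint_split [DecidableEq E] {e x : E} {U V : List E}
    (h : IsOrbit σ e (U ++ x :: V)) :
    ((x :: U : List E) : Cycle E) ∉
      (cycles σ \ {((e :: (U ++ x :: V) : List E) : Cycle E)}) ∧
    ((e :: V : List E) : Cycle E) ∉ insert ((x :: U : List E) : Cycle E)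
        (cycles σ \ {((e :: (U ++ x :: V) : List E) : Cycle E)}) := by
  have hn := h.1
  simp only [List.nodup_cons, List.nodup_append, List.mem_append, List.mem_cons] at hn
  have hx : x ∈ ((x :: U : List E) : Cycle E) := by simp
  have he : e ∈ ((e :: V : List E) : Cycle E) := by simp
  refine ⟨fun h1 => h1.2 ?_, ?_⟩
  · rw [Set.mem_singleton_iff, eq_periodicOrbit h1.1 hx]
    exact (eq_periodicOrbit h.mem_cycles (by simp)).symm
  · rintro (h1 | h1)
    · rw [h1, Cycle.mem_coe_iff, List.mem_cons] at he
      tauto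
    · refine h1.2 ?_
      rw [Set.mem_singleton_iff, eq_periodicOrbit h1.1 he]
      exact (eq_periodicOrbit h.mem_cycles (by simp)).symm

theorem ncyc_pos_of_orbit {e : E} {w : List E} (h : IsOrbit σ e w) :
    (cycles σ \ {((e :: w : List E) : Cycle E)}).ncard + 1 = ncyc σ :=
  Set.ncard_sdiff_singleton_add_one h.mem_cycles (finite_cycles σ)

theorem ncyc_mul_swap [DecidableEq E] {e x : E} {U V : List E}
    (h : IsOrbit σ e (U ++ x :: V)) : ncyc (σ * swap e x) = ncyc σ + 1 := by
  obtain ⟨h1, h2⟩ := disjoint_split h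
  have hf : (cycles σ \ {((e :: (U ++ x :: V) : List E) : Cycle E)}).Finite :=
    (finite_cycles σ).subset Set.sdiff_subset
  rw [ncyc, cycles_mul_swap h, Set.ncard_insert_of_notMem h2 (hf.insert _),
    Set.ncard_insert_of_notMem h1 hf, ncyc_pos_of_orbit h]

theorem ncyc_mul_swap_of_mem [DecidableEq E] {e x : E} (h : x ∈ periodicOrbit σ e)
    (hne : x ≠ e) : ncyc (σ * swap e x) = ncyc σ + 1 := by
  obtain ⟨w, h1, h2⟩ := exists_isOrbit σ e
  rw [h2, Cycle.mem_coe_iff, List.mem_cons] at h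
  obtain ⟨s, t, rfl⟩ := List.append_of_mem (h.resolve_left hne)
  exact ncyc_mul_swap h1

/-- The transposition joins the cycles of `e` and `y`; applying it again splits the joined cycle and
returns `σ`, so the count follows from `ncyc_mul_swap`. -/
theorem ncyc_mul_swap_of_notMem [DecidableEq E] {e y : E} (h : y ∉ periodicOrbit σ e) :
    ncyc (σ * swap e y) + 1 = ncyc σ := by
  obtain ⟨w, h1, h2⟩ := exists_isOrbit σ e
  obtain ⟨w', h1', h2'⟩ := exists_isOrbit σ y
  have hdis : ∀ z ∈ e :: w, z ∉ y :: w' := by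
    intro z hz hz'
    have e1 := eq_periodicOrbit h1.mem_cycles hz
    have e2 := eq_periodicOrbit h1'.mem_cycles hz'
    apply h
    rw [h2, e1, ← e2]
    simp
  have hne : y ≠ e := by
    rintro rfl; exact hdis y (by simp) (by simp)
  have key : ∀ L : List E, e ∉ L → y ∉ L → L.map (σ * swap e y) = L.map σ := by
    intro L he hy
    refine List.map_congr_left fun z hz => ?_
    rw [Perm.mul_apply, swap_apply_of_ne_of_ne]
    · rintro rfl; exact he hz
    · rintro rfl; exact hy hz
  have hn := List.nodup_cons.1 h1.1
  have hn' := List.nodup_cons.1 h1'.1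
  have hmem : e ∉ w' := fun hm => hdis e (by simp) (by simp [hm])
  have hmem' : y ∉ w := fun hm => hdis y (by simp [hm]) (by simp)
  have h3 : IsOrbit (σ * swap e y) e (w' ++ y :: w) := by
    refine ⟨?_, ?_⟩
    · have : (e :: (w' ++ y :: w)).Perm ((e :: w) ++ (y :: w')) := by
        rw [List.cons_append, List.perm_cons]
        have h4 : (w' ++ y :: w).Perm ((y :: w) ++ w') := List.perm_append_comm
        refine h4.trans ?_
        rw [List.cons_append]
        exact (List.perm_middle).symm
      rw [this.nodup_iff, List.nodup_append]
      exact ⟨h1.1, h1'.1, fun a ha b hb hab => hdis a ha (hab ▸ hb)⟩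
    · have e1 := h1.2
      have e2 := h1'.2
      rw [List.map_cons] at e1 e2
      rw [List.map_cons, List.map_append, List.map_cons, key w' hmem hn'.1, key w hn.1 hmem',
        Perm.mul_apply, Perm.mul_apply, swap_apply_left, swap_apply_right]
      have : σ y :: (List.map σ w' ++ σ e :: List.map σ w) =
        (σ y :: List.map σ w') ++ (σ e :: List.map σ w) := by simp
      rw [this, e1, e2]
      simp
  have h4 := ncyc_mul_swap h3
  rw [mul_assoc, swap_mul_self, mul_one] at h4
  exact h4.symm

/-- The permutation of `Option E` obtained from `σ` by inserting `none` after `e`. -/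
def insertAfter [DecidableEq E] (σ : Perm E) (e : E) : Perm (Option E) :=
  optionCongr σ * swap (some e) none

theorem cycle_map_injective {E' : Type} {f : E → E'} (hf : Injective f) :
    Injective (Cycle.map f) := by
  intro C D
  induction C using Quotient.inductionOn' with | h l =>
  induction D using Quotient.inductionOn' with | h l' =>
  intro h
  have h' : List.IsRotated (l.map f) (l'.map f) := Quotient.exact h
  obtain ⟨n, hn⟩ := h'
  rw [← List.map_rotate] at hn
  exact Quotient.sound ⟨n, List.map_injective_iff.2 hf hn⟩

theorem cycles_optionCongr (σ : Perm E) :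
    cycles (optionCongr σ) = insert (([none] : List (Option E)) : Cycle (Option E))
      (Cycle.map some '' cycles σ) := by
  refine cycles_eq_of_cover ?_ ?_
  · rintro _ (rfl | ⟨C, hC, rfl⟩)
    · exact IsOrbit.mem_cycles ⟨by simp, by simp⟩
    · exact map_mem_cycles hC (Option.some_injective E) fun x _ => by simp
  · rintro (_ | e)
    · exact ⟨_, Or.inl rfl, by simp⟩
    · refine ⟨_, Or.inr ⟨_, ⟨e, rfl⟩, rfl⟩, ?_⟩
      rw [Cycle.mem_map]
      exact ⟨e, self_mem_periodicOrbit (mem_periodicPts_perm σ e), rfl⟩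

theorem none_notMem_image (S : Set (Cycle E)) {C : Cycle (Option E)} (hC : none ∈ C) :
    C ∉ Cycle.map some '' S := by
  rintro ⟨D, _, rfl⟩
  simp [Cycle.mem_map] at hC

theorem IsOrbit.insertAfter [DecidableEq E] {e : E} {w : List E} (h : IsOrbit σ e w) :
    IsOrbit (insertAfter σ e) (some e) (none :: w.map some) := by
  have hn := List.nodup_cons.1 h.1
  refine ⟨?_, ?_⟩
  · simp [List.nodup_cons, hn.1, List.nodup_map_iff (Option.some_injective E), hn.2]
  · have h1 : (w.map some).map (Traffic.insertAfter σ e) = (w.map σ).map some := by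
      rw [List.map_map, List.map_map]
      refine List.map_congr_left fun z hz => ?_
      have : (some z : Option E) ≠ some e := by
        rintro h; obtain rfl := Option.some_injective _ h; exact hn.1 hz
      simp [Traffic.insertAfter, swap_apply_of_ne_of_ne this]
    have h2 := congrArg (List.map some) h.2
    rw [List.map_cons, List.map_cons, h1]
    simp only [Traffic.insertAfter, Perm.mul_apply, swap_apply_left, swap_apply_right,
      optionCongr_apply, Option.map_some, Option.map_none]
    simpa using h2

theorem cycles_insertAfter [DecidableEq E] {e : E} {w : List E} (h : IsOrbit σ e w) :
    cycles (insertAfter σ e) =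
      insert ((some e :: none :: w.map some : List (Option E)) : Cycle (Option E))
      (Cycle.map some '' (cycles σ \ {((e :: w : List E) : Cycle E)})) := by
  refine cycles_eq_of_cover ?_ ?_
  · rintro _ (rfl | ⟨C, hC, rfl⟩)
    · exact h.insertAfter.mem_cycles
    · refine map_mem_cycles hC.1 (Option.some_injective E) fun x hx => ?_
      have : (some x : Option E) ≠ some e := by
        rintro h'; obtain rfl := Option.some_injective _ h'
        refine hC.2 ?_
        rw [Set.mem_singleton_iff, eq_periodicOrbit hC.1 hx, h.periodicOrbit_eq]
      simp [insertAfter, swap_apply_of_ne_of_ne this]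
  · rintro (_ | x)
    · exact ⟨_, Or.inl rfl, by simp⟩
    · by_cases hx : x ∈ e :: w
      · refine ⟨_, Or.inl rfl, ?_⟩
        simpa using hx
      · refine ⟨_, Or.inr ⟨_, ⟨⟨x, rfl⟩, fun h1 => hx ?_⟩, rfl⟩, ?_⟩
        · have := self_mem_periodicOrbit (mem_periodicPts_perm σ x)
          rwa [h1] at this
        · rw [Cycle.mem_map]
          exact ⟨x, self_mem_periodicOrbit (mem_periodicPts_perm σ x), rfl⟩

theorem ncyc_optionCongr (σ : Perm E) : ncyc (optionCongr σ) = ncyc σ + 1 := by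
  rw [ncyc, cycles_optionCongr, Set.ncard_insert_of_notMem (none_notMem_image _ (by simp))
    ((finite_cycles σ).image _),
    Set.ncard_image_of_injective _ (cycle_map_injective (Option.some_injective E))]
  rfl

theorem ncyc_insertAfter [DecidableEq E] (σ : Perm E) (e : E) :
    ncyc (insertAfter σ e) = ncyc σ := by
  obtain ⟨w, h, -⟩ := exists_isOrbit σ e
  rw [ncyc, cycles_insertAfter h, Set.ncard_insert_of_notMem (none_notMem_image _ (by simp))
    (((finite_cycles σ).subset Set.sdiff_subset).image _),
    Set.ncard_image_of_injective _ (cycle_map_injective (Option.some_injective E)),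
    ncyc_pos_of_orbit h]

theorem cycles_conj {E' : Type} [Finite E'] (φ : E ≃ E') (σ : Perm E) :
    cycles (φ.permCongr σ) = Cycle.map φ '' cycles σ := by
  refine cycles_eq_of_cover ?_ ?_
  · rintro _ ⟨C, hC, rfl⟩
    exact map_mem_cycles hC φ.injective fun x _ => by simp [permCongr_apply]
  · intro e
    refine ⟨_, ⟨_, ⟨φ.symm e, rfl⟩, rfl⟩, ?_⟩
    rw [Cycle.mem_map]
    exact ⟨φ.symm e, self_mem_periodicOrbit (mem_periodicPts_perm σ _), by simp⟩

theorem ncyc_conj {E' : Type} [Finite E'] (φ : E ≃ E') (σ : Perm E) :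
    ncyc (φ.permCongr σ) = ncyc σ := by
  rw [ncyc, cycles_conj, Set.ncard_image_of_injective _ (cycle_map_injective φ.injective)]
  rfl

end Cycles

/-! ### Counting vertices, edges and cycles -/

section Counting

open Equiv Function

variable {V E : Type}

/-- The edge relation of a directed multigraph. -/
def EdgeRel (src tgt : E → V) (v w : V) : Prop := ∃ e, src e = v ∧ tgt e = w

/-- The connected components of a directed multigraph. -/
def Components (src tgt : E → V) : Type := Quot (EdgeRel src tgt)

theorem graphConnected_iff {src tgt : E → V} :
    GraphConnected src tgt ↔ Nonempty V ∧ Subsingleton (Components src tgt) := by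
  refine and_congr_right fun _ => ⟨fun h => ⟨?_⟩, fun h x y => ?_⟩
  · rintro ⟨x⟩ ⟨y⟩
    exact Quot.eqvGen_sound (h x y)
  · exact Quot.eqvGen_exact (Subsingleton.elim (α := Components src tgt) (Quot.mk _ x)
      (Quot.mk _ y))

/-- The form in which connectedness is used throughout: a vertex predicate constant along all edges
is constant. -/
theorem GraphConnected.of_forall {src tgt : E → V} (h : GraphConnected src tgt) {p : V → Prop}
    (hp : ∀ e, p (src e) ↔ p (tgt e)) {v : V} (hv : p v) (w : V) : p w := by
  have : ∀ x y, Relation.EqvGen (fun v w => ∃ e, src e = v ∧ tgt e = w) x y → (p x ↔ p y) := by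
    intro x y hxy
    induction hxy with
    | rel x y hr => obtain ⟨e, rfl, rfl⟩ := hr; exact hp e
    | refl x => rfl
    | symm x y _ ih => exact ih.symm
    | trans x y z _ _ ih1 ih2 => exact ih1.trans ih2
  exact (this v w (h.2 v w)).1 hv

variable [Finite V] [Finite E]

instance (src tgt : E → V) : Finite (Components src tgt) :=
  inferInstanceAs (Finite (Quot _))

/-- Rank-nullity for the coboundary map `ℚ^V → ℚ^E`: its kernel consists of functions factoring
through the components. -/
theorem card_le_card_add_card_components (src tgt : E → V) :
    Nat.card V ≤ Nat.card E + Nat.card (Components src tgt) := by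
  have := Fintype.ofFinite V
  have := Fintype.ofFinite E
  have := Fintype.ofFinite (Components src tgt)
  let d : (V → ℚ) →ₗ[ℚ] (E → ℚ) :=
    { toFun := fun h e => h (src e) - h (tgt e)
      map_add' := fun h h' => funext fun e => add_sub_add_comm _ _ _ _
      map_smul' := fun c h => funext fun e => (mul_sub _ _ _).symm }
  let p : (Components src tgt → ℚ) →ₗ[ℚ] (V → ℚ) :=
    LinearMap.funLeft ℚ ℚ (Quot.mk (EdgeRel src tgt))
  have h1 := d.finrank_range_add_finrank_ker
  have h2 : Module.finrank ℚ (LinearMap.range d) ≤ Fintype.card E := by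
    simpa using (LinearMap.range d).finrank_le
  have h3 : LinearMap.ker d ≤ LinearMap.range p := by
    intro h hh
    refine ⟨Quot.lift h ?_, rfl⟩
    rintro _ _ ⟨e, rfl, rfl⟩
    exact sub_eq_zero.1 (congrFun hh e)
  have h4 : Module.finrank ℚ (LinearMap.ker d) ≤ Fintype.card (Components src tgt) := by
    refine (Submodule.finrank_mono h3).trans ?_
    simpa using p.finrank_range_le
  simp only [Module.finrank_pi] at h1
  simp only [Nat.card_eq_fintype_card]
  omega

/-- Apply the previous bound to the bipartite graph on vertices and cycles in which `e` joins `tgt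
e` to its cycle. It has no more components than the original graph, because `src e = tgt (σ e)` is
joined to the same cycle as `tgt e`. -/
theorem card_add_ncyc_le {src tgt : E → V} {σ : Perm E} (h : ∀ e, src e = tgt (σ e)) :
    Nat.card V + ncyc σ ≤ Nat.card E + Nat.card (Components src tgt) := by
  have hf : Finite (cycles σ) := finite_cycles σ
  let f : E → V ⊕ cycles σ := fun e => .inl (tgt e)
  let g : E → V ⊕ cycles σ := fun e => .inr ⟨periodicOrbit σ e, e, rfl⟩
  have h1 := card_le_card_add_card_components f g
  rw [Nat.card_sum, Nat.card_coe_set_eq] at h1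
  refine h1.trans (Nat.add_le_add_left ?_ _)
  have hfg : ∀ e, (Quot.mk (EdgeRel f g) (.inl (tgt e))) =
      Quot.mk (EdgeRel f g) (.inr ⟨periodicOrbit σ e, e, rfl⟩) :=
    fun e => Quot.sound ⟨e, rfl, rfl⟩
  let q : Components src tgt → Components f g :=
    Quot.lift (fun v => Quot.mk _ (.inl v)) (by
      rintro _ _ ⟨e, rfl, rfl⟩
      rw [h, hfg, hfg]
      congr 3
      exact orbit_apply σ e)
  refine Nat.card_le_card_of_surjective q ?_
  rintro ⟨v | ⟨_, e, rfl⟩⟩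
  · exact ⟨Quot.mk _ v, rfl⟩
  · exact ⟨Quot.mk _ (tgt e), hfg e⟩

/-- The vertices of a graph after the identifications which make the cycles of `σ` oriented
closed trails. -/
abbrev PermQuot (src tgt : E → V) (σ : Perm E) : Type := Quot (EdgeRel src (tgt ∘ σ))

/-- The identifications which make the cycles of `σ` oriented closed trails turn the graph into a
cactus whose cycles are those of `σ`. -/
def Tight (src tgt : E → V) (σ : Perm E) : Prop :=
  Nat.card (PermQuot src tgt σ) + ncyc σ = Nat.card E + 1

theorem mk_src (src tgt : E → V) (σ : Perm E) (e : E) :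
    (Quot.mk _ (src e) : PermQuot src tgt σ) = Quot.mk _ (tgt (σ e)) :=
  Quot.sound ⟨e, rfl, rfl⟩

/-- `Tight` is the case of equality here. -/
theorem card_permQuot_add_ncyc_le {src tgt : E → V} (hc : GraphConnected src tgt) (σ : Perm E) :
    Nat.card (PermQuot src tgt σ) + ncyc σ ≤ Nat.card E + 1 := by
  have h1 := card_add_ncyc_le (src := fun e => (Quot.mk _ (src e) : PermQuot src tgt σ))
    (tgt := fun e => Quot.mk _ (tgt e)) (mk_src src tgt σ)
  have h2 := (graphConnected_iff.1
    (hc.map (Quot.mk (EdgeRel src (tgt ∘ σ))) Quot.mk_surjective)).2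
  have h3 := Finite.card_le_one_iff_subsingleton.2 h2
  exact h1.trans (Nat.add_le_add_left h3 _)

/-- Removing two edges of a same cycle of a cactus disconnects it. -/
theorem Tight.exists_cut {src tgt : E → V} {σ : Perm E} (h : Tight src tgt σ)
    (hc : GraphConnected src tgt) {e f : E} (hf : f ∈ periodicOrbit σ e) (hne : f ≠ e) :
    ∃ χ : V → Prop, (∀ k, χ (src k) ↔ χ (tgt (σ k))) ∧
      (∀ k, k ≠ e → k ≠ f → (χ (src k) ↔ χ (tgt k))) ∧
      χ (tgt e) ∧ χ (src f) ∧ ¬ χ (src e) ∧ ¬ χ (tgt f) := by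
  classical
  -- Exchange the sources of `e` and `f` in the quotient. The new graph is compatible with `σ * swap
  -- e f`, which has one cycle more, so the counting bound forces at least two components. The
  -- predicate `χ` will be membership in the component of `tgt e`.
  let s : E → PermQuot src tgt σ := fun k => Quot.mk _ (src (swap e f k))
  let t : E → PermQuot src tgt σ := fun k => Quot.mk _ (tgt k)
  have h1 : Nat.card (PermQuot src tgt σ) + ncyc (σ * swap e f) ≤
      Nat.card E + Nat.card (Components s t) :=
    card_add_ncyc_le fun k => mk_src src tgt σ _
  rw [ncyc_mul_swap_of_mem hf hne] at h1
  have h2 : ¬ Subsingleton (Components s t) := fun h2 => by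
    have := Finite.card_le_one_iff_subsingleton.2 h2
    unfold Tight at h
    omega
  let m : V → Components s t := fun v => Quot.mk _ (Quot.mk _ v)
  have hst : ∀ k, m (src (swap e f k)) = m (tgt k) := fun k => Quot.sound ⟨k, rfl, rfl⟩
  have hfe := hst f
  have hef := hst e
  rw [swap_apply_right] at hfe
  rw [swap_apply_left] at hef
  have h3 : ∀ k, k ≠ e → k ≠ f → m (src k) = m (tgt k) := by
    intro k h1 h2
    have := hst k
    rwa [swap_apply_of_ne_of_ne h1 h2] at this
  -- Otherwise `m` would be constant along all edges of the original connected graph, leaving a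
  -- single component.
  have h4 : m (src e) ≠ m (tgt e) := by
    intro h4
    refine h2 ⟨?_⟩
    have h5 : ∀ v, m v = m (tgt e) := by
      refine hc.of_forall (p := fun v => m v = m (tgt e)) (fun k => ?_) (v := tgt e) rfl
      by_cases hk : k = e
      · subst hk; simp [h4]
      by_cases hk' : k = f
      · subst hk'; simp [hef, ← hfe, h4]
      · rw [h3 k hk hk']
    rintro ⟨⟨v⟩⟩ ⟨⟨w⟩⟩
    exact (h5 v).trans (h5 w).symm
  refine ⟨fun v => m v = m (tgt e), fun k => ?_, fun k h1 h2 => ?_, rfl, hef, h4, ?_⟩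
  · have : m (src k) = m (tgt (σ k)) := congrArg (Quot.mk _) (mk_src src tgt σ k)
    simp only [this]
  · simp only [h3 k h1 h2]
  · exact fun h5 => h4 (hfe.trans h5)

end Counting

/-! ### The distribution of traffics as a sum over permutations of the edges -/

section PermTau

open Equiv Function

variable {A : Type u} [Ring A] [Algebra ℂ A] (Φ : A →ₗ[ℂ] ℂ)
variable {V E : Type} [Finite V] [Finite E]

/-- The product of the cumulants of the labels along the cycles of a permutation. -/
noncomputable def permWeight (σ : Perm E) (ℓ : E → A) : ℂ :=
  ∏ᶠ C ∈ cycles σ, cycCum Φ (C.map ℓ)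

open Classical in
/-- The sum of the weights of the permutations of the edges which define a cactus. -/
noncomputable def permTau (src tgt : E → V) (ℓ : E → A) : ℂ :=
  ∑ᶠ σ : Perm E, if Tight src tgt σ then permWeight Φ σ ℓ else 0

variable {Φ}

theorem permWeight_conj {E' : Type} [Finite E'] (φ : E ≃ E') (σ : Perm E) (ℓ : E' → A) :
    permWeight Φ (φ.permCongr σ) ℓ = permWeight Φ σ (ℓ ∘ φ) := by
  rw [permWeight, cycles_conj, finprod_mem_image (cycle_map_injective φ.injective).injOn]
  refine finprod_mem_congr rfl fun C _ => ?_
  congr 1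
  induction C using Quotient.inductionOn' with
  | h l => exact congrArg (fun l : List A => (l : Cycle A)) (List.map_map)

theorem permTau_congr {V' E' : Type} [Finite V'] [Finite E'] {src tgt : E → V}
    {src' tgt' : E' → V'} {ℓ : E → A} {ℓ' : E' → A} (φ : E ≃ E') (f : V ≃ V')
    (hs : ∀ e, src' (φ e) = f (src e)) (ht : ∀ e, tgt' (φ e) = f (tgt e))
    (hl : ∀ e, ℓ' (φ e) = ℓ e) : permTau Φ src tgt ℓ = permTau Φ src' tgt' ℓ' := by
  classical
  refine finsum_eq_of_bijective φ.permCongr φ.permCongr.bijective fun σ => ?_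
  have h1 : Nat.card (PermQuot src tgt σ) = Nat.card (PermQuot src' tgt' (φ.permCongr σ)) := by
    refine Nat.card_congr (Quot.congr f fun v w => ⟨?_, ?_⟩)
    · rintro ⟨e, rfl, rfl⟩
      exact ⟨φ e, hs e, by simp [permCongr_apply, ht]⟩
    · rintro ⟨e, h1, h2⟩
      obtain ⟨e, rfl⟩ := φ.surjective e
      refine ⟨e, f.injective ((hs e).symm.trans h1), f.injective ?_⟩
      simpa [permCongr_apply, ht] using h2
  have h2 : Tight src tgt σ ↔ Tight src' tgt' (φ.permCongr σ) := by
    rw [Tight, Tight, h1, ncyc_conj, Nat.card_congr φ]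
  have h3 : ℓ' ∘ φ = ℓ := funext hl
  simp only [h2, permWeight_conj, h3]

/-- Isolates the only factor that depends on the label of `e`, written so that this label comes
first. -/
theorem permWeight_orbit (htr : ∀ a b : A, Φ (a * b) = Φ (b * a)) {σ : Perm E} {e : E}
    {w : List E} (h : IsOrbit σ e w) (ℓ : E → A) :
    permWeight Φ σ ℓ = cum Φ (ℓ e :: w.map ℓ) *
      ∏ᶠ C ∈ cycles σ \ {((e :: w : List E) : Cycle E)}, cycCum Φ (C.map ℓ) := by
  have h1 : insert ((e :: w : List E) : Cycle E)
      (cycles σ \ {((e :: w : List E) : Cycle E)}) = cycles σ :=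
    Set.insert_sdiff_self_of_mem h.mem_cycles
  rw [permWeight, ← h1, finprod_mem_insert _ (by simp)
    ((finite_cycles σ).subset Set.sdiff_subset), h1, Cycle.map_coe, cycCum_coe htr, List.map_cons]

theorem cycle_map_congr {B : Type*} {C : Cycle E} {ℓ ℓ' : E → B} (h : ∀ x ∈ C, ℓ x = ℓ' x) :
    C.map ℓ = C.map ℓ' := by
  induction C using Quotient.inductionOn' with
  | h l => exact congrArg (fun l : List B => (l : Cycle B)) (List.map_congr_left h)

theorem rest_congr {σ : Perm E} {e : E} {w : List E} (h : IsOrbit σ e w) {ℓ ℓ' : E → A}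
    (hl : ∀ x, x ≠ e → ℓ x = ℓ' x) :
    ∏ᶠ C ∈ cycles σ \ {((e :: w : List E) : Cycle E)}, cycCum Φ (C.map ℓ) =
      ∏ᶠ C ∈ cycles σ \ {((e :: w : List E) : Cycle E)}, cycCum Φ (C.map ℓ') := by
  refine finprod_mem_congr rfl fun C hC => ?_
  rw [cycle_map_congr fun x hx => hl x ?_]
  rintro rfl
  refine hC.2 ?_
  rw [Set.mem_singleton_iff, eq_periodicOrbit hC.1 hx, h.periodicOrbit_eq]

theorem map_update_eq {σ : Perm E} {e : E} {w : List E} (h : IsOrbit σ e w) [DecidableEq E]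
    (ℓ : E → A) (a : A) : w.map (update ℓ e a) = w.map ℓ :=
  List.map_congr_left fun x hx => update_of_ne (by
    rintro rfl; exact (List.nodup_cons.1 h.1).1 hx) _ _

theorem permWeight_update (htr : ∀ a b : A, Φ (a * b) = Φ (b * a)) {σ : Perm E} {e : E}
    {w : List E} (h : IsOrbit σ e w) [DecidableEq E] (ℓ : E → A) (a : A) :
    permWeight Φ σ (update ℓ e a) = cum Φ (a :: w.map ℓ) *
      ∏ᶠ C ∈ cycles σ \ {((e :: w : List E) : Cycle E)}, cycCum Φ (C.map ℓ) := by
  rw [permWeight_orbit htr h, map_update_eq h, update_self,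
    rest_congr h fun x hx => update_of_ne hx _ _]

theorem permTau_update_add (htr : ∀ a b : A, Φ (a * b) = Φ (b * a)) [DecidableEq E]
    (src tgt : E → V) (ℓ : E → A) (e : E) (a b : A) :
    permTau Φ src tgt (update ℓ e (a + b)) =
      permTau Φ src tgt (update ℓ e a) + permTau Φ src tgt (update ℓ e b) := by
  rw [permTau, permTau, permTau, ← finsum_add_distrib (Set.toFinite _) (Set.toFinite _)]
  refine finsum_congr fun σ => ?_
  obtain ⟨w, h, -⟩ := exists_isOrbit σ e
  split_ifs
  · simp only [permWeight_update htr h, cum_add_cons, add_mul]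
  · simp

theorem permTau_update_smul (htr : ∀ a b : A, Φ (a * b) = Φ (b * a)) [DecidableEq E]
    (src tgt : E → V) (ℓ : E → A) (e : E) (c : ℂ) (a : A) :
    permTau Φ src tgt (update ℓ e (c • a)) = c * permTau Φ src tgt (update ℓ e a) := by
  rw [permTau, permTau, mul_finsum]
  refine finsum_congr fun σ => ?_
  obtain ⟨w, h, -⟩ := exists_isOrbit σ e
  split_ifs
  · simp only [permWeight_update htr h, cum_smul_cons, mul_assoc]
  · simp

/-! #### Contraction of an edge -/

theorem permWeight_optionCongr (htr : ∀ a b : A, Φ (a * b) = Φ (b * a)) (σ : Perm E)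
    (ℓ : Option E → A) :
    permWeight Φ (optionCongr σ) ℓ = Φ (ℓ none) * permWeight Φ σ (ℓ ∘ some) := by
  rw [permWeight, cycles_optionCongr, finprod_mem_insert _ (none_notMem_image _ (by simp))
    ((finite_cycles σ).image _), finprod_mem_image
    (cycle_map_injective (Option.some_injective E)).injOn, Cycle.map_coe, cycCum_coe htr]
  simp only [List.map_cons, List.map_nil, cum_singleton]
  congr 1
  refine finprod_mem_congr rfl fun C _ => ?_
  congr 1
  induction C using Quotient.inductionOn' with
  | h l => exact congrArg (fun l : List A => (l : Cycle A)) (List.map_map)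

/-- The identification of two vertices. -/
abbrev Glue (x y : V) : Type := Quot (fun v w : V => v = x ∧ w = y)

/-- Fixing an edge identifies its two ends, that is, contracts it; edges and cycles both drop by
one, so equality in the count is preserved. -/
theorem tight_optionCongr (src tgt : Option E → V) (σ : Perm E) :
    Tight src tgt (optionCongr σ) ↔
      Tight (fun e => (Quot.mk _ (src (some e)) : Glue (src none) (tgt none)))
        (fun e => Quot.mk _ (tgt (some e))) σ := by
  have h : Nat.card (PermQuot src tgt (optionCongr σ)) =
      Nat.card (PermQuot (fun e => (Quot.mk _ (src (some e)) : Glue (src none) (tgt none)))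
        (fun e => Quot.mk _ (tgt (some e))) σ) := by
    refine Nat.card_congr ⟨Quot.lift (fun v => Quot.mk _ (Quot.mk _ v)) ?_,
      Quot.lift (Quot.lift (fun v => Quot.mk _ v) ?_) ?_, ?_, ?_⟩
    · rintro _ _ ⟨_ | e, rfl, rfl⟩
      · exact congrArg (Quot.mk _) (Quot.sound ⟨rfl, rfl⟩)
      · exact Quot.sound ⟨e, rfl, rfl⟩
    · rintro _ _ ⟨rfl, rfl⟩
      exact Quot.sound ⟨none, rfl, rfl⟩
    · rintro _ _ ⟨e, rfl, rfl⟩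
      exact Quot.sound ⟨some e, rfl, rfl⟩
    · rintro ⟨v⟩; rfl
    · rintro ⟨⟨v⟩⟩; rfl
  rw [Tight, Tight, h, ncyc_optionCongr, Finite.card_option]
  omega

/-- If only the permutations which fix an edge contribute, this edge may be contracted. -/
theorem permTau_contract (htr : ∀ a b : A, Φ (a * b) = Φ (b * a)) (src tgt : Option E → V)
    (ℓ : Option E → A)
    (h : ∀ σ : Perm (Option E), Tight src tgt σ → σ none ≠ none → permWeight Φ σ ℓ = 0) :
    permTau Φ src tgt ℓ = Φ (ℓ none) *
      permTau Φ (fun e => (Quot.mk _ (src (some e)) : Glue (src none) (tgt none)))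
        (fun e => Quot.mk _ (tgt (some e))) (ℓ ∘ some) := by
  classical
  have := Fintype.ofFinite E
  -- A permutation of `Option E` amounts to the image of `none` together with a permutation of `E`;
  -- only the image `none` contributes.
  rw [permTau, permTau, mul_finsum, finsum_eq_sum_of_fintype,
    finsum_eq_sum_of_fintype, ← Equiv.sum_comp Perm.decomposeOption.symm,
    Fintype.sum_prod_type, Fintype.sum_option]
  have h1 : ∀ (e : E) (σ : Perm E),
      (if Tight src tgt (Perm.decomposeOption.symm (some e, σ)) then
        permWeight Φ (Perm.decomposeOption.symm (some e, σ)) ℓ else 0) = 0 := by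
    intro e σ
    split_ifs with ht
    · exact h _ ht (by simp)
    · rfl
  simp only [h1, Finset.sum_const_zero, add_zero]
  refine Finset.sum_congr rfl fun σ _ => ?_
  have h2 : Perm.decomposeOption.symm (none, σ) = optionCongr σ := by
    simp only [Perm.decomposeOption_symm_apply, swap_self]
    rfl
  rw [h2]
  simp only [tight_optionCongr, permWeight_optionCongr htr]
  split_ifs <;> simp

/-- A cumulant of length at least two with an entry `1` vanishes, so only permutations fixing the
edge survive, each with factor `Φ 1 = 1`. -/
theorem permTau_one (h1 : Φ 1 = 1) (htr : ∀ a b : A, Φ (a * b) = Φ (b * a))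
    (src tgt : Option E → V) (ℓ : Option E → A) (hl : ℓ none = 1) :
    permTau Φ src tgt ℓ =
      permTau Φ (fun e => (Quot.mk _ (src (some e)) : Glue (src none) (tgt none)))
        (fun e => Quot.mk _ (tgt (some e))) (ℓ ∘ some) := by
  rw [permTau_contract htr, hl, h1, one_mul]
  intro σ _ hσ
  obtain ⟨w, h, -⟩ := exists_isOrbit σ none
  rw [permWeight_orbit htr h, hl]
  cases w with
  | nil => simpa [hσ] using h.2
  | cons x w => rw [List.map_cons, cum_one_cons_cons h1, zero_mul]

end PermTau

/-! #### Subdivision of an edge -/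

section Subdivide

open Equiv Function

variable {A : Type u} [Ring A] [Algebra ℂ A] {Φ : A →ₗ[ℂ] ℂ}
variable {V E : Type} [Finite V] [Finite E] [DecidableEq E]

/-- The sources of the edges when the edge `e` is subdivided: `some e` is the half of `e` next to
its target, `none` the other half, and the vertex `none` is the new one. -/
def subdivSrc (src : E → V) (e : E) : Option E → Option V
  | none => some (src e)
  | some x => if x = e then none else some (src x)

/-- The targets of the edges when an edge is subdivided. -/
def subdivTgt (tgt : E → V) : Option E → Option V
  | none => none
  | some x => some (tgt x)

/-- The permutations of the edges of the subdivision, in terms of those of the original graph. -/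
def subdivPerm (e : E) (x : Option E) (σ : Perm E) : Perm (Option E) :=
  insertAfter σ e * swap (some e) x

theorem insertAfter_self (σ : Perm E) (e : E) : insertAfter σ e (some e) = none := by
  simp [insertAfter]

theorem insertAfter_none (σ : Perm E) (e : E) : insertAfter σ e none = some (σ e) := by
  simp [insertAfter]

theorem insertAfter_of_ne (σ : Perm E) {e x : E} (h : x ≠ e) :
    insertAfter σ e (some x) = some (σ x) := by
  have : (some x : Option E) ≠ some e := by simpa using h
  simp [insertAfter, swap_apply_of_ne_of_ne this]

/-- `x` is recovered as the preimage of `none`, and then `σ` by cancellation. Surjectivity follows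
by cardinality. -/
theorem subdivPerm_bijective (e : E) :
    Bijective (fun p : Option E × Perm E => subdivPerm e p.1 p.2) := by
  have hinj : Injective (fun p : Option E × Perm E => subdivPerm e p.1 p.2) := by
    rintro ⟨x, σ⟩ ⟨x', σ'⟩ h
    have key : ∀ (y : Option E) (τ : Perm E), subdivPerm e y τ y = none := fun y τ => by
      rw [subdivPerm, Perm.mul_apply, swap_apply_right, insertAfter_self]
    have h' : subdivPerm e x σ = subdivPerm e x' σ' := h
    obtain rfl : x = x' := (subdivPerm e x' σ').injective (by rw [key, ← h', key])
    have h1 : insertAfter σ e = insertAfter σ' e := mul_right_cancel h'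
    have h2 : optionCongr σ = optionCongr σ' := mul_right_cancel h1
    rw [optionCongr_injective h2]
  exact ⟨hinj, (Finite.injective_iff_surjective_of_equiv Perm.decomposeOption.symm).1 hinj⟩

/-- The two halves of `e` follow one another in the cycle, so the middle vertex is identified with
no other. -/
theorem card_permQuot_insertAfter (src tgt : E → V) (e : E) (σ : Perm E) :
    Nat.card (PermQuot (subdivSrc src e) (subdivTgt tgt) (insertAfter σ e)) =
      Nat.card (PermQuot src tgt σ) + 1 := by
  rw [← Finite.card_option]
  refine Nat.card_congr ⟨Quot.lift (Option.map (Quot.mk _)) ?_,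
    fun o => o.elim (Quot.mk _ none) (Quot.lift (fun v => Quot.mk _ (some v)) ?_), ?_, ?_⟩
  · rintro _ _ ⟨_ | x, rfl, rfl⟩
    · rw [comp_apply, insertAfter_none]
      exact congrArg some (mk_src src tgt σ e)
    · by_cases hx : x = e
      · subst hx
        rw [comp_apply, insertAfter_self]
        simp [subdivSrc, subdivTgt]
      · rw [comp_apply, insertAfter_of_ne σ hx]
        simp only [subdivSrc, hx, if_false]
        exact congrArg some (mk_src src tgt σ x)
  · rintro _ _ ⟨x, rfl, rfl⟩
    by_cases hx : x = e
    · subst hx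
      exact Quot.sound ⟨none, rfl, by rw [comp_apply, insertAfter_none]; rfl⟩
    · exact Quot.sound ⟨some x, by simp [subdivSrc, hx],
        by rw [comp_apply, insertAfter_of_ne σ hx]; rfl⟩
  · rintro ⟨_ | v⟩ <;> rfl
  · rintro (_ | v)
    · rfl
    · induction v using Quot.ind; rfl

/-- Here `x`, and not `some e`, is sent to the half `none`, whose target is the middle vertex. That
vertex therefore falls into the class of the source of `x` and adds no class. -/
theorem card_permQuot_subdivPerm (src tgt : E → V) {e : E} {x : Option E} (hx : x ≠ some e)
    (σ : Perm E) :
    Nat.card (PermQuot (subdivSrc src e) (subdivTgt tgt) (subdivPerm e x σ)) =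
      Nat.card (PermQuot src tgt σ) := by
  have hxx : subdivPerm e x σ x = none := by
    rw [subdivPerm, Perm.mul_apply, swap_apply_right, insertAfter_self]
  have hne : ∀ y, y ≠ some e → y ≠ x → subdivPerm e x σ y = insertAfter σ e y := fun y h1 h2 => by
    rw [subdivPerm, Perm.mul_apply, swap_apply_of_ne_of_ne h1 h2]
  have hee : subdivPerm e x σ (some e) = insertAfter σ e x := by
    rw [subdivPerm, Perm.mul_apply, swap_apply_left]
  -- The original edge having the same source as `x`: the half `none` retains the source of `e`.
  set y : E := x.elim e id with hy
  have hsx : subdivSrc src e x = some (src y) := by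
    cases x with
    | none => rfl
    | some z =>
      have : z ≠ e := fun h => hx (by rw [h])
      simp [subdivSrc, this, hy]
  have hix : insertAfter σ e x = some (σ y) := by
    cases x with
    | none => exact insertAfter_none σ e
    | some z => exact insertAfter_of_ne σ fun h => hx (by rw [h])
  have hm : (Quot.mk _ (some (src y)) :
      PermQuot (subdivSrc src e) (subdivTgt tgt) (subdivPerm e x σ)) = Quot.mk _ none :=
    Quot.sound ⟨x, hsx, by rw [comp_apply, hxx]; rfl⟩
  have hm' : (Quot.mk _ none : PermQuot (subdivSrc src e) (subdivTgt tgt) (subdivPerm e x σ)) =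
      Quot.mk _ (some (tgt (σ y))) :=
    Quot.sound ⟨some e, by simp [subdivSrc], by rw [comp_apply, hee, hix]; rfl⟩
  refine Nat.card_congr ⟨Quot.lift
    (fun o => o.elim (Quot.mk _ (src y)) (fun v => Quot.mk _ v)) ?_,
    Quot.lift (fun v => Quot.mk _ (some v)) ?_, ?_, ?_⟩
  · rintro _ _ ⟨z, rfl, rfl⟩
    rw [comp_apply]
    by_cases hz : z = x
    · rw [hz, hxx, hsx]; rfl
    by_cases hz' : z = some e
    · rw [hz', hee, hix]
      simp only [subdivSrc, if_true, subdivTgt]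
      exact mk_src src tgt σ y
    rw [hne z hz' hz]
    cases z with
    | none =>
      rw [insertAfter_none]
      exact mk_src src tgt σ e
    | some z =>
      have : z ≠ e := fun h => hz' (by rw [h])
      rw [insertAfter_of_ne σ this]
      simp only [subdivSrc, this, if_false]
      exact mk_src src tgt σ z
  · rintro _ _ ⟨z, rfl, rfl⟩
    by_cases hz : z = y
    · rw [hz, hm, hm']; rfl
    by_cases hz' : z = e
    · rw [hz'] at hz ⊢
      have hxn : x ≠ none := by rintro rfl; exact hz rfl
      refine Quot.sound ⟨none, rfl, ?_⟩
      rw [comp_apply, hne none (by simp) hxn.symm, insertAfter_none]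
      rfl
    · have h1 : (some z : Option E) ≠ some e := by simpa using hz'
      have h2 : some z ≠ x := by rintro rfl; exact hz rfl
      refine Quot.sound ⟨some z, by simp [subdivSrc, hz'], ?_⟩
      rw [comp_apply, hne _ h1 h2, insertAfter_of_ne σ hz']
      rfl
  · rintro ⟨_ | v⟩
    · exact hm
    · rfl
  · rintro ⟨v⟩; rfl

/-- The subdivision has one more edge. For `x = some e` there is one more class and the same number
of cycles. For other `x` in the enlarged cycle of `e` the classes are unchanged and a cycle splits.
For `x` outside it two cycles merge, and the counting bound for `σ` excludes equality. -/
theorem tight_subdivPerm {src tgt : E → V} {e : E}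
    (hc : GraphConnected src tgt) {σ : Perm E} {w : List E} (h : IsOrbit σ e w) (x : Option E) :
    Tight (subdivSrc src e) (subdivTgt tgt) (subdivPerm e x σ) ↔
      Tight src tgt σ ∧ x ∈ some e :: none :: w.map some := by
  by_cases hx : x = some e
  · subst hx
    rw [subdivPerm, swap_self]
    change Tight _ _ (insertAfter σ e * 1) ↔ _
    rw [mul_one, Tight, Tight, card_permQuot_insertAfter, ncyc_insertAfter, Finite.card_option]
    simp only [List.mem_cons, true_or, and_true]
    omega
  · rw [Tight, Tight, card_permQuot_subdivPerm src tgt hx, Finite.card_option]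
    have h1 := h.insertAfter
    by_cases hm : x ∈ some e :: none :: w.map some
    · rw [subdivPerm, ncyc_mul_swap_of_mem (by rwa [h1.periodicOrbit_eq]) hx, ncyc_insertAfter]
      simp only [hm, and_true]
      omega
    · have h2 := ncyc_mul_swap_of_notMem (σ := insertAfter σ e) (e := some e) (y := x)
        (by rwa [h1.periodicOrbit_eq])
      have h3 := card_permQuot_add_ncyc_le hc σ
      rw [ncyc_insertAfter] at h2
      simp only [hm, and_false, iff_false]
      rw [subdivPerm]
      omega

/-- A cut with nonempty left piece is indexed by the last letter `x` of that piece. -/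
theorem splitSum_eq_add_sum {B : Type} (g : List B → List B → ℂ) (f : B → ℂ) (w : List B)
    (hf : ∀ U x V, w = U ++ x :: V → f x = g (U ++ [x]) V) :
    splitSum g w = g [] w + (w.map f).sum := by
  induction w generalizing g with
  | nil => simp [splitSum]
  | cons c w ih =>
    rw [splitSum, ih (fun u v => g (c :: u) v), List.map_cons, List.sum_cons,
      hf [] c w rfl]
    · simp
    · rintro U x V rfl
      exact hf (c :: U) x V rfl

theorem splitSum_map {B : Type} (f : List A → List A → ℂ) (ℓ : B → A) (w : List B) :
    splitSum f (w.map ℓ) = splitSum (fun u v => f (u.map ℓ) (v.map ℓ)) w := by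
  simp only [splitSum_eq_sum, List.length_map, List.map_take, List.map_drop]

/-- This is the product formula `cum_mul_cons`: `x = some e` gives the unsplit cumulant, `x = none`
the cut with empty left piece, and every `x` in `w` the cut just after `x`. The other cycles
contribute the common factor `R`. -/
theorem sum_permWeight_subdivPerm (htr : ∀ a b : A, Φ (a * b) = Φ (b * a)) {σ : Perm E} {e : E}
    {w : List E} (h : IsOrbit σ e w) (ℓ : E → A) (ℓ' : Option E → A)
    (he : ℓ e = ℓ' (some e) * ℓ' none) (hℓ : ∀ x, x ≠ e → ℓ' (some x) = ℓ x) :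
    ∑ x ∈ (some e :: none :: w.map some).toFinset, permWeight Φ (subdivPerm e x σ) ℓ' =
      permWeight Φ σ ℓ := by
  have hn := List.nodup_cons.1 h.1
  have h1 := h.insertAfter
  have hw : (w.map some).map ℓ' = w.map ℓ := by
    rw [List.map_map]
    exact List.map_congr_left fun x hx => hℓ x (by rintro rfl; exact hn.1 hx)
  set R : ℂ := ∏ᶠ C ∈ cycles σ \ {((e :: w : List E) : Cycle E)}, cycCum Φ (C.map ℓ) with hR
  have hdiff : cycles (insertAfter σ e) \
      {((some e :: none :: w.map some : List (Option E)) : Cycle (Option E))} =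
      Cycle.map some '' (cycles σ \ {((e :: w : List E) : Cycle E)}) := by
    rw [cycles_insertAfter h, Set.insert_sdiff_self_of_notMem]
    exact none_notMem_image _ (by simp)
  have hrest : ∏ᶠ C ∈ cycles (insertAfter σ e) \
      {((some e :: none :: w.map some : List (Option E)) : Cycle (Option E))},
        cycCum Φ (C.map ℓ') = R := by
    rw [hdiff, finprod_mem_image (cycle_map_injective (Option.some_injective E)).injOn, hR]
    refine finprod_mem_congr rfl fun C hC => ?_
    congr 1
    have h2 : (C.map some).map ℓ' = C.map (ℓ' ∘ some) := by
      induction C using Quotient.inductionOn' with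
      | h l => exact congrArg (fun l : List A => (l : Cycle A)) (List.map_map)
    rw [h2]
    refine cycle_map_congr fun x hx => hℓ x ?_
    rintro rfl
    refine hC.2 ?_
    rw [Set.mem_singleton_iff, eq_periodicOrbit hC.1 hx, h.periodicOrbit_eq]
  have hself : permWeight Φ (subdivPerm e (some e) σ) ℓ' =
      cum Φ (ℓ' (some e) :: ℓ' none :: w.map ℓ) * R := by
    rw [subdivPerm, swap_self]
    change permWeight Φ (insertAfter σ e * 1) ℓ' = _
    rw [mul_one, permWeight_orbit htr h1, hrest, List.map_cons, hw]
  have hsplit : ∀ U x V, none :: w.map some = U ++ x :: V →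
      permWeight Φ (subdivPerm e x σ) ℓ' =
        cum Φ (ℓ' x :: U.map ℓ') * cum Φ (ℓ' (some e) :: V.map ℓ') * R := by
    intro U x V hU
    have h2 : IsOrbit (insertAfter σ e) (some e) (U ++ x :: V) := hU ▸ h1
    obtain ⟨h3, h4⟩ := disjoint_split h2
    have hf : (cycles (insertAfter σ e) \
        {((some e :: (U ++ x :: V) : List (Option E)) : Cycle (Option E))}).Finite :=
      (finite_cycles _).subset Set.sdiff_subset
    rw [permWeight, subdivPerm, cycles_mul_swap h2, finprod_mem_insert _ h4 (hf.insert _),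
      finprod_mem_insert _ h3 hf, ← hU, hrest, Cycle.map_coe, Cycle.map_coe, cycCum_coe htr,
      cycCum_coe htr, List.map_cons, List.map_cons]
    ring
  have hnd := h1.1
  rw [List.sum_toFinset _ hnd, List.map_cons, List.sum_cons, hself, List.map_cons,
    List.sum_cons, hsplit [] none (w.map some) rfl, hw, permWeight_orbit htr h, ← hR, he,
    cum_mul_cons, splitSum_map, add_mul, List.map_map]
  -- The split cycle is listed from `x`, whereas the product formula lists it from `none` with `x`
  -- at the end; cyclic invariance reconciles them.
  have hR0 := splitSum_eq_add_sum (fun u v => cum Φ (ℓ' none :: List.map ℓ u) *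
      cum Φ (ℓ' (some e) :: List.map ℓ v) * R)
    ((fun x => permWeight Φ (subdivPerm e x σ) ℓ') ∘ some) w (by
      intro U x V hU
      have e1 := hsplit (none :: U.map some) (some x) (V.map some) (by rw [hU]; simp)
      have hx : ∀ z ∈ w, ℓ' (some z) = ℓ z := fun z hz => hℓ z (by
        rintro rfl; exact hn.1 hz)
      have hUm : U.map (ℓ' ∘ some) = U.map ℓ := List.map_congr_left fun z hz =>
        hx z (by rw [hU]; simp [hz])
      have hVm : V.map (ℓ' ∘ some) = V.map ℓ := List.map_congr_left fun z hz =>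
        hx z (by rw [hU]; simp [hz])
      rw [comp_apply, e1, List.map_cons, List.map_map, List.map_map, hUm, hVm,
        hx x (by rw [hU]; simp), ← cum_concat htr, List.map_append]
      simp)
  rw [splitSum_mul_right] at hR0
  rw [hR0]
  simp

/-- An edge labelled by a product may be replaced by two consecutive edges. -/
theorem permTau_subdivide (htr : ∀ a b : A, Φ (a * b) = Φ (b * a)) {src tgt : E → V} {e : E}
    (hc : GraphConnected src tgt) (ℓ : E → A) (ℓ' : Option E → A)
    (he : ℓ e = ℓ' (some e) * ℓ' none) (hℓ : ∀ x, x ≠ e → ℓ' (some x) = ℓ x) :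
    permTau Φ (subdivSrc src e) (subdivTgt tgt) ℓ' = permTau Φ src tgt ℓ := by
  classical
  have := Fintype.ofFinite E
  rw [permTau, permTau, finsum_eq_sum_of_fintype, finsum_eq_sum_of_fintype,
    ← (Equiv.ofBijective _ (subdivPerm_bijective e)).sum_comp, Fintype.sum_prod_type_right]
  refine Finset.sum_congr rfl fun σ _ => ?_
  obtain ⟨w, h, -⟩ := exists_isOrbit σ e
  simp only [ofBijective_apply, tight_subdivPerm hc h]
  split_ifs with ht
  · rw [← sum_permWeight_subdivPerm htr h ℓ ℓ' he hℓ, ← Finset.sum_filter]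
    refine Finset.sum_congr ?_ fun _ _ => rfl
    ext x
    simp [ht]
  · simp [ht]

end Subdivide

/-! ### Contexts -/

attribute [local instance] GraphMonomial.finV GraphMonomial.finE GraphOp.finV

/-- A graph with a hole, in which a `2`-graph monomial may be plugged: its output is identified
with `head` and its input with `tail`. -/
structure Context (J : Type u) where
  V : Type
  E : Type
  finV : Finite V
  finE : Finite E
  src : E → V
  tgt : E → V
  label : E → J
  head : V
  tail : V
  -- The hole counts as an edge `none` from `tail` to `head`; without it the graph may be
  -- disconnected.
  conn : GraphConnected (fun e : Option E => e.elim tail src) (fun e => e.elim head tgt)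

attribute [local instance] Context.finV Context.finE

namespace GraphMonomial

variable {J : Type u}

/-- Exchange the input and the output. -/
def swap (t : GraphMonomial J 2) : GraphMonomial J 2 where
  V := t.V
  E := t.E
  finV := t.finV
  finE := t.finE
  src := t.src
  tgt := t.tgt
  label := t.label
  port := ![t.inp, t.out]
  conn := t.conn

theorem revEdge_iso (a : J) : Iso (revEdge a) (edge a).swap := by
  refine ⟨(show (revEdge a).V ≃ (edge a).swap.V from @Equiv.swap (Fin 2) _ 0 1),
    Equiv.refl _, fun _ => ?_, fun _ => ?_, fun _ => rfl,
    fun i => ?_⟩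
  · exact (Equiv.swap_apply_left (0 : Fin 2) 1).symm
  · exact (Equiv.swap_apply_right (0 : Fin 2) 1).symm
  · fin_cases i
    · exact (Equiv.swap_apply_left (0 : Fin 2) 1).symm
    · exact (Equiv.swap_apply_right (0 : Fin 2) 1).symm

theorem glue_swap_iso (t s : GraphMonomial J 2) : Iso (t.glue s).swap (s.swap.glue t.swap) := by
  refine ⟨⟨Quot.lift (fun x => Quot.mk _ x.swap) ?_, Quot.lift (fun x => Quot.mk _ x.swap) ?_,
    ?_, ?_⟩, Equiv.sumComm _ _, ?_, ?_, ?_, ?_⟩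
  · rintro _ _ ⟨rfl, rfl⟩
    exact (Quot.sound ⟨rfl, rfl⟩).symm
  · rintro _ _ ⟨rfl, rfl⟩
    exact (Quot.sound ⟨rfl, rfl⟩).symm
  · rintro ⟨x | x⟩ <;> rfl
  · rintro ⟨x | x⟩ <;> rfl
  · rintro (e | e) <;> rfl
  · rintro (e | e) <;> rfl
  · rintro (e | e) <;> rfl
  · intro i
    fin_cases i <;> rfl

/-- Connectedness of the part of a graph covered by a graph monomial. -/
theorem mk_eq_of_conn {t : GraphMonomial J 2} {W : Type} (f : t.V → W)
    (h : ∀ e, f (t.src e) = f (t.tgt e)) (x y : t.V) : f x = f y :=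
  t.conn.of_forall (p := fun z => f x = f z) (fun e => by rw [h]) rfl y

end GraphMonomial

namespace Context

variable {J : Type u} (H : Context J)

/-- The identifications made when `t` is plugged in the hole of a context. -/
def PlugRel (t : GraphMonomial J 2) (v w : H.V ⊕ t.V) : Prop :=
  (v = .inl H.head ∧ w = .inr t.out) ∨ (v = .inl H.tail ∧ w = .inr t.inp)

abbrev PlugV (t : GraphMonomial J 2) : Type := Quot (H.PlugRel t)

/-- A vertex of the context, after plugging. -/
abbrev inCtx (t : GraphMonomial J 2) (v : H.V) : H.PlugV t := Quot.mk _ (.inl v)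

/-- A vertex of the plugged graph monomial, after plugging. -/
abbrev inHole (t : GraphMonomial J 2) (v : t.V) : H.PlugV t := Quot.mk _ (.inr v)

variable {H} in
theorem plug_head (t : GraphMonomial J 2) :
    (Quot.mk _ (.inl H.head) : H.PlugV t) = Quot.mk _ (.inr t.out) :=
  Quot.sound (.inl ⟨rfl, rfl⟩)

variable {H} in
theorem plug_tail (t : GraphMonomial J 2) :
    (Quot.mk _ (.inl H.tail) : H.PlugV t) = Quot.mk _ (.inr t.inp) :=
  Quot.sound (.inr ⟨rfl, rfl⟩)

variable {A : Type u} [Ring A] [Algebra ℂ A] (Φ : A →ₗ[ℂ] ℂ)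

/-- The value of `τ_Φ` on the graph obtained by plugging `t` in the hole of `H`. -/
noncomputable def eval (H : Context A) (t : GraphMonomial A 2) : ℂ :=
  permTau Φ (fun e : H.E ⊕ t.E => (Quot.mk _ (Sum.map H.src t.src e) : H.PlugV t))
    (fun e => Quot.mk _ (Sum.map H.tgt t.tgt e)) (Sum.elim H.label t.label)

variable {Φ}

theorem eval_iso (H : Context A) {t s : GraphMonomial A 2} (h : GraphMonomial.Iso t s) :
    H.eval Φ t = H.eval Φ s := by
  obtain ⟨f, g, h1, h2, h3, h4⟩ := h
  have e0 : s.out = f t.out := h4 0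
  have e1 : s.inp = f t.inp := h4 1
  refine permTau_congr (Equiv.sumCongr (Equiv.refl _) g)
    (Quot.congr (Equiv.sumCongr (Equiv.refl _) f) fun x y => ?_) ?_ ?_ ?_
  · have inj := (Equiv.sumCongr (Equiv.refl H.V) f).injective
    have i0 : Sum.inr (f t.out) = Equiv.sumCongr (Equiv.refl H.V) f (.inr t.out) := rfl
    have i1 : Sum.inr (f t.inp) = Equiv.sumCongr (Equiv.refl H.V) f (.inr t.inp) := rfl
    have i2 : Sum.inl H.head = Equiv.sumCongr (Equiv.refl H.V) f (.inl H.head) := rfl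
    have i3 : Sum.inl H.tail = Equiv.sumCongr (Equiv.refl H.V) f (.inl H.tail) := rfl
    rw [PlugRel, PlugRel, e0, e1, i0, i1, i2, i3, inj.eq_iff, inj.eq_iff, inj.eq_iff, inj.eq_iff]
  · rintro (e | e)
    · rfl
    · exact congrArg (fun v => Quot.mk (H.PlugRel s) (.inr v)) (h1 e)
  · rintro (e | e)
    · rfl
    · exact congrArg (fun v => Quot.mk (H.PlugRel s) (.inr v)) (h2 e)
  · rintro (e | e)
    · rfl
    · exact h3 e

/-- Connectedness of a context, in terms of functions constant along the edges. -/
theorem eq_of_forall (H : Context J) {W : Type} (f : H.V → W)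
    (h : ∀ e, f (H.src e) = f (H.tgt e)) (h' : f H.tail = f H.head) (x y : H.V) : f x = f y :=
  H.conn.of_forall (p := fun z => f x = f z) (by
    rintro (_ | e)
    · exact iff_of_eq (congrArg (f x = ·) h')
    · exact iff_of_eq (congrArg (f x = ·) (h e))) rfl y

/-- Apply the hypothesis to the predicate "connected to `x`". -/
theorem conn_of_forall {V E : Type} {src tgt : E → V} {head tail : V}
    (h : ∀ f : V → Prop, (∀ e, f (src e) = f (tgt e)) → f tail = f head → ∀ x y, f x = f y) :
    GraphConnected (fun e : Option E => e.elim tail src) (fun e => e.elim head tgt) := by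
  refine ⟨⟨head⟩, fun x y => ?_⟩
  set r : V → V → Prop := Relation.EqvGen (fun v w => ∃ e : Option E,
    e.elim tail src = v ∧ e.elim head tgt = w) with hr
  have key : ∀ v w, r v w → r x v = r x w := fun v w hvw =>
    propext ⟨fun h1 => .trans _ _ _ h1 hvw, fun h1 => .trans _ _ _ h1 (.symm _ _ hvw)⟩
  have h1 := h (fun z => r x z) (fun e => key _ _ (.rel _ _ ⟨some e, rfl, rfl⟩))
    (key _ _ (.rel _ _ ⟨none, rfl, rfl⟩)) x y
  exact h1 ▸ Relation.EqvGen.refl x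

/-- The context obtained by attaching `s` to the tail of the hole. -/
def right (H : Context J) (s : GraphMonomial J 2) : Context J where
  V := Quot (fun v w : H.V ⊕ s.V => v = .inl H.tail ∧ w = .inr s.inp)
  E := H.E ⊕ s.E
  finV := inferInstance
  finE := inferInstance
  src e := Quot.mk _ (Sum.map H.src s.src e)
  tgt e := Quot.mk _ (Sum.map H.tgt s.tgt e)
  label := Sum.elim H.label s.label
  head := Quot.mk _ (.inl H.head)
  tail := Quot.mk _ (.inr s.out)
  conn := by
    refine conn_of_forall fun f hf hf' => ?_
    have hs := s.mk_eq_of_conn (fun x => f (Quot.mk _ (.inr x))) fun e => hf (.inr e)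
    have hg : f (Quot.mk _ (.inl H.tail)) = f (Quot.mk _ (.inr s.inp)) :=
      congrArg f (Quot.sound ⟨rfl, rfl⟩)
    have hH := H.eq_of_forall (fun x => f (Quot.mk _ (.inl x))) (fun e => hf (.inl e))
      (hg.trans ((hs _ s.out).trans hf'))
    have hall : ∀ x, f x = f (Quot.mk _ (.inl H.tail)) := by
      rintro ⟨x | x⟩
      · exact hH _ _
      · exact (hs _ _).trans hg.symm
    exact fun x y => (hall x).trans (hall y).symm

/-- The context obtained by attaching `s` to the head of the hole. -/
def left (H : Context J) (s : GraphMonomial J 2) : Context J where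
  V := Quot (fun v w : H.V ⊕ s.V => v = .inl H.head ∧ w = .inr s.out)
  E := H.E ⊕ s.E
  finV := inferInstance
  finE := inferInstance
  src e := Quot.mk _ (Sum.map H.src s.src e)
  tgt e := Quot.mk _ (Sum.map H.tgt s.tgt e)
  label := Sum.elim H.label s.label
  head := Quot.mk _ (.inr s.inp)
  tail := Quot.mk _ (.inl H.tail)
  conn := by
    refine conn_of_forall fun f hf hf' => ?_
    have hs := s.mk_eq_of_conn (fun x => f (Quot.mk _ (.inr x))) fun e => hf (.inr e)
    have hg : f (Quot.mk _ (.inl H.head)) = f (Quot.mk _ (.inr s.out)) :=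
      congrArg f (Quot.sound ⟨rfl, rfl⟩)
    have hH := H.eq_of_forall (fun x => f (Quot.mk _ (.inl x))) (fun e => hf (.inl e))
      (hf'.trans ((hs _ s.out).trans hg.symm))
    have hall : ∀ x, f x = f (Quot.mk _ (.inl H.head)) := by
      rintro ⟨x | x⟩
      · exact hH _ _
      · exact (hs _ _).trans hg.symm
    exact fun x y => (hall x).trans (hall y).symm

/-- The two plugged graphs are isomorphic: a factor of the plugged monomial can be absorbed into the
context. -/
theorem eval_glue_right (H : Context A) (t s : GraphMonomial A 2) :
    H.eval Φ (t.glue s) = (H.right s).eval Φ t := by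
  refine permTau_congr ⟨Sum.elim (fun e => .inl (.inl e))
      (Sum.elim (fun e => .inr e) (fun e => .inl (.inr e))),
      Sum.elim (Sum.elim (fun e => .inl e) (fun e => .inr (.inr e))) (fun e => .inr (.inl e)),
      by rintro (e | e | e) <;> rfl, by rintro ((e | e) | e) <;> rfl⟩
    ⟨Quot.lift (Sum.elim (fun v => Quot.mk _ (.inl (Quot.mk _ (.inl v))))
      (Quot.lift (Sum.elim (fun v => Quot.mk _ (.inr v))
        (fun v => Quot.mk _ (.inl (Quot.mk _ (.inr v))))) ?_)) ?_,
     Quot.lift (Sum.elim (Quot.lift (Sum.elim (fun v => Quot.mk _ (.inl v))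
        (fun v => Quot.mk _ (.inr (Quot.mk _ (.inr v))))) ?_)
        (fun v => Quot.mk _ (.inr (Quot.mk _ (.inl v))))) ?_, ?_, ?_⟩ ?_ ?_ ?_
  · rintro _ _ ⟨rfl, rfl⟩
    exact (plug_tail (H := H.right s) t).symm
  · rintro _ _ (⟨rfl, rfl⟩ | ⟨rfl, rfl⟩)
    · exact plug_head (H := H.right s) t
    · exact congrArg ((H.right s).inCtx t) (Quot.sound ⟨rfl, rfl⟩)
  · rintro _ _ ⟨rfl, rfl⟩
    exact plug_tail (t.glue s)
  · rintro _ _ (⟨rfl, rfl⟩ | ⟨rfl, rfl⟩)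
    · exact plug_head (t.glue s)
    · exact congrArg (H.inHole (t.glue s))
        (Quot.sound (r := GraphMonomial.GlueRel t s) ⟨rfl, rfl⟩).symm
  · rintro ⟨v | v⟩
    · rfl
    · obtain ⟨v⟩ := v
      rcases v with v | v <;> rfl
  · rintro ⟨v | v⟩
    · obtain ⟨v⟩ := v
      rcases v with v | v <;> rfl
    · rfl
  · rintro (e | e | e) <;> rfl
  · rintro (e | e | e) <;> rfl
  · rintro (e | e | e) <;> rfl

theorem eval_glue_left (H : Context A) (t s : GraphMonomial A 2) :
    H.eval Φ (t.glue s) = (H.left t).eval Φ s := by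
  refine permTau_congr ⟨Sum.elim (fun e => .inl (.inl e))
      (Sum.elim (fun e => .inl (.inr e)) (fun e => .inr e)),
      Sum.elim (Sum.elim (fun e => .inl e) (fun e => .inr (.inl e))) (fun e => .inr (.inr e)),
      by rintro (e | e | e) <;> rfl, by rintro ((e | e) | e) <;> rfl⟩
    ⟨Quot.lift (Sum.elim (fun v => Quot.mk _ (.inl (Quot.mk _ (.inl v))))
      (Quot.lift (Sum.elim (fun v => Quot.mk _ (.inl (Quot.mk _ (.inr v))))
        (fun v => Quot.mk _ (.inr v))) ?_)) ?_,
     Quot.lift (Sum.elim (Quot.lift (Sum.elim (fun v => Quot.mk _ (.inl v))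
        (fun v => Quot.mk _ (.inr (Quot.mk _ (.inl v))))) ?_)
        (fun v => Quot.mk _ (.inr (Quot.mk _ (.inr v))))) ?_, ?_, ?_⟩ ?_ ?_ ?_
  · rintro _ _ ⟨rfl, rfl⟩
    exact plug_head (H := H.left t) s
  · rintro _ _ (⟨rfl, rfl⟩ | ⟨rfl, rfl⟩)
    · exact congrArg ((H.left t).inCtx s) (Quot.sound ⟨rfl, rfl⟩)
    · exact plug_tail (H := H.left t) s
  · rintro _ _ ⟨rfl, rfl⟩
    exact plug_head (t.glue s)
  · rintro _ _ (⟨rfl, rfl⟩ | ⟨rfl, rfl⟩)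
    · exact congrArg (H.inHole (t.glue s))
        (Quot.sound (r := GraphMonomial.GlueRel t s) ⟨rfl, rfl⟩)
    · exact plug_tail (t.glue s)
  · rintro ⟨v | v⟩
    · rfl
    · obtain ⟨v⟩ := v
      rcases v with v | v <;> rfl
  · rintro ⟨v | v⟩
    · obtain ⟨v⟩ := v
      rcases v with v | v <;> rfl
    · rfl
  · rintro (e | e | e) <;> rfl
  · rintro (e | e | e) <;> rfl
  · rintro (e | e | e) <;> rfl

/-- Exchange head and tail. -/
def swap (H : Context J) : Context J where
  V := H.V
  E := H.E
  finV := inferInstance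
  finE := inferInstance
  src := H.src
  tgt := H.tgt
  label := H.label
  head := H.tail
  tail := H.head
  conn := conn_of_forall fun f hf hf' => H.eq_of_forall f hf hf'.symm

theorem eval_swap (H : Context A) (t : GraphMonomial A 2) :
    H.eval Φ t.swap = H.swap.eval Φ t := by
  refine permTau_congr (Equiv.refl _) (Quot.congr (Equiv.refl _) fun _ _ => or_comm)
    ?_ ?_ ?_
  · rintro (e | e) <;> rfl
  · rintro (e | e) <;> rfl
  · rintro (e | e) <;> rfl

/-! #### Plugging an edge -/

/-- An edge just fills the hole, so the evaluation lives on `Option H.E`, where `none` can be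
relabelled, contracted or subdivided. -/
theorem eval_edge (H : Context A) (a : A) :
    H.eval Φ (GraphMonomial.edge a) = permTau Φ (fun e : Option H.E => e.elim H.tail H.src)
      (fun e => e.elim H.head H.tgt) (fun e => e.elim a H.label) := by
  symm
  refine permTau_congr ⟨fun e => e.elim (.inr ()) .inl, Sum.elim some (fun _ => none),
      by rintro (_ | e) <;> rfl, by rintro (e | e) <;> rfl⟩
    ⟨fun v => Quot.mk _ (.inl v), Quot.lift (Sum.elim id (![H.head, H.tail] : Fin 2 → H.V)) ?_,
      fun v => rfl, ?_⟩ ?_ ?_ ?_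
  · rintro _ _ (⟨rfl, rfl⟩ | ⟨rfl, rfl⟩) <;> rfl
  · rintro ⟨v | v⟩
    · rfl
    · change Fin 2 at v
      fin_cases v
      · exact plug_head (H := H) (GraphMonomial.edge a)
      · exact plug_tail (H := H) (GraphMonomial.edge a)
  · rintro (_ | e)
    · exact (plug_tail (H := H) (GraphMonomial.edge a)).symm
    · rfl
  · rintro (_ | e)
    · exact (plug_head (H := H) (GraphMonomial.edge a)).symm
    · rfl
  · rintro (_ | e) <;> rfl

theorem elim_eq_update [DecidableEq H.E] (ℓ : H.E → A) (a : A) :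
    (fun e : Option H.E => e.elim a ℓ) = Function.update (fun e => e.elim 0 ℓ) none a := by
  funext e
  cases e <;> simp

theorem eval_edge_add (htr : ∀ a b : A, Φ (a * b) = Φ (b * a)) (H : Context A) (a b : A) :
    H.eval Φ (GraphMonomial.edge (a + b)) =
      H.eval Φ (GraphMonomial.edge a) + H.eval Φ (GraphMonomial.edge b) := by
  classical
  rw [eval_edge, eval_edge, eval_edge, elim_eq_update _ _ (a + b), elim_eq_update _ _ a,
    elim_eq_update _ _ b, permTau_update_add htr]

theorem eval_edge_smul (htr : ∀ a b : A, Φ (a * b) = Φ (b * a)) (H : Context A) (c : ℂ) (a : A) :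
    H.eval Φ (GraphMonomial.edge (c • a)) = c * H.eval Φ (GraphMonomial.edge a) := by
  classical
  rw [eval_edge, eval_edge, elim_eq_update _ _ (c • a), elim_eq_update _ _ a,
    permTau_update_smul htr]

theorem eval_edge_one (h1 : Φ 1 = 1) (htr : ∀ a b : A, Φ (a * b) = Φ (b * a)) (H : Context A) :
    H.eval Φ (GraphMonomial.edge 1) = H.eval Φ (GraphMonomial.unit A) := by
  rw [eval_edge, permTau_one h1 htr _ _ _ rfl]
  refine permTau_congr (Equiv.sumEmpty _ Empty).symm
    ⟨Quot.lift (fun v => Quot.mk _ (.inl v)) ?_,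
      Quot.lift (Sum.elim (fun v => Quot.mk _ v) (fun _ => Quot.mk _ H.head)) ?_, ?_, ?_⟩
    (fun _ => rfl) (fun _ => rfl) (fun _ => rfl)
  · rintro _ _ ⟨rfl, rfl⟩
    exact (plug_tail (H := H) (GraphMonomial.unit A)).trans
      (plug_head (H := H) (GraphMonomial.unit A)).symm
  · rintro _ _ (⟨rfl, rfl⟩ | ⟨rfl, rfl⟩)
    · rfl
    · exact Quot.sound ⟨rfl, rfl⟩
  · rintro ⟨v⟩; rfl
  · rintro ⟨v | v⟩
    · rfl
    · exact plug_head (H := H) (GraphMonomial.unit A)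

theorem eval_edge_mul (htr : ∀ a b : A, Φ (a * b) = Φ (b * a)) (H : Context A) (a b : A) :
    H.eval Φ (GraphMonomial.edge (a * b)) =
      H.eval Φ ((GraphMonomial.edge a).glue (GraphMonomial.edge b)) := by
  classical
  -- The edge `none` in the hole is subdivided: its half `some none` next to the head carries `a`,
  -- the new half `none` next to the tail carries `b`.
  rw [eval_glue_right, eval_edge, eval_edge, ← permTau_subdivide htr H.conn (e := none) _
    (fun e => e.elim b (fun e => e.elim a H.label)) rfl]
  · refine permTau_congr
      ⟨fun e => e.elim (some (.inr ())) (fun e => e.elim none (fun e => some (.inl e))),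
        fun e => e.elim (some none) (Sum.elim (fun e => some (some e)) (fun _ => none)),
        by rintro (_ | _ | e) <;> rfl, by rintro (_ | e | e) <;> rfl⟩
      ⟨fun v => v.elim (Quot.mk _ (.inr (0 : Fin 2))) (fun v => Quot.mk _ (.inl v)),
        Quot.lift (Sum.elim some (![none, some H.tail] : Fin 2 → Option H.V)) ?_, ?_, ?_⟩
      ?_ ?_ ?_
    · rintro _ _ ⟨rfl, rfl⟩; rfl
    · rintro (_ | v) <;> rfl
    · rintro ⟨v | v⟩
      · rfl
      · change Fin 2 at v
        fin_cases v
        · rfl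
        · exact Quot.sound ⟨rfl, rfl⟩
    · rintro (_ | _ | e)
      · exact (Quot.sound ⟨rfl, rfl⟩ : Quot.mk (fun v w : H.V ⊕ Fin 2 =>
          v = .inl H.tail ∧ w = .inr 1) (.inl H.tail) = Quot.mk _ (.inr 1)).symm
      · rfl
      · rfl
    · rintro (_ | _ | e) <;> rfl
    · rintro (_ | _ | e) <;> rfl
  · rintro (_ | e) h
    · exact absurd rfl h
    · rfl

/-! #### Graph operations as contexts -/

/-- Single out one summand of a disjoint union. -/
noncomputable def sigmaSplit {K : ℕ} (i : Fin K) (F : Fin K → Type) :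
    (Σ k : {k // k ≠ i}, F k) ⊕ F i ≃ Σ k, F k :=
  Equiv.ofBijective (Sum.elim (fun x => ⟨x.1, x.2⟩) (fun x => ⟨i, x⟩)) (by
    constructor
    · rintro (⟨⟨k, hk⟩, x⟩ | x) (⟨⟨l, hl⟩, y⟩ | y) h
      · simp only [Sum.elim_inl, Sigma.mk.injEq] at h
        obtain ⟨rfl, h⟩ := h
        rw [eq_of_heq h]
      · simp only [Sum.elim_inl, Sum.elim_inr, Sigma.mk.injEq] at h
        exact absurd h.1 hk
      · simp only [Sum.elim_inl, Sum.elim_inr, Sigma.mk.injEq] at h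
        exact absurd h.1.symm hl
      · simp only [Sum.elim_inr, Sigma.mk.injEq, heq_eq_eq, true_and] at h
        rw [h]
    · rintro ⟨k, x⟩
      by_cases hk : k = i
      · subst hk; exact ⟨.inr x, rfl⟩
      · exact ⟨.inl ⟨⟨k, hk⟩, x⟩, rfl⟩)

section GraphOp

variable {K : ℕ} (g : GraphOp K) (i : Fin K) (s : {k // k ≠ i} → GraphMonomial J 2)

/-- The identifications made when all edges of `g` but one are replaced by graph monomials and
the result is plugged in a context. -/
inductive OpRel : H.V ⊕ g.V ⊕ (Σ k, (s k).V) → H.V ⊕ g.V ⊕ (Σ k, (s k).V) → Prop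
  | head : OpRel (.inl H.head) (.inr (.inl g.out))
  | tail : OpRel (.inl H.tail) (.inr (.inl g.inp))
  | source (k) : OpRel (.inr (.inl (g.src k.1))) (.inr (.inr ⟨k, (s k).inp⟩))
  | target (k) : OpRel (.inr (.inl (g.tgt k.1))) (.inr (.inr ⟨k, (s k).out⟩))

/-- The context obtained by replacing all edges of a graph operation but one by graph monomials,
and plugging the result in a context. -/
def ofOp : Context J where
  V := Quot (H.OpRel g i s)
  E := H.E ⊕ Σ k, (s k).E
  finV := inferInstance
  finE := inferInstance
  src e := Quot.mk _ (e.elim (fun e => .inl (H.src e))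
    (fun e => .inr (.inr ⟨e.1, (s e.1).src e.2⟩)))
  tgt e := Quot.mk _ (e.elim (fun e => .inl (H.tgt e))
    (fun e => .inr (.inr ⟨e.1, (s e.1).tgt e.2⟩)))
  label := Sum.elim H.label (fun e => (s e.1).label e.2)
  head := Quot.mk _ (.inr (.inl (g.tgt i)))
  tail := Quot.mk _ (.inr (.inl (g.src i)))
  conn := by
    refine conn_of_forall fun f hf hf' => ?_
    have hs : ∀ k x y, f (Quot.mk _ (.inr (.inr ⟨k, x⟩))) = f (Quot.mk _ (.inr (.inr ⟨k, y⟩))) :=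
      fun k => (s k).mk_eq_of_conn (fun x => f (Quot.mk _ (.inr (.inr ⟨k, x⟩))))
        fun e => hf (.inr ⟨k, e⟩)
    have hsrc : ∀ k : {k // k ≠ i}, f (Quot.mk _ (.inr (.inl (g.src k.1)))) =
        f (Quot.mk _ (.inr (.inr ⟨k, (s k).inp⟩))) := fun k =>
      congrArg f (Quot.sound (OpRel.source k))
    have htgt : ∀ k : {k // k ≠ i}, f (Quot.mk _ (.inr (.inl (g.tgt k.1)))) =
        f (Quot.mk _ (.inr (.inr ⟨k, (s k).out⟩))) := fun k =>
      congrArg f (Quot.sound (OpRel.target k))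
    have hg : ∀ x y, f (Quot.mk _ (.inr (.inl x))) = f (Quot.mk _ (.inr (.inl y))) := by
      intro x y
      refine g.conn.of_forall (p := fun z => f (Quot.mk _ (.inr (.inl x))) =
        f (Quot.mk _ (.inr (.inl z)))) (fun k => ?_) rfl y
      have : f (Quot.mk _ (.inr (.inl (g.src k)))) = f (Quot.mk _ (.inr (.inl (g.tgt k)))) := by
        by_cases hk : k = i
        · subst hk; exact hf'
        · exact (hsrc ⟨k, hk⟩).trans ((hs _ _ _).trans (htgt ⟨k, hk⟩).symm)
      rw [this]
    have hh : f (Quot.mk _ (.inl H.head)) = f (Quot.mk _ (.inr (.inl g.out))) :=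
      congrArg f (Quot.sound OpRel.head)
    have ht : f (Quot.mk _ (.inl H.tail)) = f (Quot.mk _ (.inr (.inl g.inp))) :=
      congrArg f (Quot.sound OpRel.tail)
    have hH := H.eq_of_forall (fun x => f (Quot.mk _ (.inl x))) (fun e => hf (.inl e))
      (ht.trans ((hg _ _).trans hh.symm))
    have hall : ∀ x, f x = f (Quot.mk _ (.inl H.head)) := by
      rintro ⟨x | x | ⟨k, x⟩⟩
      · exact hH _ _
      · exact (hg _ _).trans hh.symm
      · exact (hs k _ _).trans ((hsrc k).symm.trans ((hg _ _).trans hh.symm))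
    exact fun x y => (hall x).trans (hall y).symm

end GraphOp

/-- Everything except the `i`-th argument can be absorbed into the context. -/
theorem eval_subst (H : Context A) {K : ℕ} (g : GraphOp K) (i : Fin K)
    (s : Fin K → GraphMonomial A 2) :
    H.eval Φ (g.subst s) = (H.ofOp g i (fun k => s k)).eval Φ (s i) := by
  symm
  let eV := sigmaSplit i fun k => (s k).V
  have hl : ∀ k : {k // k ≠ i}, ∀ x : (s k).V, eV.symm ⟨k, x⟩ = .inl ⟨k, x⟩ := fun k x =>
    eV.symm_apply_eq.2 rfl
  have hr : ∀ x : (s i).V, eV.symm ⟨i, x⟩ = .inr x := fun x => eV.symm_apply_eq.2 rfl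
  let C : Context A := H.ofOp g i (fun k => s k)
  -- The inverse vertex map before passing to quotients: vertices of `s i` go to the hole, all
  -- others to the enlarged context.
  let b : H.V ⊕ g.V ⊕ (Σ k, (s k).V) → C.PlugV (s i) :=
    Sum.elim (fun v => Quot.mk _ (.inl (Quot.mk _ (.inl v))))
      (Sum.elim (fun v => Quot.mk _ (.inl (Quot.mk _ (.inr (.inl v)))))
        (fun x => (eV.symm x).elim (fun x => Quot.mk _ (.inl (Quot.mk _ (.inr (.inr x)))))
          (fun v => Quot.mk _ (.inr v))))
  have hbs : ∀ k, b (.inr (.inl (g.src k))) = b (.inr (.inr ⟨k, (s k).inp⟩)) := by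
    intro k
    by_cases hk : k = i
    · subst hk
      simp only [b, Sum.elim_inr, hr, Sum.elim_inl]
      exact plug_tail (H := C) (s k)
    · simp only [b, Sum.elim_inr, hl ⟨k, hk⟩, Sum.elim_inl]
      exact congrArg (C.inCtx (s i)) (Quot.sound (OpRel.source ⟨k, hk⟩))
  have hbt : ∀ k, b (.inr (.inl (g.tgt k))) = b (.inr (.inr ⟨k, (s k).out⟩)) := by
    intro k
    by_cases hk : k = i
    · subst hk
      simp only [b, Sum.elim_inr, hr, Sum.elim_inl]
      exact plug_head (H := C) (s k)
    · simp only [b, Sum.elim_inr, hl ⟨k, hk⟩, Sum.elim_inl]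
      exact congrArg (C.inCtx (s i)) (Quot.sound (OpRel.target ⟨k, hk⟩))
  have hsrc : ∀ k, (Quot.mk _ (.inl (g.src k)) : (g.subst s).V) =
      Quot.mk _ (.inr ⟨k, (s k).inp⟩) := fun k => Quot.sound (.source k)
  have htgt : ∀ k, (Quot.mk _ (.inl (g.tgt k)) : (g.subst s).V) =
      Quot.mk _ (.inr ⟨k, (s k).out⟩) := fun k => Quot.sound (.target k)
  refine permTau_congr ((Equiv.sumAssoc _ _ _).trans
      (Equiv.sumCongr (Equiv.refl H.E) (sigmaSplit i fun k => (s k).E)))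
    ⟨Quot.lift (Sum.elim (Quot.lift (Sum.elim (fun v => Quot.mk _ (.inl v))
        (Sum.elim (fun v => Quot.mk _ (.inr (Quot.mk _ (.inl v))))
          (fun x => Quot.mk _ (.inr (Quot.mk _ (.inr ⟨x.1, x.2⟩)))))) ?_)
        (fun v => Quot.mk _ (.inr (Quot.mk _ (.inr ⟨i, v⟩))))) ?_,
      Quot.lift (Sum.elim (fun v => b (.inl v)) (Quot.lift (fun v => b (.inr v)) ?_)) ?_, ?_, ?_⟩
    ?_ ?_ ?_
  · rintro _ _ (_ | _ | k | k)
    · exact plug_head (H := H) (g.subst s)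
    · exact plug_tail (H := H) (g.subst s)
    · exact congrArg (H.inHole (g.subst s)) (hsrc k)
    · exact congrArg (H.inHole (g.subst s)) (htgt k)
  · rintro _ _ (⟨rfl, rfl⟩ | ⟨rfl, rfl⟩)
    · exact congrArg (H.inHole (g.subst s)) (htgt i)
    · exact congrArg (H.inHole (g.subst s)) (hsrc i)
  · rintro _ _ (k | k)
    · exact hbs k
    · exact hbt k
  · rintro _ _ (⟨rfl, rfl⟩ | ⟨rfl, rfl⟩)
    · exact congrArg (C.inCtx (s i)) (Quot.sound OpRel.head)
    · exact congrArg (C.inCtx (s i)) (Quot.sound OpRel.tail)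
  · rintro ⟨v | v⟩
    · obtain ⟨v⟩ := v
      rcases v with v | v | ⟨k, v⟩
      · rfl
      · rfl
      · change b (.inr (.inr ⟨k, v⟩)) = _
        simp only [b, Sum.elim_inr, hl k v, Sum.elim_inl]
        rfl
    · change b (.inr (.inr ⟨i, v⟩)) = _
      simp only [b, Sum.elim_inr, hr v]
      rfl
  · rintro ⟨v | v⟩
    · rfl
    obtain ⟨v⟩ := v
    rcases v with v | ⟨k, v⟩
    · rfl
    · by_cases hk : k = i
      · subst hk
        have hb : b (.inr (.inr ⟨k, v⟩)) = C.inHole (s k) v := by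
          simp only [b, Sum.elim_inr, hr v]
        exact congrArg (Quot.lift _ _) hb
      · have hb : b (.inr (.inr ⟨k, v⟩)) =
            C.inCtx (s i) (Quot.mk _ (.inr (.inr ⟨⟨k, hk⟩, v⟩))) := by
          simp only [b, Sum.elim_inr, hl ⟨k, hk⟩ v, Sum.elim_inl]
        exact congrArg (Quot.lift _ _) hb
  · rintro ((e | e) | e) <;> rfl
  · rintro ((e | e) | e) <;> rfl
  · rintro ((e | e) | e) <;> rfl

end Context

/-! ### Null elements of the algebra of `2`-graph polynomials -/

section Poly

variable {J : Type u}

theorem toPoly_congr {t s : GraphMonomial J 2} (h : GraphMonomial.Iso t s) :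
    t.toPoly = s.toPoly :=
  congrArg (fun x => MonoidAlgebra.single x 1) (Quotient.sound h)

theorem toPoly_mul (t s : GraphMonomial J 2) : t.toPoly * s.toPoly = (t.glue s).toPoly := by
  rw [GraphMonomial.toPoly, GraphMonomial.toPoly, MonoidAlgebra.single_mul_single, one_mul]
  rfl

theorem toPoly_unit : (GraphMonomial.unit J).toPoly = 1 := rfl

theorem single_eq_smul_toPoly (x : GraphClass J 2) (c : ℂ) :
    (MonoidAlgebra.single x c : GraphAlgebra J) = c • (Quotient.out x).toPoly := by
  have : (Quotient.out x).cls = x := Quotient.out_eq x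
  rw [GraphMonomial.toPoly, this, MonoidAlgebra.smul_single, smul_eq_mul, mul_one]

theorem graphAlgebra_induction {p : GraphAlgebra J → Prop} (x : GraphAlgebra J)
    (add : ∀ x y, p x → p y → p (x + y)) (smul : ∀ (c : ℂ) x, p x → p (c • x))
    (toPoly : ∀ t : GraphMonomial J 2, p t.toPoly) : p x := by
  induction x using MonoidAlgebra.induction_linear with
  | zero => rw [← zero_smul ℂ (GraphMonomial.unit J).toPoly]; exact smul _ _ (toPoly _)
  | add x y hx hy => exact add _ _ hx hy
  | single m r => rw [single_eq_smul_toPoly]; exact smul _ _ (toPoly _)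

theorem graphAlgebra_hom_ext {M : Type*} [AddCommGroup M] [Module ℂ M]
    {f g : GraphAlgebra J →ₗ[ℂ] M} (h : ∀ t : GraphMonomial J 2, f t.toPoly = g t.toPoly) :
    f = g := by
  refine LinearMap.ext fun x => ?_
  induction x using graphAlgebra_induction with
  | add x y hx hy => rw [map_add, map_add, hx, hy]
  | smul c x hx => rw [map_smul, map_smul, hx]
  | toPoly t => exact h t

theorem act_toPoly {K : ℕ} (g : GraphOp K) (s : Fin K → GraphMonomial J 2) :
    g.act (fun k => (s k).toPoly) = (g.subst s).toPoly := by
  have := g.act_single (fun k => (s k).cls) (fun _ => 1)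
  rw [GraphOp.substCls_cls, Finset.prod_const_one] at this
  exact this

end Poly

variable {A : Type u} [Ring A] [Algebra ℂ A] (Φ : A →ₗ[ℂ] ℂ)

namespace Context

/-- The linear extension of `Context.eval`. -/
noncomputable def functional (H : Context A) : GraphAlgebra A →ₗ[ℂ] ℂ :=
  (Finsupp.linearCombination ℂ fun x : GraphClass A 2 => H.eval Φ (Quotient.out x))
    ∘ₗ (MonoidAlgebra.coeffLinearEquiv ℂ).toLinearMap

variable {Φ}

theorem functional_toPoly (H : Context A) (t : GraphMonomial A 2) :
    H.functional Φ t.toPoly = H.eval Φ t := by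
  have h : MonoidAlgebra.coeffLinearEquiv ℂ t.toPoly = Finsupp.single t.cls (1 : ℂ) := rfl
  rw [functional, LinearMap.comp_apply, LinearEquiv.coe_coe, h,
    Finsupp.linearCombination_single, one_smul]
  exact H.eval_iso (Quotient.mk_out t)

/-- Multiplying by a monomial only changes the context, which makes the common kernel of all
contexts stable under multiplication. -/
theorem functional_mul_toPoly (H : Context A) (x : GraphAlgebra A) (s : GraphMonomial A 2) :
    H.functional Φ (x * s.toPoly) = (H.right s).functional Φ x := by
  have : H.functional Φ ∘ₗ LinearMap.mulRight ℂ s.toPoly = (H.right s).functional Φ := by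
    refine graphAlgebra_hom_ext fun t => ?_
    rw [LinearMap.comp_apply, LinearMap.mulRight_apply, toPoly_mul, functional_toPoly,
      functional_toPoly, eval_glue_right]
  rw [← this]
  rfl

theorem functional_toPoly_mul (H : Context A) (t : GraphMonomial A 2) (x : GraphAlgebra A) :
    H.functional Φ (t.toPoly * x) = (H.left t).functional Φ x := by
  have : H.functional Φ ∘ₗ LinearMap.mulLeft ℂ t.toPoly = (H.left t).functional Φ := by
    refine graphAlgebra_hom_ext fun s => ?_
    rw [LinearMap.comp_apply, LinearMap.mulLeft_apply, toPoly_mul, functional_toPoly,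
      functional_toPoly, eval_glue_left]
  rw [← this]
  rfl

/-- With the other arguments monomials, `Z_g` in its `i`-th slot is also only a change of context,
so it preserves equality modulo null elements. -/
theorem functional_act (H : Context A) {K : ℕ} (g : GraphOp K) (i : Fin K)
    (s : Fin K → GraphMonomial A 2) (x : GraphAlgebra A) :
    H.functional Φ (g.act (Function.update (fun k => (s k).toPoly) i x)) =
      (H.ofOp g i (fun k => s k)).functional Φ x := by
  have : H.functional Φ ∘ₗ g.act.toLinearMap (fun k => (s k).toPoly) i =
      (H.ofOp g i (fun k => s k)).functional Φ := by
    refine graphAlgebra_hom_ext fun t => ?_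
    rw [LinearMap.comp_apply, MultilinearMap.toLinearMap_apply, functional_toPoly]
    have h1 : Function.update (fun k => (s k).toPoly) i t.toPoly =
        fun k => (Function.update s i t k).toPoly := by
      funext k
      by_cases hk : k = i
      · subst hk; simp
      · simp [hk]
    have h2 : (fun k : {k // k ≠ i} => Function.update s i t k) = fun k : {k // k ≠ i} => s k := by
      funext k
      exact Function.update_of_ne k.2 _ _
    rw [h1, act_toPoly, functional_toPoly, eval_subst (Φ := Φ) H g i, h2, Function.update_self]
  rw [← this]
  rfl

end Context

/-- The elements on which all contexts vanish. -/
noncomputable def nullIdeal : Ideal (GraphAlgebra A) where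
  carrier := {x | ∀ H : Context A, H.functional Φ x = 0}
  add_mem' := fun hx hy H => by rw [map_add, hx H, hy H, add_zero]
  zero_mem' := fun H => map_zero _
  smul_mem' := fun c x hx => by
    induction c using graphAlgebra_induction with
    | add c d hc hd =>
      intro H
      rw [smul_eq_mul, add_mul, map_add, ← smul_eq_mul, ← smul_eq_mul, hc H, hd H, add_zero]
    | smul r c hc =>
      intro H
      rw [smul_assoc, map_smul, hc H, smul_zero]
    | toPoly t =>
      intro H
      rw [smul_eq_mul, Context.functional_toPoly_mul]
      exact hx _

variable {Φ}

theorem mem_nullIdeal {x : GraphAlgebra A} :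
    x ∈ nullIdeal Φ ↔ ∀ H : Context A, H.functional Φ x = 0 := Iff.rfl

instance : (nullIdeal Φ).IsTwoSided where
  mul_mem_of_left := fun {x} y hx => by
    induction y using graphAlgebra_induction with
    | add c d hc hd => rw [mul_add]; exact Ideal.add_mem _ hc hd
    | smul r c hc =>
      intro H
      rw [mul_smul_comm, map_smul, hc H, smul_zero]
    | toPoly t =>
      intro H
      rw [Context.functional_mul_toPoly]
      exact hx _

variable (Φ) in
/-- The quotient of the algebra of `2`-graph polynomials by the null elements. -/
abbrev NullQuot := GraphAlgebra A ⧸ nullIdeal Φ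

variable (Φ) in
/-- The quotient map. -/
noncomputable abbrev toNullQuot : GraphAlgebra A →ₐ[ℂ] NullQuot Φ :=
  Ideal.Quotient.mkₐ ℂ (nullIdeal Φ)

theorem toNullQuot_eq_iff {x y : GraphAlgebra A} :
    toNullQuot Φ x = toNullQuot Φ y ↔
      ∀ H : Context A, H.functional Φ x = H.functional Φ y := by
  rw [Ideal.Quotient.mkₐ_eq_mk, Ideal.Quotient.eq, mem_nullIdeal]
  simp only [map_sub, sub_eq_zero]

/-- Modulo null elements, the edges form an algebra. -/
noncomputable def edgeHom (h1 : Φ 1 = 1) (htr : ∀ a b : A, Φ (a * b) = Φ (b * a)) :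
    A →ₐ[ℂ] NullQuot Φ :=
  AlgHom.ofLinearMap
    { toFun := fun a => toNullQuot Φ (GraphMonomial.edge a).toPoly
      map_add' := fun a b => by
        rw [← map_add, toNullQuot_eq_iff]
        intro H
        simp only [map_add, Context.functional_toPoly, Context.eval_edge_add htr]
      map_smul' := fun c a => by
        rw [RingHom.id_apply, ← map_smul, toNullQuot_eq_iff]
        intro H
        simp only [map_smul, Context.functional_toPoly, Context.eval_edge_smul htr, smul_eq_mul] }
    (by
      change toNullQuot Φ (GraphMonomial.edge 1).toPoly = 1
      rw [← map_one (toNullQuot Φ), ← toPoly_unit, toNullQuot_eq_iff]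
      intro H
      simp only [Context.functional_toPoly, Context.eval_edge_one h1 htr])
    (by
      intro a b
      change toNullQuot Φ (GraphMonomial.edge (a * b)).toPoly =
        toNullQuot Φ (GraphMonomial.edge a).toPoly * toNullQuot Φ (GraphMonomial.edge b).toPoly
      rw [← map_mul, toNullQuot_eq_iff, toPoly_mul]
      intro H
      simp only [Context.functional_toPoly, Context.eval_edge_mul htr])

theorem edgeHom_apply (h1 : Φ 1 = 1) (htr : ∀ a b : A, Φ (a * b) = Φ (b * a)) (a : A) :
    edgeHom h1 htr a = toNullQuot Φ (GraphMonomial.edge a).toPoly := rfl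

/-- Exchanging the ends of the hole transfers every identity for edges to reversed edges, with
products in the opposite order. -/
theorem eval_revEdge (H : Context A) (a : A) :
    H.eval Φ (GraphMonomial.revEdge a) = H.swap.eval Φ (GraphMonomial.edge a) := by
  rw [H.eval_iso (GraphMonomial.revEdge_iso a), Context.eval_swap]

theorem revEdge_add (htr : ∀ a b : A, Φ (a * b) = Φ (b * a)) (a b : A) :
    toNullQuot Φ (GraphMonomial.revEdge (a + b)).toPoly =
      toNullQuot Φ (GraphMonomial.revEdge a).toPoly +
        toNullQuot Φ (GraphMonomial.revEdge b).toPoly := by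
  rw [← map_add, toNullQuot_eq_iff]
  intro H
  simp only [map_add, Context.functional_toPoly, eval_revEdge, Context.eval_edge_add htr]

theorem revEdge_smul (htr : ∀ a b : A, Φ (a * b) = Φ (b * a)) (c : ℂ) (a : A) :
    toNullQuot Φ (GraphMonomial.revEdge (c • a)).toPoly =
      c • toNullQuot Φ (GraphMonomial.revEdge a).toPoly := by
  rw [← map_smul, toNullQuot_eq_iff]
  intro H
  simp only [map_smul, Context.functional_toPoly, eval_revEdge, Context.eval_edge_smul htr,
    smul_eq_mul]

theorem revEdge_one (h1 : Φ 1 = 1) (htr : ∀ a b : A, Φ (a * b) = Φ (b * a)) :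
    toNullQuot Φ (GraphMonomial.revEdge (1 : A)).toPoly = 1 := by
  rw [← map_one (toNullQuot Φ), ← toPoly_unit, toNullQuot_eq_iff]
  intro H
  simp only [Context.functional_toPoly, eval_revEdge, Context.eval_edge_one h1 htr,
    ← Context.eval_swap]
  refine H.eval_iso ⟨Equiv.refl _, Equiv.refl _, fun _ => rfl, fun _ => rfl, fun _ => rfl,
    fun _ => rfl⟩

theorem revEdge_mul (htr : ∀ a b : A, Φ (a * b) = Φ (b * a)) (a b : A) :
    toNullQuot Φ (GraphMonomial.revEdge (a * b)).toPoly =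
      toNullQuot Φ (GraphMonomial.revEdge b).toPoly *
        toNullQuot Φ (GraphMonomial.revEdge a).toPoly := by
  rw [← map_mul, toNullQuot_eq_iff, toPoly_mul]
  intro H
  rw [Context.functional_toPoly, Context.functional_toPoly, eval_revEdge,
    Context.eval_edge_mul htr, ← Context.eval_swap]
  exact H.eval_iso ((GraphMonomial.glue_swap_iso _ _).trans
    (GraphMonomial.glue_iso (GraphMonomial.revEdge_iso b).symm
      (GraphMonomial.revEdge_iso a).symm))

/-- After absorbing `g` and the edges labelled `b` into the context, the claim is that `edgeHom`
commutes with evaluating the polynomial `P`. -/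
theorem toNullQuot_of_freeRel (h1 : Φ 1 = 1) (htr : ∀ a b : A, Φ (a * b) = Φ (b * a))
    {x y : GraphAlgebra A} (h : FreeRel A x y) : toNullQuot Φ x = toNullQuot Φ y := by
  obtain ⟨g, i, b, P, a⟩ := h
  rw [toNullQuot_eq_iff]
  intro H
  rw [H.functional_act, H.functional_act]
  refine toNullQuot_eq_iff.1 ?_ _
  rw [← edgeHom_apply h1 htr]
  have : (edgeHom h1 htr).comp (FreeAlgebra.lift ℂ a) = (toNullQuot Φ).comp
      (FreeAlgebra.lift ℂ (fun l => (GraphMonomial.edge (a l)).toPoly)) := by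
    ext l
    simp only [Function.comp_apply, AlgHom.comp_apply, FreeAlgebra.lift_ι_apply, edgeHom_apply]
  exact DFunLike.congr_fun this P

theorem LinearMap.exists_factor {M N P : Type*} [AddCommGroup M] [AddCommGroup N]
    [AddCommGroup P] [Module ℂ M] [Module ℂ N] [Module ℂ P] (f : M →ₗ[ℂ] N) (g : M →ₗ[ℂ] P)
    (hf : Function.Surjective f) (h : ∀ x, f x = 0 → g x = 0) :
    ∃ k : N →ₗ[ℂ] P, ∀ x, k (f x) = g x := by
  obtain ⟨s, hs⟩ := f.exists_rightInverse_of_surjective (LinearMap.range_eq_top.2 hf)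
  refine ⟨g ∘ₗ s, fun x => ?_⟩
  have h2 : f (s (f x) - x) = 0 := by
    rw [map_sub, sub_eq_zero]
    exact LinearMap.congr_fun hs (f x)
  have := h _ h2
  rwa [map_sub, sub_eq_zero] at this

theorem exists_functional_nullQuot (H : Context A) :
    ∃ ψ : NullQuot Φ →ₗ[ℂ] ℂ, ∀ x, ψ (toNullQuot Φ x) = H.functional Φ x := by
  refine LinearMap.exists_factor (toNullQuot Φ).toLinearMap (H.functional Φ)
    (Ideal.Quotient.mkₐ_surjective ℂ _) fun x hx => ?_
  have h : toNullQuot Φ x = toNullQuot Φ 0 := by rw [map_zero]; exact hx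
  rw [toNullQuot_eq_iff.1 h H, map_zero]

/-! ### The trivial context, paths and cycles -/

/-- The context whose output and input are identified. -/
def Context.trivial (J : Type u) : Context J where
  V := Unit
  E := Empty
  finV := inferInstance
  finE := inferInstance
  src := Empty.elim
  tgt := Empty.elim
  label := Empty.elim
  head := ()
  tail := ()
  conn := ⟨⟨()⟩, fun _ _ => .refl _⟩

/-- The edge from input to output, or from output to input. -/
def GraphMonomial.dirEdge {J : Type u} (ε : Bool) (a : J) : GraphMonomial J 2 :=
  if ε then revEdge a else edge a

theorem pathConn (n : ℕ) (ε : Fin n → Bool) : GraphConnected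
    (fun k => if ε k then k.castSucc else k.succ) (fun k => if ε k then k.succ else k.castSucc) := by
  set r := Relation.EqvGen (fun v w => ∃ k, (if ε k then k.castSucc else k.succ) = v ∧
    (if ε k then k.succ else k.castSucc) = w) with hr
  have h : ∀ k : Fin n, r k.castSucc k.succ := by
    intro k
    cases hk : ε k with
    | true => exact .rel _ _ ⟨k, by simp [hk], by simp [hk]⟩
    | false => exact .symm _ _ (.rel _ _ ⟨k, by simp [hk], by simp [hk]⟩)
  have h0 : ∀ k, r 0 k := by
    intro k
    induction k using Fin.induction with
    | zero => exact .refl _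
    | succ k ih => exact .trans _ _ _ ih (h k)
  exact ⟨⟨0⟩, fun x y => .trans _ _ _ (.symm _ _ (h0 x)) (h0 y)⟩

/-- A path from the output to the input; the edge `k` is directed towards the output when
`ε k = false`. -/
def GraphMonomial.path {J : Type u} {n : ℕ} (ε : Fin n → Bool) (a : Fin n → J) :
    GraphMonomial J 2 where
  V := Fin (n + 1)
  E := Fin n
  finV := inferInstance
  finE := inferInstance
  src k := if ε k then k.castSucc else k.succ
  tgt k := if ε k then k.succ else k.castSucc
  label := a
  port := ![0, Fin.last n]
  conn := pathConn n ε

theorem dirEdge_glue_path_iso {J : Type u} {n : ℕ} (ε : Fin (n + 1) → Bool) (a : Fin (n + 1) → J) :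
    GraphMonomial.Iso ((GraphMonomial.dirEdge (ε 0) (a 0)).glue
      (GraphMonomial.path (fun k => ε k.succ) (fun k => a k.succ))) (GraphMonomial.path ε a) := by
  cases h0 : ε 0 with
  | false =>
    simp only [GraphMonomial.dirEdge]
    refine ⟨⟨Quot.lift (Sum.elim (![0, 1] : Fin 2 → Fin (n + 2)) (Fin.succ : Fin (n + 1) → _)) ?_,
      (Fin.cases (Quot.mk _ (.inl (0 : Fin 2))) (fun k => Quot.mk _ (.inr k)) : Fin (n + 2) → _),
      ?_, ?_⟩, ⟨Sum.elim (fun _ => (0 : Fin (n + 1))) (Fin.succ : Fin n → _),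
      (Fin.cases (.inl ()) (fun k => .inr k) : Fin (n + 1) → _), ?_, ?_⟩, ?_, ?_, ?_, ?_⟩
    · rintro _ _ ⟨rfl, rfl⟩; rfl
    · rintro ⟨v | v⟩
      · change Fin 2 at v
        fin_cases v
        · rfl
        · exact (Quot.sound ⟨rfl, rfl⟩ : Quot.mk (GraphMonomial.GlueRel (GraphMonomial.edge (a 0))
            (GraphMonomial.path (fun k => ε k.succ) (fun k => a k.succ))) (.inl (1 : Fin 2)) =
            Quot.mk _ (.inr (0 : Fin (n + 1)))).symm
      · rfl
    · intro v
      change Fin (n + 2) at v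
      cases v using Fin.cases <;> rfl
    · rintro (e | e) <;> rfl
    · intro e
      change Fin (n + 1) at e
      cases e using Fin.cases <;> rfl
    · rintro (e | e)
      · change (if ε 0 then _ else _) = _
        simp [h0]; rfl
      · change (if ε (Fin.succ e) then _ else _) = Fin.succ (if ε (Fin.succ e) then _ else _)
        split_ifs <;> rfl
    · rintro (e | e)
      · change (if ε 0 then _ else _) = _
        simp [h0]; rfl
      · change (if ε (Fin.succ e) then _ else _) = Fin.succ (if ε (Fin.succ e) then _ else _)
        split_ifs <;> rfl
    · rintro (e | e) <;> rfl
    · intro i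
      fin_cases i <;> rfl
  | true =>
    simp only [GraphMonomial.dirEdge]
    refine ⟨⟨Quot.lift (Sum.elim (![0, 1] : Fin 2 → Fin (n + 2)) (Fin.succ : Fin (n + 1) → _)) ?_,
      (Fin.cases (Quot.mk _ (.inl (0 : Fin 2))) (fun k => Quot.mk _ (.inr k)) : Fin (n + 2) → _),
      ?_, ?_⟩, ⟨Sum.elim (fun _ => (0 : Fin (n + 1))) (Fin.succ : Fin n → _),
      (Fin.cases (.inl ()) (fun k => .inr k) : Fin (n + 1) → _), ?_, ?_⟩, ?_, ?_, ?_, ?_⟩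
    · rintro _ _ ⟨rfl, rfl⟩; rfl
    · rintro ⟨v | v⟩
      · change Fin 2 at v
        fin_cases v
        · rfl
        · exact (Quot.sound ⟨rfl, rfl⟩ : Quot.mk (GraphMonomial.GlueRel (GraphMonomial.revEdge (a 0))
            (GraphMonomial.path (fun k => ε k.succ) (fun k => a k.succ))) (.inl (1 : Fin 2)) =
            Quot.mk _ (.inr (0 : Fin (n + 1)))).symm
      · rfl
    · intro v
      change Fin (n + 2) at v
      cases v using Fin.cases <;> rfl
    · rintro (e | e) <;> rfl
    · intro e
      change Fin (n + 1) at e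
      cases e using Fin.cases <;> rfl
    · rintro (e | e)
      · change (if ε 0 then _ else _) = _
        simp [h0]; rfl
      · change (if ε (Fin.succ e) then _ else _) = Fin.succ (if ε (Fin.succ e) then _ else _)
        split_ifs <;> rfl
    · rintro (e | e)
      · change (if ε 0 then _ else _) = _
        simp [h0]; rfl
      · change (if ε (Fin.succ e) then _ else _) = Fin.succ (if ε (Fin.succ e) then _ else _)
        split_ifs <;> rfl
    · rintro (e | e) <;> rfl
    · intro i
      fin_cases i <;> rfl

theorem path_zero_iso {J : Type u} (ε : Fin 0 → Bool) (a : Fin 0 → J) :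
    GraphMonomial.Iso (GraphMonomial.unit J) (GraphMonomial.path ε a) := by
  refine ⟨⟨fun _ => (0 : Fin 1), fun _ => (), fun _ => rfl, fun v => ?_⟩,
    ⟨Empty.elim, fun e : Fin 0 => e.elim0, fun e => e.elim, fun e => Fin.elim0 e⟩,
    fun e => e.elim, fun e => e.elim, fun e => e.elim, fun i => ?_⟩
  · exact Subsingleton.elim (α := Fin 1) _ _
  · exact Subsingleton.elim (α := Fin 1) _ _

theorem prod_dirEdge {J : Type u} {n : ℕ} (ε : Fin n → Bool) (a : Fin n → J) :
    (List.ofFn fun k => (GraphMonomial.dirEdge (ε k) (a k)).toPoly).prod =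
      (GraphMonomial.path ε a).toPoly := by
  induction n with
  | zero =>
    rw [List.ofFn_zero, List.prod_nil, ← toPoly_unit]
    exact toPoly_congr (path_zero_iso ε a)
  | succ n ih =>
    rw [List.ofFn_succ, List.prod_cons, ih (fun k => ε k.succ) (fun k => a k.succ), toPoly_mul]
    exact toPoly_congr (dirEdge_glue_path_iso ε a)

/-- The sources of the edges of a cycle, obtained by closing a path. -/
def cycSrc {m : ℕ} (ε : Fin (m + 1) → Bool) (k : Fin (m + 1)) : Fin (m + 1) :=
  if ε k then k else k + 1

/-- The targets of the edges of a cycle, obtained by closing a path. -/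
def cycTgt {m : ℕ} (ε : Fin (m + 1) → Bool) (k : Fin (m + 1)) : Fin (m + 1) :=
  if ε k then k + 1 else k

theorem cycConn {m : ℕ} (ε : Fin (m + 1) → Bool) : GraphConnected (cycSrc ε) (cycTgt ε) := by
  set r := Relation.EqvGen (fun v w => ∃ k, cycSrc ε k = v ∧ cycTgt ε k = w) with hr
  have h : ∀ k : Fin (m + 1), r k (k + 1) := by
    intro k
    cases hk : ε k with
    | true => exact .rel _ _ ⟨k, by simp [cycSrc, hk], by simp [cycTgt, hk]⟩
    | false => exact .symm _ _ (.rel _ _ ⟨k, by simp [cycSrc, hk], by simp [cycTgt, hk]⟩)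
  have h0 : ∀ k, r 0 k := by
    intro k
    induction k using Fin.induction with
    | zero => exact .refl _
    | succ k ih => exact .trans _ _ _ ih (by simpa using h k.castSucc)
  exact ⟨⟨0⟩, fun x y => .trans _ _ _ (.symm _ _ (h0 x)) (h0 y)⟩

/-! ### Closed paths and the value of an oriented cycle -/

section Trace

variable {A : Type u} [Ring A] [Algebra ℂ A] {Φ : A →ₗ[ℂ] ℂ}

/-- Identify the end points of a path. -/
def closeEnd {m : ℕ} : Fin (m + 2) → Fin (m + 1) := Fin.lastCases 0 fun k => k

theorem closeEnd_last (m : ℕ) : closeEnd (Fin.last (m + 1)) = 0 := Fin.lastCases_last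

theorem closeEnd_castSucc {m : ℕ} (k : Fin (m + 1)) : closeEnd k.castSucc = k :=
  Fin.lastCases_castSucc (motive := fun _ => Fin (m + 1)) k

theorem closeEnd_succ {m : ℕ} (k : Fin (m + 1)) : closeEnd k.succ = k + 1 := by
  cases k using Fin.lastCases with
  | last => rw [Fin.succ_last, closeEnd_last, Fin.last_add_one]
  | cast k => rw [Fin.succ_castSucc, closeEnd_castSucc, Fin.coeSucc_eq_succ]

theorem eval_trivial_path {m : ℕ} (ε : Fin (m + 1) → Bool) (a : Fin (m + 1) → A) :
    (Context.trivial A).eval Φ (GraphMonomial.path ε a) = permTau Φ (cycSrc ε) (cycTgt ε) a := by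
  refine permTau_congr (Equiv.emptySum Empty (Fin (m + 1)))
    ⟨Quot.lift (Sum.elim (fun _ => (0 : Fin (m + 1))) closeEnd) ?_,
      fun k => Quot.mk _ (.inr k.castSucc), ?_, closeEnd_castSucc⟩ ?_ ?_ ?_
  · rintro _ _ (⟨rfl, rfl⟩ | ⟨rfl, rfl⟩)
    · exact (closeEnd_castSucc (0 : Fin (m + 1))).symm
    · exact (closeEnd_last m).symm
  · have h0 := Context.plug_head (H := Context.trivial A) (GraphMonomial.path ε a)
    have h1 := Context.plug_tail (H := Context.trivial A) (GraphMonomial.path ε a)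
    rintro ⟨v | v⟩
    · exact h0.symm
    · change Fin (m + 2) at v
      change (Quot.mk _ (.inr (closeEnd v).castSucc) :
          (Context.trivial A).PlugV (GraphMonomial.path ε a)) = Quot.mk _ (.inr v)
      cases v using Fin.lastCases with
      | last => rw [closeEnd_last]; exact h0.symm.trans h1
      | cast v => rw [closeEnd_castSucc]
  · rintro (e | e)
    · exact e.elim
    · change Fin (m + 1) at e
      change cycSrc ε e = closeEnd (if ε e then e.castSucc else e.succ)
      rw [cycSrc, apply_ite closeEnd, closeEnd_castSucc, closeEnd_succ]
  · rintro (e | e)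
    · exact e.elim
    · change Fin (m + 1) at e
      change cycTgt ε e = closeEnd (if ε e then e.succ else e.castSucc)
      rw [cycTgt, apply_ite closeEnd, closeEnd_castSucc, closeEnd_succ]
  · rintro (e | e)
    · exact e.elim
    · rfl

theorem permTau_loop (htr : ∀ a b : A, Φ (a * b) = Φ (b * a)) (a : Fin 1 → A) :
    permTau Φ (cycSrc fun _ => false) (cycTgt fun _ => false) a = Φ (a 0) := by
  have : Unique (Fin (0 + 1)) := inferInstanceAs (Unique (Fin 1))
  have hc : ∀ σ : Equiv.Perm (Fin 1), cycles σ = {(([0] : List (Fin 1)) : Cycle (Fin 1))} := by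
    intro σ
    have h : IsOrbit σ 0 [] := ⟨by simp, by simpa using Subsingleton.elim _ _⟩
    rw [cycles, Set.range_unique, ← h.periodicOrbit_eq]
    exact congrArg (fun x : Fin 1 => ({Function.periodicOrbit σ x} : Set (Cycle (Fin 1))))
      (Subsingleton.elim _ _)
  have ht : ∀ σ, Tight (cycSrc fun _ : Fin 1 => false) (cycTgt fun _ => false) σ := by
    intro σ
    have : Nat.card (PermQuot (cycSrc fun _ : Fin 1 => false) (cycTgt fun _ => false) σ) = 1 :=
      Nat.card_eq_one_iff_unique.2 ⟨Quot.Subsingleton, ⟨Quot.mk _ 0⟩⟩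
    rw [Tight, this, ncyc, hc, Set.ncard_singleton, Nat.card_eq_fintype_card, Fintype.card_fin]
  rw [permTau, finsum_eq_sum_of_fintype, Fintype.sum_unique, if_pos (ht _), permWeight, hc,
    finprod_mem_singleton]
  exact (cycCum_coe htr [a 0]).trans (cum_singleton _ _)

theorem eval_trivial_edge (htr : ∀ a b : A, Φ (a * b) = Φ (b * a)) (a : A) :
    (Context.trivial A).eval Φ (GraphMonomial.edge a) = Φ a := by
  have h := prod_dirEdge (fun _ : Fin 1 => false) (fun _ => a)
  rw [List.ofFn_succ, List.ofFn_zero, List.prod_cons, List.prod_nil, mul_one] at h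
  have h2 := congrArg ((Context.trivial A).functional Φ) h
  rw [Context.functional_toPoly, Context.functional_toPoly, eval_trivial_path,
    permTau_loop htr] at h2
  exact h2

/-- Modulo null elements a path of edges is one edge labelled by the product, and closing an edge
labelled `a` into a loop gives `Φ a`. -/
theorem permTau_cycle (h1 : Φ 1 = 1) (htr : ∀ a b : A, Φ (a * b) = Φ (b * a)) {m : ℕ}
    (a : Fin (m + 1) → A) :
    permTau Φ (cycSrc fun _ => false) (cycTgt fun _ => false) a = Φ (List.ofFn a).prod := by
  rw [← eval_trivial_path, ← Context.functional_toPoly, ← prod_dirEdge,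
    ← eval_trivial_edge htr, ← Context.functional_toPoly]
  refine toNullQuot_eq_iff.1 ?_ _
  rw [map_list_prod, ← edgeHom_apply h1 htr, map_list_prod, List.map_ofFn, List.map_ofFn]
  rfl

end Trace

/-! ### Tight permutations of a cycle and non-crossing partitions -/

section NonCrossing

open Equiv Function

/-- By finiteness, forward stability suffices to reach the whole orbit. Usually `p` expresses being
on one side of a cut. -/
theorem of_mem_orbit {E : Type} [Finite E] {σ : Perm E} {p : E → Prop} {x y : E}
    (hp : ∀ z, p z → p (σ z)) (hx : p x) (hy : y ∈ periodicOrbit σ x) : p y := by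
  obtain ⟨n, rfl⟩ := (mem_periodicOrbit_iff (mem_periodicPts_perm σ x)).1 hy
  induction n with
  | zero => exact hx
  | succ n ih =>
    rw [iterate_succ_apply']
    exact hp _ (ih ((mem_periodicOrbit_iff (mem_periodicPts_perm σ x)).2 ⟨n, rfl⟩))

theorem mem_orbit_self {E : Type} [Finite E] (σ : Perm E) (x : E) : x ∈ periodicOrbit σ x :=
  mem_orbit_iff.2 rfl

theorem mem_orbit_comm {E : Type} [Finite E] {σ : Perm E} {x y : E} :
    x ∈ periodicOrbit σ y ↔ y ∈ periodicOrbit σ x := by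
  rw [mem_orbit_iff, mem_orbit_iff, eq_comm]

/-- Each element is mapped to the next one, cyclically, in its orbit. -/
def IsNext {n : ℕ} (σ : Perm (Fin n)) : Prop :=
  ∀ x, ∀ y ∈ periodicOrbit σ x, (σ x ≤ x → σ x ≤ y ∧ y ≤ x) ∧ (x < σ x → y ≤ x ∨ σ x ≤ y)

/-- The orbits do not cross. -/
def OrbitsNonCrossing {n : ℕ} (σ : Perm (Fin n)) : Prop :=
  ∀ i j k l, i < j → j < k → k < l → k ∈ periodicOrbit σ i → l ∈ periodicOrbit σ j →
    j ∈ periodicOrbit σ i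

theorem fin_interval {m : ℕ} {p : Fin (m + 1) → Prop} {x y : Fin (m + 1)} (hxy : x ≤ y)
    (h : ∀ k, x ≤ k → k < y → (p k ↔ p (k + 1))) : p x ↔ p y := by
  induction y using Fin.induction with
  | zero => rw [Fin.le_zero_iff.1 hxy]
  | succ k ih =>
    rcases hxy.eq_or_lt with rfl | hlt
    · rfl
    · have hk : x ≤ k.castSucc := Fin.le_castSucc_iff.2 hlt
      have h1 := h k.castSucc hk Fin.castSucc_lt_succ
      rw [Fin.coeSucc_eq_succ] at h1
      exact (ih hk fun j h2 h3 => h j h2 (h3.trans Fin.castSucc_lt_succ)).trans h1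

/-- Such a permutation is determined by its orbits, since the cyclic successor within a set is
unique. -/
theorem IsNext.ext {n : ℕ} {σ σ' : Perm (Fin n)} (h : IsNext σ) (h' : IsNext σ')
    (ho : ∀ x y, y ∈ periodicOrbit σ x ↔ y ∈ periodicOrbit σ' x) : σ = σ' := by
  ext1 x
  have m1 : σ x ∈ periodicOrbit σ' x := (ho _ _).1 (apply_mem_orbit (mem_orbit_self σ x))
  have m2 : σ' x ∈ periodicOrbit σ x := (ho _ _).2 (apply_mem_orbit (mem_orbit_self σ' x))
  obtain ⟨h1, h2⟩ := h x _ m2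
  obtain ⟨h3, h4⟩ := h' x _ m1
  rcases le_or_gt (σ x) x with hx | hx <;> rcases le_or_gt (σ' x) x with hx' | hx'
  · exact le_antisymm (h1 hx).1 (h3 hx').1
  · exact absurd (h1 hx).2 hx'.not_ge
  · exact absurd (h3 hx').2 hx.not_ge
  · exact le_antisymm ((h2 hx).resolve_left hx'.not_ge) ((h4 hx').resolve_left hx.not_ge)

variable {m : ℕ} {σ : Perm (Fin (m + 1))}

/-- Cut at the edges `x` and `σ x`: the side `χ` is the cyclic arc from `σ x + 1` to `x`. Every
orbit element other than `σ x` lies in that arc, so none lies strictly between `x` and `σ x`. -/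
theorem Tight.isNext (h : Tight (cycSrc fun _ => false) (cycTgt fun _ => false) σ) :
    IsNext σ := by
  intro x y hy
  by_cases hx : σ x = x
  · have : y = x := of_mem_orbit (p := fun z => z = x) (fun z hz => by rw [hz, hx]) rfl hy
    subst this
    rw [hx]
    exact ⟨fun _ => ⟨le_rfl, le_rfl⟩, fun h => absurd h (lt_irrefl _)⟩
  obtain ⟨χ, h1, h2, h3, h4, h5, h6⟩ := h.exists_cut (cycConn _)
    (apply_mem_orbit (mem_orbit_self σ x)) hx
  simp only [cycSrc, cycTgt, Bool.false_eq_true, if_false] at h1 h2 h3 h4 h5 h6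
  -- The negation is stable under `σ`: away from the cut edges both ends of an edge are on the same
  -- side, and entering `σ x` requires coming from `x`. Its orbit would then contain `x`,
  -- contradicting `χ x`.
  have key : y = σ x ∨ χ y := by
    by_contra hc
    have := of_mem_orbit (σ := σ) (p := fun z => ¬ (z = σ x ∨ χ z)) (x := y) (y := x) ?_ hc
      (mem_orbit_comm.1 hy)
    · exact this (.inr h3)
    · rintro z hz hz'
      push Not at hz
      have hzx : z ≠ x := fun h => hz.2 (h ▸ h3)
      rcases hz' with hz' | hz'
      · exact hzx (σ.injective hz')
      · exact hz.2 ((h2 z hzx hz.1).1 ((h1 z).2 hz'))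
  constructor
  · intro hle
    rcases key with rfl | hχ
    · exact ⟨le_rfl, hle⟩
    refine ⟨le_of_not_gt fun hlt => h6 ?_, le_of_not_gt fun hlt => h5 ?_⟩
    · refine (fin_interval hlt.le fun k hk hk' => (h2 k ?_ ?_).symm).1 hχ
      · exact (hk'.trans_le hle).ne
      · exact hk'.ne
    · refine (fin_interval (Fin.add_one_le_of_lt hlt) fun k hk hk' => (h2 k ?_ ?_).symm).2 hχ
      · rintro rfl
        exact absurd (Fin.lt_add_one_iff.2 (lt_of_lt_of_le hlt (Fin.le_last _))) hk.not_gt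
      · rintro rfl
        exact absurd (Fin.lt_add_one_iff.2 (lt_of_lt_of_le hlt (Fin.le_last _)))
          (hk.trans hle).not_gt
  · intro hlt
    rcases key with rfl | hχ
    · exact .inr le_rfl
    by_contra hc
    push Not at hc
    refine h5 ((fin_interval (Fin.add_one_le_of_lt hc.1) fun k hk hk' => (h2 k ?_ ?_).symm).2 hχ)
    · rintro rfl
      exact absurd (Fin.lt_add_one_iff.2 (lt_of_lt_of_le hlt (Fin.le_last _))) hk.not_gt
    · rintro rfl
      exact absurd (hk'.trans hc.2) (lt_irrefl _)

/-- Cut at `i` and `k`. If `j` is not in their orbit, its own orbit avoids the cut edges and remains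
on the side of `j`, whereas `l` lies on the other side. -/
theorem Tight.orbitsNonCrossing (h : Tight (cycSrc fun _ => false) (cycTgt fun _ => false) σ) :
    OrbitsNonCrossing σ := by
  intro i j k l hij hjk hkl hk hl
  by_contra hj
  obtain ⟨χ, h1, h2, h3, h4, h5, h6⟩ := h.exists_cut (cycConn _) hk (hij.trans hjk).ne'
  simp only [cycSrc, cycTgt, Bool.false_eq_true, if_false] at h1 h2 h3 h4 h5 h6
  have hlt : ∀ {x y : Fin (m + 1)}, x < y → x < x + 1 := fun hxy =>
    Fin.lt_add_one_iff.2 (lt_of_lt_of_le hxy (Fin.le_last _))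
  have hχ : j ∉ periodicOrbit σ i ∧ ¬ χ j := by
    refine ⟨hj, fun hχ => h5 ?_⟩
    refine (fin_interval (Fin.add_one_le_of_lt hij) fun z hz hz' => (h2 z ?_ ?_).symm).2 hχ
    · rintro rfl; exact absurd (hlt hij) hz.not_gt
    · exact (hz'.trans hjk).ne
  have hl' := of_mem_orbit (p := fun z => z ∉ periodicOrbit σ i ∧ ¬ χ z) (fun z hz => ?_) hχ hl
  · refine hl'.2 ((fin_interval (Fin.add_one_le_of_lt hkl) fun z hz hz' => (h2 z ?_ ?_).symm).1 h4)
    · rintro rfl; exact absurd (hlt hkl) (hz.trans (hij.trans hjk).le).not_gt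
    · rintro rfl; exact absurd (hlt hkl) hz.not_gt
  · have hzi : z ≠ i := fun h => hz.1 (h ▸ mem_orbit_self σ z)
    have hzk : z ≠ k := fun h => hz.1 (h ▸ hk)
    refine ⟨fun h => hz.1 ?_, fun h => hz.2 ((h2 z hzi hzk).1 ((h1 z).2 h))⟩
    rw [mem_orbit_iff, orbit_apply] at h
    exact mem_orbit_iff.2 h

/-- An element that is not an ascent is the maximum of its orbit, so each cycle has at most one. -/
theorem card_not_lt_le (h : IsNext σ) : Nat.card {e // ¬ e < σ e} ≤ ncyc σ := by
  have := (finite_cycles σ).to_subtype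
  rw [ncyc, ← Nat.card_coe_set_eq]
  refine Nat.card_le_card_of_injective
    (fun e => (⟨periodicOrbit σ e.1, e.1, rfl⟩ : cycles σ)) ?_
  rintro ⟨e, he⟩ ⟨f, hf⟩ hef
  replace hef : periodicOrbit σ e = periodicOrbit σ f := congrArg Subtype.val hef
  push Not at he hf
  have h1 := ((h e f (mem_orbit_iff.2 hef.symm)).1 he).2
  have h2 := ((h f e (mem_orbit_iff.2 hef)).1 hf).2
  exact Subtype.ext (le_antisymm h2 h1)

/-- For every ascent `e < σ e` the interval `(e, σ e]` is a union of classes. These intervals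
separate the vertices `e + 1` from one another and from `0`. -/
theorem lt_card_permQuot (h : IsNext σ) (hnc : OrbitsNonCrossing σ) :
    Nat.card {e // e < σ e} + 1 ≤
      Nat.card (PermQuot (cycSrc fun _ => false) (cycTgt fun _ => false) σ) := by
  rw [← Finite.card_option]
  -- The identifications are `k + 1 ~ σ k`. In the orbit of `e` only `k = e` meets the interval, by
  -- `IsNext`; other orbits cannot enter or leave it without crossing.
  have hinv : ∀ e, e < σ e → ∀ k, (e < k + 1 ∧ k + 1 ≤ σ e) ↔ (e < σ k ∧ σ k ≤ σ e) := by
    intro e he k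
    have h1 : (e < k + 1 ∧ k + 1 ≤ σ e) ↔ e ≤ k ∧ k < σ e := by
      rcases (Fin.le_last k).eq_or_lt with rfl | hk
      · rw [Fin.last_add_one]
        exact ⟨fun h => absurd h.1 (Fin.not_lt_zero e), fun h => absurd h.2 (Fin.le_last _).not_gt⟩
      · rw [Fin.lt_def, Fin.le_def, Fin.le_def, Fin.lt_def, Fin.val_add_one_of_lt hk]
        omega
    rw [h1]
    by_cases hk : k ∈ periodicOrbit σ e
    · have hek := mem_orbit_comm.1 hk
      have a1 := (h e k hk).2 he
      have a2 := (h e _ (apply_mem_orbit hk)).2 he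
      obtain ⟨b1, b2⟩ := h k e hek
      obtain ⟨c1, c2⟩ := h k (σ e) (apply_mem_orbit hek)
      have inj : σ k = σ e → k = e := fun h => σ.injective h
      constructor
      · rintro ⟨h3, h4⟩
        have : k = e := le_antisymm (a1.resolve_right h4.not_ge) h3
        rw [this]
        exact ⟨he, le_rfl⟩
      · rintro ⟨h3, h4⟩
        have : k = e := σ.injective (le_antisymm h4 (a2.resolve_left h3.not_ge))
        rw [this]
        exact ⟨le_rfl, he⟩
    · have hk1 : k ≠ e := fun h => hk (h ▸ mem_orbit_self σ k)
      have hk2 : k ≠ σ e := fun h => hk (h ▸ apply_mem_orbit (mem_orbit_self σ e))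
      have hk' : σ k ∉ periodicOrbit σ e := fun h => hk (by
        rw [mem_orbit_iff, orbit_apply] at h; exact mem_orbit_iff.2 h)
      have hk3 : σ k ≠ e := fun h => hk' (h ▸ mem_orbit_self σ (σ k))
      have hk4 : σ k ≠ σ e := fun h => hk1 (σ.injective h)
      have ms : σ e ∈ periodicOrbit σ e := apply_mem_orbit (mem_orbit_self σ e)
      have mk : σ k ∈ periodicOrbit σ k := apply_mem_orbit (mem_orbit_self σ k)
      constructor
      · rintro ⟨h3, h4⟩
        have h3 := lt_of_le_of_ne h3 hk1.symm
        refine ⟨lt_of_not_ge fun h5 => hk ?_, le_of_not_gt fun h5 => hk ?_⟩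
        · have := hnc _ _ _ _ (lt_of_le_of_ne h5 hk3) h3 h4 (mem_orbit_comm.1 mk)
            ms
          exact mem_orbit_comm.1 ((mem_orbit_iff.2 ((mem_orbit_iff.1 this).trans
            (orbit_apply σ k))))
        · exact hnc _ _ _ _ h3 h4 h5 ms mk
      · rintro ⟨h3, h4⟩
        have h4 := lt_of_le_of_ne h4 hk4
        refine ⟨le_of_not_gt fun h5 => hk ?_, lt_of_not_ge fun h5 => hk' ?_⟩
        · exact mem_orbit_comm.1 (hnc _ _ _ _ h5 h3 h4 mk ms)
        · exact hnc _ _ _ _ h3 h4 (lt_of_le_of_ne h5 hk2.symm) ms (mem_orbit_comm.1 mk)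
  let q : ∀ e, e < σ e → PermQuot (cycSrc fun _ => false) (cycTgt fun _ => false) σ → Prop :=
    fun e he => Quot.lift (fun v => e < v ∧ v ≤ σ e) (by
      rintro _ _ ⟨k, rfl, rfl⟩
      exact propext (hinv e he k))
  have hlt : ∀ {e}, e < σ e → e < e + 1 := fun he =>
    Fin.lt_add_one_iff.2 (lt_of_lt_of_le he (Fin.le_last _))
  have hq : ∀ e (he : e < σ e), q e he (Quot.mk _ (e + 1)) := fun e he =>
    ⟨hlt he, Fin.add_one_le_of_lt he⟩
  refine Nat.card_le_card_of_injective
    (fun e : Option {e // e < σ e} => (Quot.mk _ (e.elim 0 fun e => e.1 + 1) :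
      PermQuot (cycSrc fun _ => false) (cycTgt fun _ => false) σ)) ?_
  have h0 : ∀ e (he : e < σ e), ¬ q e he (Quot.mk _ 0) := fun e he h =>
    absurd h.1 (Fin.not_lt_zero e)
  have h1 : ∀ e f (he : e < σ e) (hf : f < σ f), e < f → ¬ q f hf (Quot.mk _ (e + 1)) :=
    fun e f he hf hef h => absurd h.1 (Fin.add_one_le_of_lt hef).not_gt
  rintro (_ | ⟨e, he⟩) (_ | ⟨f, hf⟩) hef
  · rfl
  · exact absurd (congrArg (q f hf) hef ▸ hq f hf) (h0 f hf)
  · exact absurd (congrArg (q e he) hef ▸ hq e he) (h0 e he)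
  · rcases lt_trichotomy e f with h2 | rfl | h2
    · exact absurd (congrArg (q f hf) hef ▸ hq f hf) (h1 e f he hf h2)
    · rfl
    · exact absurd (congrArg (q e he) hef ▸ hq e he) (h1 f e hf he h2)

/-- For the converse, non-ascents bound the cycles from below and ascents, plus one, bound the
classes from below; together they attain the general upper bound. -/
theorem tight_cycle_iff : Tight (cycSrc fun _ => false) (cycTgt fun _ => false) σ ↔
    IsNext σ ∧ OrbitsNonCrossing σ := by
  refine ⟨fun h => ⟨h.isNext, h.orbitsNonCrossing⟩, fun ⟨h, hnc⟩ => ?_⟩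
  have h1 := card_permQuot_add_ncyc_le (cycConn fun _ : Fin (m + 1) => false) σ
  have h2 := card_not_lt_le h
  have h3 := lt_card_permQuot h hnc
  have h4 := Nat.card_congr (Equiv.sumCompl fun e : Fin (m + 1) => e < σ e)
  rw [Nat.card_sum] at h4
  unfold Tight
  omega

/-- The permutation mapping each element to the next one, cyclically, in its block. -/
noncomputable def blockPerm {n : ℕ} (π : Finpartition (Finset.univ : Finset (Fin n))) :
    Perm (Fin n) :=
  Equiv.ofBijective (fun e => (π.part e).sort.formPerm e) (by
    refine Finite.injective_iff_bijective.1 fun e f h => ?_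
    have hm : ∀ e, (π.part e).sort.formPerm e ∈ π.part e := fun e =>
      (Finset.mem_sort _).1 (List.formPerm_apply_mem_of_mem
        ((Finset.mem_sort (· ≤ ·)).2 (π.mem_part (Finset.mem_univ e))))
    have h1 : π.part e = π.part f :=
      (π.part_eq_of_mem (π.part_mem.2 (Finset.mem_univ e)) (hm e)).symm.trans
        ((congrArg π.part h).trans
          (π.part_eq_of_mem (π.part_mem.2 (Finset.mem_univ f)) (hm f)))
    have h2 : (π.part f).sort.formPerm e = (π.part f).sort.formPerm f := by
      rw [← h1]
      exact h.trans (by rw [h1])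
    exact (List.formPerm _).injective h2)

/-! ### Partitions as permutations -/

section Block

variable {n : ℕ} {π : Finpartition (Finset.univ : Finset (Fin n))}

theorem blockPerm_apply (e : Fin n) : blockPerm π e = (π.part e).sort.formPerm e := rfl

theorem blockPerm_getElem {B : Finset (Fin n)} (hB : B ∈ π.parts) (i : ℕ) (hi : i < B.sort.length) :
    blockPerm π B.sort[i] = B.sort[(i + 1) % B.sort.length]'
      (Nat.mod_lt _ (Nat.zero_lt_of_lt hi)) := by
  have h : π.part B.sort[i] = B :=
    π.part_eq_of_mem hB ((Finset.mem_sort _).1 (List.getElem_mem hi))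
  rw [blockPerm_apply, h]
  exact List.formPerm_apply_getElem _ (Finset.sort_nodup _ _) _ _

theorem blockPerm_isOrbit {B : Finset (Fin n)} (hB : B ∈ π.parts) {a : Fin n} {w : List (Fin n)}
    (h : B.sort = a :: w) : IsOrbit (blockPerm π) a w := by
  refine ⟨h ▸ Finset.sort_nodup B (· ≤ ·), ?_⟩
  have h1 : w ++ [a] = B.sort.rotate 1 := by rw [h, List.rotate_cons_succ, List.rotate_zero]
  rw [h1, ← h]
  refine List.ext_getElem (by simp) fun i hi hi' => ?_
  rw [List.getElem_map, blockPerm_getElem hB, List.getElem_rotate]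

theorem mem_blockPerm_orbit {x y : Fin n} :
    y ∈ periodicOrbit (blockPerm π) x ↔ y ∈ π.part x := by
  have hB := π.part_mem.2 (Finset.mem_univ x)
  have hx := (Finset.mem_sort (· ≤ ·)).2 (π.mem_part (Finset.mem_univ x))
  rw [← Finset.mem_sort (· ≤ ·)]
  obtain ⟨a, w, hs⟩ := List.exists_cons_of_ne_nil (List.ne_nil_of_mem hx)
  have h := blockPerm_isOrbit hB hs
  rw [hs] at hx ⊢
  obtain ⟨u, hu, huw⟩ := h.of_mem hx
  rw [hu.periodicOrbit_eq, huw]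
  rfl

theorem blockPerm_isNext : IsNext (blockPerm π) := by
  intro x y hy
  rw [mem_blockPerm_orbit] at hy
  have hB := π.part_mem.2 (Finset.mem_univ x)
  have hx := π.mem_part (Finset.mem_univ x)
  generalize π.part x = B at hB hx hy
  have hmono := (Finset.sortedLT_sort B).strictMono_get
  obtain ⟨i, hi, rfl⟩ := List.getElem_of_mem ((Finset.mem_sort (· ≤ ·)).2 hx)
  obtain ⟨j, hj, rfl⟩ := List.getElem_of_mem ((Finset.mem_sort (· ≤ ·)).2 hy)
  have hle : ∀ {i j : ℕ} {hi : i < B.sort.length} {hj : j < B.sort.length},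
      B.sort[i] ≤ B.sort[j] ↔ i ≤ j := fun {i j hi hj} =>
    hmono.le_iff_le (a := ⟨i, hi⟩) (b := ⟨j, hj⟩)
  rw [blockPerm_getElem hB, ← not_le, hle, hle, hle]
  rcases Nat.lt_or_ge (i + 1) B.sort.length with h | h
  · rw [Nat.mod_eq_of_lt h]
    omega
  · have : i + 1 = B.sort.length := by omega
    rw [this, Nat.mod_self]
    omega

theorem blockPerm_orbitsNonCrossing_iff : OrbitsNonCrossing (blockPerm π) ↔ NonCrossing π := by
  constructor
  · intro h i j k l hij hjk hkl B hB C hC hi hk hj hl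
    have h1 := h i j k l hij hjk hkl (mem_blockPerm_orbit.2 (by rwa [π.part_eq_of_mem hB hi]))
      (mem_blockPerm_orbit.2 (by rwa [π.part_eq_of_mem hC hj]))
    rw [mem_blockPerm_orbit, π.part_eq_of_mem hB hi] at h1
    rw [← π.part_eq_of_mem hB h1, π.part_eq_of_mem hC hj]
  · intro h i j k l hij hjk hkl hk hl
    rw [mem_blockPerm_orbit] at hk hl ⊢
    have := h i j k l hij hjk hkl _ (π.part_mem.2 (Finset.mem_univ i)) _
      (π.part_mem.2 (Finset.mem_univ j)) (π.mem_part (Finset.mem_univ i)) hk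
      (π.mem_part (Finset.mem_univ j)) hl
    rw [this]
    exact π.mem_part (Finset.mem_univ j)

theorem blockPerm_injective : Injective (blockPerm (n := n)) := by
  intro π π' h
  have h1 : ∀ x, π.part x = π'.part x := fun x => by
    ext y
    rw [← mem_blockPerm_orbit, ← mem_blockPerm_orbit, h]
  have h2 : ∀ {π π' : Finpartition (Finset.univ : Finset (Fin n))},
      (∀ x, π.part x = π'.part x) → π.parts ⊆ π'.parts := by
    intro π π' h B hB
    obtain ⟨x, hx⟩ := π.nonempty_of_mem_parts hB
    rw [← π.part_eq_of_mem hB hx, h]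
    exact π'.part_mem.2 (Finset.mem_univ x)
  exact Finpartition.ext (Finset.Subset.antisymm (h2 h1) (h2 fun x => (h1 x).symm))

theorem exists_blockPerm_eq {σ : Perm (Fin n)} (h : IsNext σ) : ∃ π, blockPerm π = σ := by
  classical
  let s : Setoid (Fin n) := Setoid.ker (periodicOrbit σ)
  refine ⟨Finpartition.ofSetoid s, blockPerm_isNext.ext h fun x y => ?_⟩
  rw [mem_blockPerm_orbit, Finpartition.mem_part_ofSetoid_iff_rel, mem_orbit_iff]
  exact eq_comm

variable {A : Type u} [Ring A] [Algebra ℂ A] {Φ : A →ₗ[ℂ] ℂ}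

theorem permWeight_blockPerm (htr : ∀ a b : A, Φ (a * b) = Φ (b * a)) (a : Fin n → A) :
    permWeight Φ (blockPerm π) a =
      ∏ B : {B // B ∈ π.parts}, cum Φ (List.ofFn fun i => a (B.1.orderEmbOfFin rfl i)) := by
  have hc : cycles (blockPerm π) =
      Set.range fun B : {B // B ∈ π.parts} => ((B.1.sort : List (Fin n)) : Cycle (Fin n)) := by
    refine cycles_eq_of_cover ?_ fun e => ?_
    · rintro _ ⟨⟨B, hB⟩, rfl⟩
      obtain ⟨x, hx⟩ := π.nonempty_of_mem_parts hB
      obtain ⟨b, w, hs⟩ := List.exists_cons_of_ne_nil (List.ne_nil_of_mem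
        ((Finset.mem_sort (· ≤ ·)).2 hx))
      simp only [hs]
      exact (blockPerm_isOrbit hB hs).mem_cycles
    · exact ⟨_, ⟨⟨π.part e, π.part_mem.2 (Finset.mem_univ e)⟩, rfl⟩,
        (Finset.mem_sort (· ≤ ·)).2 (π.mem_part (Finset.mem_univ e))⟩
  have hinj : Injective fun B : {B // B ∈ π.parts} =>
      ((B.1.sort : List (Fin n)) : Cycle (Fin n)) := by
    rintro ⟨B, hB⟩ ⟨C, hC⟩ h
    refine Subtype.ext (Finset.ext fun x => ?_)
    rw [← Finset.mem_sort (· ≤ ·), ← Finset.mem_sort (s := C) (· ≤ ·)]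
    exact (Quotient.exact h : List.IsRotated _ _).mem_iff
  rw [permWeight, hc, finprod_mem_range hinj, finprod_eq_prod_of_fintype]
  refine Finset.prod_congr rfl fun B _ => ?_
  refine (cycCum_coe htr (B.1.sort.map a)).trans (congrArg (cum Φ) ?_)
  rw [← Finset.listMap_orderEmbOfFin_finRange B.1 rfl, List.map_map, List.ofFn_eq_map]
  rfl

end Block

/-! ### The list cumulants are the free cumulants -/

section Cumulant

variable {A : Type u} [Ring A] [Algebra ℂ A] {Φ : A →ₗ[ℂ] ℂ}

open Classical in
-- Evaluate the oriented cycle in two ways: merging its edges, and summing over its tight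
-- permutations, which are the `blockPerm` of non-crossing partitions.
theorem moment_eq_sum_cum (h1 : Φ 1 = 1) (htr : ∀ a b : A, Φ (a * b) = Φ (b * a)) {n : ℕ}
    (hn : n ≠ 0) (a : Fin n → A) :
    Φ (List.ofFn a).prod =
      ∑ π : {π : Finpartition (Finset.univ : Finset (Fin n)) // NonCrossing π},
        ∏ B : {B // B ∈ π.1.parts}, cum Φ (List.ofFn fun i => a (B.1.orderEmbOfFin rfl i)) := by
  obtain ⟨m, rfl⟩ := Nat.exists_eq_succ_of_ne_zero hn
  rw [← permTau_cycle h1 htr, permTau, finsum_eq_sum_of_fintype, ← Finset.sum_filter]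
  symm
  refine Finset.sum_bij (fun π _ => blockPerm π.1) ?_ ?_ ?_ ?_
  · intro π _
    rw [Finset.mem_filter, tight_cycle_iff]
    exact ⟨Finset.mem_univ _, blockPerm_isNext, blockPerm_orbitsNonCrossing_iff.2 π.2⟩
  · intro π _ π' _ h
    exact Subtype.ext (blockPerm_injective h)
  · intro σ hσ
    rw [Finset.mem_filter, tight_cycle_iff] at hσ
    obtain ⟨π, rfl⟩ := exists_blockPerm_eq hσ.2.1
    exact ⟨⟨π, blockPerm_orbitsNonCrossing_iff.1 hσ.2.2⟩, Finset.mem_univ _, rfl⟩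
  · intro π _
    exact (permWeight_blockPerm htr a).symm

/-- Both families solve the moment-cumulant formula, which is triangular: all terms except that of
the one-block partition involve shorter cumulants and agree by induction. -/
theorem freeCumulant_eq_cum (h1 : Φ 1 = 1) (htr : ∀ a b : A, Φ (a * b) = Φ (b * a)) {n : ℕ}
    (hn : n ≠ 0) (a : Fin n → A) : freeCumulant Φ n a = cum Φ (List.ofFn a) := by
  classical
  induction n using Nat.strong_induction_on with
  | _ n ih =>
  have : NeZero n := ⟨hn⟩
  have hne : (Finset.univ : Finset (Fin n)) ≠ ⊥ := Finset.univ_nonempty.ne_empty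
  have h2 := (moment_cumulant Φ n hn a).symm.trans (moment_eq_sum_cum h1 htr hn a)
  let π₀ : {π : Finpartition (Finset.univ : Finset (Fin n)) // NonCrossing π} :=
    ⟨Finpartition.indiscrete hne, by
      intro i j k l _ _ _ B hB C hC _ _ _ _
      rw [Finpartition.indiscrete_parts, Finset.mem_singleton] at hB hC
      rw [hB, hC]⟩
  have hpart : ∀ B : {B // B ∈ π₀.1.parts},
      B = ⟨Finset.univ, Finset.mem_singleton_self _⟩ := fun B =>
    Subtype.ext (Finset.mem_singleton.1 B.2)
  -- Transports the one-block term along `card univ = n`; the increasing enumeration of `univ` is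
  -- the identity.
  have key : ∀ (F : (m : ℕ) → (Fin m → A) → ℂ) (m : ℕ)
      (h : (Finset.univ : Finset (Fin n)).card = m),
      F m (fun i => a (Finset.univ.orderEmbOfFin h i)) = F n a := by
    intro F m h
    obtain rfl : n = m := by simpa using h
    congr 1
    funext i
    exact congrArg a (congrFun (Finset.orderEmbOfFin_unique (s := (Finset.univ : Finset (Fin n))) h
      (f := id) (by simp) strictMono_id) i).symm
  rw [← Finset.add_sum_erase _ _ (Finset.mem_univ π₀),
    ← Finset.add_sum_erase _ _ (Finset.mem_univ π₀),
    Fintype.prod_eq_single _ (fun B hB => absurd (hpart B) hB),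
    Fintype.prod_eq_single _ (fun B hB => absurd (hpart B) hB)] at h2
  rw [key (fun m b => freeCumulant Φ m b), key (fun m b => cum Φ (List.ofFn b))] at h2
  refine add_right_cancel (h2.trans (congrArg _ (Finset.sum_congr rfl fun π hπ => ?_)).symm)
  refine Finset.prod_congr rfl fun B _ => ih _ ?_ ?_ _
  · have hB : B.1 ≠ Finset.univ := by
      intro hB
      refine (Finset.mem_erase.1 hπ).1 (Subtype.ext (Finpartition.ext ?_))
      rw [Finpartition.indiscrete_parts]
      refine Finset.eq_singleton_iff_unique_mem.2 
        ⟨(congrArg (· ∈ π.1.parts) hB).mp B.2, fun C hC => ?_⟩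
      obtain ⟨x, hx⟩ := π.1.nonempty_of_mem_parts hC
      rw [← hB]
      exact π.1.eq_of_mem_parts hC B.2 hx (hB.symm.subset (Finset.mem_univ x))
    simpa using (Finset.card_lt_iff_ne_univ B.1).2 hB
  · exact (Finset.card_pos.2 (π.1.nonempty_of_mem_parts B.2)).ne'

end Cumulant

end NonCrossing

/-! ### Cacti and permutations of their edges -/

section Cactus

open Equiv Function

variable {J : Type u} {n : ℕ} {t : GraphMonomial J n} {σ : Perm t.E}

/-- A closed walk cannot cross a cut exactly once. -/
theorem fin_cycle {m : ℕ} {p : Fin (m + 1) → Prop} (j : Fin (m + 1))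
    (h : ∀ k, k ≠ j → (p k ↔ p (k + 1))) : p j ↔ p (j + 1) := by
  have h1 : p 0 ↔ p j := fin_interval (Fin.zero_le j) fun k _ hk => h k hk.ne
  rcases (Fin.le_last j).eq_or_lt with rfl | hj
  · rw [Fin.last_add_one]
    exact h1.symm
  · have h2 : p (j + 1) ↔ p (Fin.last m) := fin_interval (Fin.le_last _) fun k hk _ =>
      h k fun h => absurd (Fin.lt_add_one_iff.2 hj) (h ▸ hk).not_gt
    have h3 := h (Fin.last m) hj.ne'
    rw [Fin.last_add_one] at h3
    exact h1.symm.trans (h3.symm.trans h2.symm)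

/-- The cycles of `σ` are oriented cycles of `t`, and make `t` a cactus. -/
def CactusPerm (t : GraphMonomial J n) (σ : Perm t.E) : Prop :=
  (∀ e, t.src e = t.tgt (σ e)) ∧ Nat.card t.V + ncyc σ = Nat.card t.E + 1

theorem CactusPerm.tight (h : CactusPerm t σ) : Tight t.src t.tgt σ := by
  have hc : Nat.card (PermQuot t.src t.tgt σ) = Nat.card t.V := by
    refine Nat.card_congr ⟨Quot.lift id ?_, Quot.mk _, ?_, fun _ => rfl⟩
    · rintro _ _ ⟨e, rfl, rfl⟩
      exact h.1 e
    · rintro ⟨v⟩; rfl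
  unfold Tight
  rw [hc, h.2]

/-- The cut at two edges of one orbit puts their targets on different sides. -/
theorem CactusPerm.tgt_inj (h : CactusPerm t σ) {x y : t.E} (hy : y ∈ periodicOrbit σ x)
    (hxy : t.tgt x = t.tgt y) : x = y := by
  by_contra hne
  obtain ⟨χ, h1, h2, h3, h4, h5, h6⟩ := h.tight.exists_cut t.conn hy (Ne.symm hne)
  exact h6 (hxy ▸ h3)

theorem GraphMonomial.IsOrientedListing.isCycle {m : ℕ} {e : Fin (m + 1) → t.E}
    (h : t.IsOrientedListing e) : t.IsCycle (Set.range e) :=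
  ⟨m, e, fun i => t.tgt (e i), h.1, h.2.1, rfl, fun i => .inr ⟨h.2.2 i, rfl⟩⟩

/-- An oriented listing of edges of a cycle of the permutation follows the permutation. -/
theorem CactusPerm.apply_listing (h : CactusPerm t σ) {m : ℕ} {e : Fin (m + 1) → t.E}
    (he : t.IsOrientedListing e) (ho : ∀ i j, e i ∈ periodicOrbit σ (e j)) (i : Fin (m + 1)) :
    σ (e i) = e (i + 1) := by
  refine h.tgt_inj ?_ ((h.1 (e i)).symm.trans (he.2.2 i))
  rw [mem_orbit_iff, orbit_apply, ← mem_orbit_iff]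
  exact ho _ _

theorem isOrbit_ofFn {E : Type} {σ : Perm E} {m : ℕ} {e : Fin (m + 1) → E} (hi : Injective e)
    (h : ∀ i, σ (e i) = e (i + 1)) : IsOrbit σ (e 0) (List.ofFn fun i : Fin m => e i.succ) := by
  have h0 : e 0 :: (List.ofFn fun i : Fin m => e i.succ) = List.ofFn e := (List.ofFn_succ).symm
  refine ⟨?_, ?_⟩
  · rw [h0]
    exact List.nodup_ofFn.2 hi
  · rw [h0, List.map_ofFn]
    have h1 : σ ∘ e = fun i => e (i + 1) := funext h
    rw [h1, List.ofFn_succ_last]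
    simp only [Fin.coeSucc_eq_succ, Fin.last_add_one]

theorem exists_listing {E : Type} [Finite E] (σ : Perm E) (x : E) :
    ∃ (m : ℕ) (e : Fin (m + 1) → E), Injective e ∧ (∀ i, σ (e i) = e (i + 1)) ∧
      Set.range e = {y | y ∈ periodicOrbit σ x} := by
  obtain ⟨w, h1, h2⟩ := exists_isOrbit σ x
  refine ⟨w.length, (x :: w).get, List.nodup_iff_injective_get.1 h1.1, fun i => ?_, ?_⟩
  · have h3 : ((x :: w).map σ)[(i : ℕ)]'(by simpa using i.2) =
        (w ++ [x])[(i : ℕ)]'(by simpa using i.2) := by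
      simp only [h1.2]
    rw [List.getElem_map] at h3
    refine h3.trans ?_
    rcases (Fin.le_last i).eq_or_lt with rfl | hi
    · simp
    · have hi' : (i : ℕ) < w.length := hi
      rw [List.getElem_append_left hi']
      have : i + 1 = (⟨i + 1, Nat.succ_lt_succ hi'⟩ : Fin (w.length + 1)) :=
        Fin.ext (Fin.val_add_one_of_lt hi)
      rw [this]
      rfl
  · rw [h2]
    exact Set.range_list_get (x :: w)

theorem CactusPerm.exists_listing (h : CactusPerm t σ) (x : t.E) :
    ∃ (m : ℕ) (e : Fin (m + 1) → t.E), t.IsOrientedListing e ∧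
      Set.range e = {y | y ∈ periodicOrbit σ x} := by
  obtain ⟨m, e, h1, h2, h3⟩ := Traffic.exists_listing σ x
  have hm : ∀ i, e i ∈ periodicOrbit σ x := fun i => h3.subset ⟨i, rfl⟩
  refine ⟨m, e, ⟨h1, fun i j hij => h1 (h.tgt_inj ?_ hij), fun i => ?_⟩, h3⟩
  · rw [mem_orbit_iff, mem_orbit_iff.1 (hm i), ← mem_orbit_iff]
    exact hm j
  · rw [h.1, h2]

/-- Orbits are simple cycles by `tgt_inj`. Conversely, a simple cycle contains the whole orbit of
each of its edges, and consecutive edges of it lie in one orbit. -/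
theorem CactusPerm.isCycle_iff (h : CactusPerm t σ) {C : Set t.E} :
    t.IsCycle C ↔ ∃ x, C = {y | y ∈ periodicOrbit σ x} := by
  constructor
  swap
  · rintro ⟨x, rfl⟩
    obtain ⟨m, e, h1, h2⟩ := h.exists_listing x
    exact h2 ▸ h1.isCycle
  rintro ⟨m, e, v, he, hv, rfl, hev⟩
  -- If an edge `f` of the orbit were outside, the cycle would cross the cut at `e j` and `f` only
  -- once, at `e j`.
  have hsub : ∀ j, ∀ f ∈ periodicOrbit σ (e j), f ∈ Set.range e := by
    intro j f hf
    by_contra hfr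
    obtain ⟨χ, h1, h2, h3, h4, h5, h6⟩ := h.tight.exists_cut t.conn hf
      (fun h => hfr ⟨j, h.symm⟩)
    have h7 := fin_cycle (p := fun k => χ (v k)) j fun k hk => by
      have h8 := h2 (e k) (fun h => hk (he h)) (fun h => hfr ⟨k, h⟩)
      rcases hev k with ⟨h9, h10⟩ | ⟨h9, h10⟩
      · rwa [h9, h10] at h8
      · rw [h9, h10] at h8
        exact h8.symm
    rcases hev j with ⟨h9, h10⟩ | ⟨h9, h10⟩
    · rw [h10] at h3
      rw [h9] at h5
      exact h5 (h7.2 h3)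
    · rw [h10] at h3
      rw [h9] at h5
      exact h5 (h7.1 h3)
  -- The neighbour of `e i` in its orbit at the vertex `v (i + 1)` is `σ (e i)` or its `σ`-preimage,
  -- according to the direction of `e i`. By `hsub` it lies on the cycle, and being different from
  -- `e i` it is `e (i + 1)`. If it equals `e i`, then `e i` is a loop and the cycle has length one.
  have hnext : ∀ i, e (i + 1) ∈ periodicOrbit σ (e i) := by
    intro i
    have key : ∀ x ∈ periodicOrbit σ (e i), x ≠ e i →
        (t.src x = v (i + 1) ∨ t.tgt x = v (i + 1)) → e (i + 1) ∈ periodicOrbit σ (e i) := by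
      intro x hx hne hxv
      obtain ⟨j, rfl⟩ := hsub i x hx
      have hj : v j = v (i + 1) ∨ v (j + 1) = v (i + 1) := by
        rcases hev j with ⟨h9, h10⟩ | ⟨h9, h10⟩ <;> rw [h9, h10] at hxv
        · exact hxv
        · exact hxv.symm
      rcases hj with hj | hj
      · rwa [← hv hj]
      · exact absurd (congrArg e (add_right_cancel (hv hj))) hne
    have loop : t.src (e i) = t.tgt (e i) → e (i + 1) ∈ periodicOrbit σ (e i) := by
      intro hl
      have : v i = v (i + 1) := by
        rcases hev i with ⟨h9, h10⟩ | ⟨h9, h10⟩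
        · rw [← h9, ← h10, hl]
        · rw [← h9, ← h10, hl]
      rw [← hv this]
      exact mem_orbit_self σ _
    rcases hev i with ⟨h9, h10⟩ | ⟨h9, h10⟩
    · have h1 := h.1 (σ.symm (e i))
      rw [Equiv.apply_symm_apply] at h1
      by_cases hs : σ.symm (e i) = e i
      · exact loop (by rw [← h1, hs])
      · refine key _ ?_ hs (.inl (h1.trans h10))
        rw [mem_orbit_iff, ← orbit_apply, Equiv.apply_symm_apply]
    · by_cases hs : σ (e i) = e i
      · have h1 := h.1 (e i)
        rw [hs] at h1
        exact loop h1
      · exact key _ (apply_mem_orbit (mem_orbit_self σ _)) hs (.inr ((h.1 (e i)).symm.trans h9))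
  refine ⟨e 0, Set.Subset.antisymm ?_ (fun f hf => hsub 0 f hf)⟩
  rintro _ ⟨i, rfl⟩
  change e i ∈ periodicOrbit σ (e 0)
  induction i using Fin.induction with
  | zero => exact mem_orbit_self σ _
  | succ i ih =>
    have := hnext i.castSucc
    rw [Fin.coeSucc_eq_succ] at this
    rw [mem_orbit_iff] at ih this ⊢
    rw [this, ih]

theorem CactusPerm.isCactus (h : CactusPerm t σ) : t.IsCactus := by
  intro e
  refine ⟨{y | y ∈ periodicOrbit σ e}, ⟨h.isCycle_iff.2 ⟨e, rfl⟩, mem_orbit_self σ e⟩, ?_⟩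
  rintro C ⟨hC, he⟩
  obtain ⟨x, rfl⟩ := h.isCycle_iff.1 hC
  ext y
  rw [Set.mem_ofPred_eq, Set.mem_ofPred_eq, mem_orbit_iff.1 he]

theorem CactusPerm.isOrientedCycle (h : CactusPerm t σ) {C : Set t.E} (hC : t.IsCycle C) :
    t.IsOrientedCycle C := by
  obtain ⟨x, rfl⟩ := h.isCycle_iff.1 hC
  obtain ⟨m, e, h1, h2⟩ := h.exists_listing x
  exact ⟨⟨m, e⟩, h1, h2⟩

/-- The graph determines the orbits, as its cycles, and `tgt_inj` then determines the successor of
an edge in its orbit. -/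
theorem CactusPerm.unique (h : CactusPerm t σ) {σ' : Perm t.E} (h' : CactusPerm t σ') :
    σ = σ' := by
  ext1 e
  obtain ⟨C, -, hC⟩ := h.isCactus e
  have h1 := hC {y | y ∈ periodicOrbit σ e} ⟨h.isCycle_iff.2 ⟨e, rfl⟩, mem_orbit_self σ e⟩
  have h2 := hC {y | y ∈ periodicOrbit σ' e} ⟨h'.isCycle_iff.2 ⟨e, rfl⟩, mem_orbit_self σ' e⟩
  have h3 : σ' e ∈ periodicOrbit σ e := by
    have : σ' e ∈ {y | y ∈ periodicOrbit σ' e} := apply_mem_orbit (mem_orbit_self σ' e)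
    rwa [h2, ← h1] at this
  refine h.tgt_inj ?_ ((h.1 e).symm.trans (h'.1 e))
  rw [mem_orbit_iff, orbit_apply, ← mem_orbit_iff]
  exact h3

/-! #### Permutations from cacti -/

/-- The underlying simple graph of the subgraph with edge set `F`. -/
def subGraph (t : GraphMonomial J n) (F : Set t.E) : SimpleGraph t.V where
  Adj x y := x ≠ y ∧ ∃ g ∈ F, (t.src g = x ∧ t.tgt g = y) ∨ (t.src g = y ∧ t.tgt g = x)
  symm := ⟨fun _ _ h => ⟨h.1.symm, h.2.imp fun _ h => ⟨h.1, h.2.symm⟩⟩⟩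
  loopless := ⟨fun _ h => h.1 rfl⟩

/-- A simple path in `F` from the source to the target of `f` is closed up by `f`, listed last. -/
theorem exists_isCycle_of_reachable {F : Set t.E} {f : t.E} (hf : f ∉ F)
    (h : (subGraph t F).Reachable (t.src f) (t.tgt f)) :
    ∃ C, t.IsCycle C ∧ f ∈ C ∧ C ⊆ insert f F := by
  classical
  obtain ⟨p, hp⟩ := h.exists_isPath
  have hg : ∀ i : Fin p.length, ∃ g ∈ F,
      (t.src g = p.getVert i ∧ t.tgt g = p.getVert (i + 1)) ∨
        (t.src g = p.getVert (i + 1) ∧ t.tgt g = p.getVert i) :=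
    fun i => (p.adj_getVert_succ i.2).2
  choose g hgF hg using hg
  have hinj : ∀ {i j : ℕ}, i ≤ p.length → j ≤ p.length → p.getVert i = p.getVert j → i = j :=
    fun hi hj h => hp.getVert_injOn hi hj h
  obtain ⟨e, hel, hec⟩ : ∃ e : Fin (p.length + 1) → t.E,
      e (Fin.last _) = f ∧ ∀ i, e (Fin.castSucc i) = g i :=
    ⟨Fin.snoc (α := fun _ => t.E) g f, Fin.snoc_last (α := fun _ => t.E) _ _,
      fun i => Fin.snoc_castSucc (α := fun _ => t.E) _ _ i⟩
  refine ⟨_, ⟨p.length, e, fun i => p.getVert i, ?_, ?_, rfl, ?_⟩, ?_, ?_⟩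
  · intro i j hij
    cases i using Fin.lastCases with
    | last =>
      cases j using Fin.lastCases with
      | last => rfl
      | cast j =>
        rw [hel, hec] at hij
        exact absurd (hij ▸ hgF j) hf
    | cast i =>
      cases j using Fin.lastCases with
      | last =>
        rw [hel, hec] at hij
        exact absurd (hij ▸ hgF i) hf
      | cast j =>
        rw [hec, hec] at hij
        have h1 := hg i
        rw [hij] at h1
        have hi := i.2
        have hj := j.2
        have h3 : (i : ℕ) = j := by
          rcases h1 with ⟨a1, a2⟩ | ⟨a1, a2⟩ <;> rcases hg j with ⟨b1, b2⟩ | ⟨b1, b2⟩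
          · exact hinj hi.le hj.le (a1.symm.trans b1)
          · have := hinj hi.le hj (a1.symm.trans b1)
            have := hinj hi hj.le (a2.symm.trans b2)
            omega
          · have := hinj hi hj.le (a1.symm.trans b1)
            have := hinj hi.le hj (a2.symm.trans b2)
            omega
          · exact hinj hi.le hj.le (a2.symm.trans b2)
        rw [Fin.ext h3]
  · intro i j hij
    exact Fin.ext (hinj (Nat.lt_succ_iff.1 i.2) (Nat.lt_succ_iff.1 j.2) hij)
  · intro i
    cases i using Fin.lastCases with
    | last =>
      rw [hel]
      change _ ∨ t.src f = p.getVert (Fin.last p.length + 1 : Fin (p.length + 1)) ∧ _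
      rw [Fin.last_add_one]
      refine .inr ⟨?_, ?_⟩
      · simp
      · simp
    | cast i =>
      rw [hec, Fin.coeSucc_eq_succ]
      exact hg i
  · exact ⟨Fin.last _, hel⟩
  · rintro _ ⟨i, rfl⟩
    cases i using Fin.lastCases with
    | last => rw [hel]; exact Set.mem_insert _ _
    | cast i => rw [hec]; exact Set.mem_insert_of_mem _ (hgF i)

/-- A graph all of whose edges are bridges is a forest. -/
theorem card_add_one_le_of_bridges {V F : Type} [Finite V] [Nonempty V] [Finite F]
    (src tgt : F → V) (h : ∀ f, ∃ χ : V → Prop, χ (src f) ∧ ¬ χ (tgt f) ∧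
      ∀ g, g ≠ f → (χ (src g) ↔ χ (tgt g))) : Nat.card F + 1 ≤ Nat.card V := by
  classical
  have := Fintype.ofFinite V
  have := Fintype.ofFinite F
  let d : (V → ℚ) →ₗ[ℚ] (F → ℚ) :=
    { toFun := fun h e => h (src e) - h (tgt e)
      map_add' := fun h h' => funext fun e => add_sub_add_comm _ _ _ _
      map_smul' := fun c h => funext fun e => (mul_sub _ _ _).symm }
  -- The indicator of a side of the bridge `f` has coboundary the basis vector of `f`; the constants
  -- then make the kernel nonzero.
  have hsurj : LinearMap.range d = ⊤ := by
    rw [eq_top_iff, ← (Pi.basisFun ℚ F).span_eq, Submodule.span_le]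
    rintro _ ⟨f, rfl⟩
    obtain ⟨χ, h1, h2, h3⟩ := h f
    refine ⟨fun v => if χ v then 1 else 0, funext fun g => ?_⟩
    rw [Pi.basisFun_apply]
    change ((if χ (src g) then (1 : ℚ) else 0) - if χ (tgt g) then 1 else 0) = _
    by_cases hg : g = f
    · subst hg
      simp [h1, h2]
    · simp [h3 g hg, hg]
  have h1 := d.finrank_range_add_finrank_ker
  rw [hsurj, finrank_top, Module.finrank_pi, Module.finrank_pi] at h1
  have h2 : 1 ≤ Module.finrank ℚ (LinearMap.ker d) := by
    have hne : (fun _ => 1 : V → ℚ) ∈ LinearMap.ker d := by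
      rw [LinearMap.mem_ker]
      exact funext fun e => sub_self _
    have : Nontrivial (LinearMap.ker d) :=
      ⟨⟨⟨_, hne⟩, 0, fun h => by
        obtain ⟨v⟩ := ‹Nonempty V›
        exact one_ne_zero (congrFun (congrArg Subtype.val h) v)⟩⟩
    exact Module.finrank_pos
  rw [Nat.card_eq_fintype_card, Nat.card_eq_fintype_card]
  omega

/-- Let `σ` follow the chosen oriented listing of the cycle of each edge. Deleting one
representative from every cycle leaves a forest, so the number of edges is at most (number of
vertices) − 1 + (number of cycles); the general bound gives the other inequality. -/
theorem exists_cactusPerm (hc : t.IsCactus) (ho : ∀ C, t.IsCycle C → t.IsOrientedCycle C) :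
    ∃ σ : Perm t.E, CactusPerm t σ := by
  classical
  choose C hC hCu using hc
  have hCeq : ∀ {e f}, f ∈ C e → C f = C e := fun {e f} hf =>
    (hCu f (C e) ⟨(hC e).1, hf⟩).symm
  have hl : ∀ D : {D // t.IsCycle D}, ∃ p : (m : ℕ) × (Fin (m + 1) → t.E),
      t.IsOrientedListing p.2 ∧ Set.range p.2 = D.1 := fun D => ho D.1 D.2
  choose L hL hLr using hl
  let c : t.E → {D // t.IsCycle D} := fun e => ⟨C e, (hC e).1⟩
  have hi : ∀ e, ∃ i, (L (c e)).2 i = e := fun e => (hLr (c e)).symm.subset (hC e).2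
  choose i hi using hi
  let s : t.E → t.E := fun e => (L (c e)).2 (i e + 1)
  have hs : ∀ e, C (s e) = C e := fun e => hCeq ((hLr (c e)).subset ⟨_, rfl⟩)
  have hsi : Injective s := by
    intro e f hef
    have h1 : c e = c f := Subtype.ext ((hs e).symm.trans ((congrArg C hef).trans (hs f)))
    have gen : ∀ D D' (a : Fin ((L D).1 + 1)) (b : Fin ((L D').1 + 1)), D = D' →
        (L D).2 (a + 1) = (L D').2 (b + 1) → (L D).2 a = (L D').2 b := by
      rintro D _ a b rfl h
      rw [add_right_cancel ((hL D).1 h)]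
    exact (hi e).symm.trans ((gen _ _ _ _ h1 hef).trans (hi f))
  let σ : Perm t.E := Equiv.ofBijective s (Finite.injective_iff_bijective.1 hsi)
  have hσ : ∀ e, t.src e = t.tgt (σ e) := by
    intro e
    have := (hL (c e)).2.2 (i e)
    rw [hi e] at this
    exact this
  have horb : ∀ e f, f ∈ periodicOrbit σ e → C f = C e := fun e f hf =>
    of_mem_orbit (p := fun x => C x = C e) (fun z hz => (hs z).trans hz) rfl hf
  -- The representative of the cycle of `e`: the first edge in its listing.
  let r : t.E → t.E := fun e => (L (c e)).2 0
  have hr : ∀ e, r e ∈ C e := fun e => (hLr (c e)).subset ⟨0, rfl⟩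
  have hrc : ∀ {e f}, C e = C f → r e = r f := fun {e f} h =>
    congrArg (fun D => (L D).2 0) (Subtype.ext h : c e = c f)
  have h1 : Nat.card {e // ¬ e ≠ r e} ≤ ncyc σ := by
    have := (finite_cycles σ).to_subtype
    rw [ncyc, ← Nat.card_coe_set_eq]
    refine Nat.card_le_card_of_injective
      (fun e => (⟨periodicOrbit σ e.1, e.1, rfl⟩ : cycles σ)) ?_
    rintro ⟨e, he⟩ ⟨f, hf⟩ hef
    replace hef : periodicOrbit σ e = periodicOrbit σ f := congrArg Subtype.val hef
    push Not at he hf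
    refine Subtype.ext ?_
    change e = f
    rw [he, hf, hrc (horb f e (mem_orbit_iff.2 hef))]
  -- Each remaining edge is a bridge: a cycle through `f` made of remaining edges would be the cycle
  -- of `f` and hence contain its deleted representative.
  have h2 : Nat.card {e // e ≠ r e} + 1 ≤ Nat.card t.V := by
    have := t.conn.1
    refine card_add_one_le_of_bridges (fun f : {e // e ≠ r e} => t.src f.1)
      (fun f => t.tgt f.1) ?_
    rintro ⟨f, hf⟩
    refine ⟨fun v => (subGraph t {g | g ≠ r g ∧ g ≠ f}).Reachable (t.src f) v,
      SimpleGraph.Reachable.refl _, fun hreach => ?_, ?_⟩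
    · obtain ⟨D, hD, hfD, hDF⟩ := exists_isCycle_of_reachable (fun h => h.2 rfl) hreach
      have hDC := hCu f D ⟨hD, hfD⟩
      have h3 : r f ∈ D := hDC ▸ hr f
      rcases hDF h3 with h4 | h4
      · exact hf h4.symm
      · exact h4.1 (hrc (hCeq (hr f))).symm
    · rintro ⟨g, hg⟩ hgf
      have hgf' : g ≠ f := fun h => hgf (Subtype.ext h)
      change SimpleGraph.Reachable _ _ (t.src g) ↔ SimpleGraph.Reachable _ _ (t.tgt g)
      by_cases hst : t.src g = t.tgt g
      · rw [hst]
      · have hadj : (subGraph t {g | g ≠ r g ∧ g ≠ f}).Adj (t.src g) (t.tgt g) :=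
          ⟨hst, g, ⟨hg, hgf'⟩, .inl ⟨rfl, rfl⟩⟩
        exact ⟨fun h => h.trans hadj.reachable, fun h => h.trans hadj.symm.reachable⟩
  have h3 := Nat.card_congr (Equiv.sumCompl fun e : t.E => e ≠ r e)
  rw [Nat.card_sum] at h3
  have h4 := card_add_ncyc_le hσ
  have h5 := Finite.card_le_one_iff_subsingleton.2 (graphConnected_iff.1 t.conn).2
  exact ⟨σ, hσ, by omega⟩

end Cactus

/-! ### The distribution of traffics as a permutation sum -/

section Tau

open Equiv Function

variable {A : Type u} [Ring A] [Algebra ℂ A] {Φ : A →ₗ[ℂ] ℂ}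

/-- Whatever oriented listing is chosen, it follows `σ`; only its starting point is arbitrary, and
cyclic invariance removes that dependence. -/
theorem CactusPerm.cycleCumulant (h1 : Φ 1 = 1) (htr : ∀ a b : A, Φ (a * b) = Φ (b * a))
    {t : GraphMonomial A 0} {σ : Perm t.E} (h : CactusPerm t σ) {C : Cycle t.E}
    (hC : C ∈ cycles σ) :
    cycleCumulant Φ t {y | y ∈ C} = cycCum Φ (C.map t.label) := by
  obtain ⟨x, rfl⟩ := hC
  have hcyc : t.IsOrientedCycle {y | y ∈ periodicOrbit σ x} :=
    h.isOrientedCycle (h.isCycle_iff.2 ⟨x, rfl⟩)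
  rw [Traffic.cycleCumulant, dif_pos hcyc]
  have hch := hcyc.choose_spec
  generalize hcyc.choose = p at hch ⊢
  obtain ⟨m, e⟩ := p
  obtain ⟨he, hr⟩ := hch
  simp only at he hr ⊢
  have hm : ∀ i, e i ∈ periodicOrbit σ x := fun i => hr.subset ⟨i, rfl⟩
  have ho := isOrbit_ofFn he.1 (h.apply_listing he fun i j => by
    rw [mem_orbit_iff, mem_orbit_iff.1 (hm j), ← mem_orbit_iff]
    exact hm i)
  rw [← mem_orbit_iff.1 (hm 0), ho.periodicOrbit_eq, ← List.ofFn_succ (f := e),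
    freeCumulant_eq_cum h1 htr (Nat.succ_ne_zero m)]
  refine Eq.trans ?_ (cycCum_coe htr ((List.ofFn e).map t.label)).symm
  rw [List.map_ofFn]
  rfl

open Classical in
-- The sum has at most one term: an oriented cactus has exactly one such permutation, any other
-- graph none.
theorem injTau_eq (h1 : Φ 1 = 1) (htr : ∀ a b : A, Φ (a * b) = Φ (b * a))
    (t : GraphMonomial A 0) :
    injTau Φ t = ∑ᶠ σ : Perm t.E, if CactusPerm t σ then permWeight Φ σ t.label else 0 := by
  by_cases hσ : ∃ σ : Perm t.E, CactusPerm t σ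
  · obtain ⟨σ, h⟩ := hσ
    rw [finsum_eq_single _ σ fun σ' hne => if_neg fun h' => hne (h'.unique h), if_pos h,
      injTau, if_pos ⟨h.isCactus, fun C hC => h.isOrientedCycle hC⟩, permWeight,
      ← finprod_set_coe_eq_finprod_mem]
    symm
    refine finprod_eq_of_bijective
      (fun C : cycles σ => (⟨{y | y ∈ C.1}, ?_⟩ : {D // t.IsCycle D})) ⟨?_, ?_⟩ ?_
    · obtain ⟨_, x, rfl⟩ := C
      exact h.isCycle_iff.2 ⟨x, rfl⟩
    · rintro ⟨_, x, rfl⟩ ⟨_, y, rfl⟩ hxy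
      have h2 : {z | z ∈ periodicOrbit σ x} = {z | z ∈ periodicOrbit σ y} :=
        congrArg Subtype.val hxy
      exact Subtype.ext (mem_orbit_iff.1 (h2.subset (mem_orbit_self σ x)))
    · rintro ⟨D, hD⟩
      obtain ⟨x, rfl⟩ := h.isCycle_iff.1 hD
      exact ⟨⟨_, x, rfl⟩, rfl⟩
    · intro C
      exact (h.cycleCumulant h1 htr C.2).symm
  · rw [injTau, if_neg fun hc => hσ (exists_cactusPerm hc.1 hc.2)]
    push Not at hσ
    simp only [hσ, if_false, finsum_zero]

/-- Compatibility with `σ` makes `t^π` a quotient of `PermQuot`. The counting bound then leaves no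
room for further identifications. -/
theorem cactusPerm_quot_iff (t : GraphMonomial A 0) (σ : Perm t.E) (π : Setoid t.V) :
    CactusPerm (t.quot π) σ ↔ Tight t.src t.tgt σ ∧
      π = Setoid.ker (Quot.mk (EdgeRel t.src (t.tgt ∘ σ))) := by
  have key : Nat.card (Quotient (Setoid.ker (Quot.mk (EdgeRel t.src (t.tgt ∘ σ))))) =
      Nat.card (PermQuot t.src t.tgt σ) :=
    Nat.card_congr (Setoid.quotientKerEquivOfSurjective _ Quot.mk_surjective)
  constructor
  · rintro ⟨h1, h2⟩
    let q : PermQuot t.src t.tgt σ → Quotient π := Quot.lift (Quotient.mk π) (by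
      rintro _ _ ⟨e, rfl, rfl⟩
      exact h1 e)
    have hq : Surjective q := by
      rintro ⟨v⟩
      exact ⟨Quot.mk _ v, rfl⟩
    have h3 := card_permQuot_add_ncyc_le t.conn σ
    have h4 : Nat.card (Quotient π) + ncyc σ = Nat.card t.E + 1 := h2
    have h5 := Nat.card_le_card_of_surjective q hq
    have h6 : Nat.card (PermQuot t.src t.tgt σ) = Nat.card (Quotient π) := by omega
    refine ⟨by unfold Tight; omega, ?_⟩
    have hinj : Injective q := (Nat.bijective_iff_surjective_and_card q).2 ⟨hq, h6⟩ |>.1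
    ext v w
    rw [Setoid.ker_def]
    exact ⟨fun h => hinj (Quotient.sound h), fun h => Quotient.exact (congrArg q h)⟩
  · rintro ⟨h, rfl⟩
    refine ⟨fun e => Quotient.sound (mk_src t.src t.tgt σ e), ?_⟩
    change Nat.card (Quotient _) + ncyc σ = Nat.card t.E + 1
    rw [key]
    exact h

/-- Exchange the sums over `π` and `σ`: each tight `σ` contributes for exactly one partition. -/
theorem tauMonomial_eq (h1 : Φ 1 = 1) (htr : ∀ a b : A, Φ (a * b) = Φ (b * a))
    (t : GraphMonomial A 0) : tauMonomial Φ t = permTau Φ t.src t.tgt t.label := by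
  classical
  have : Finite (Setoid t.V) := Finite.of_injective
    (fun s : Setoid t.V => (fun x y => s x y : t.V → t.V → Prop))
    fun s s' h => Setoid.ext fun x y => iff_of_eq (congrFun (congrFun h x) y)
  have hf := Fintype.ofFinite (Setoid t.V)
  have hf' := Fintype.ofFinite t.E
  have hinj : ∀ π, injTau Φ (t.quot π) = ∑ σ : Perm t.E,
      if π = Setoid.ker (Quot.mk (EdgeRel t.src (t.tgt ∘ σ))) then
        (if Tight t.src t.tgt σ then permWeight Φ σ t.label else 0) else 0 := by
    intro π
    rw [injTau_eq h1 htr]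
    refine (finsum_eq_sum_of_fintype (α := Perm t.E) _).trans
      (Finset.sum_congr rfl fun σ _ => ?_)
    rw [← ite_and]
    exact if_congr ((cactusPerm_quot_iff t σ π).trans and_comm) rfl rfl
  rw [tauMonomial, finsum_eq_sum_of_fintype, permTau, finsum_eq_sum_of_fintype,
    Finset.sum_congr rfl fun π _ => hinj π, Finset.sum_comm]
  exact Finset.sum_congr rfl fun σ _ => by
    rw [Finset.sum_ite_eq', if_pos (Finset.mem_univ _)]

theorem tau_cls (h1 : Φ 1 = 1) (htr : ∀ a b : A, Φ (a * b) = Φ (b * a))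
    (t : GraphMonomial A 0) : tau Φ (Finsupp.single t.cls 1) = permTau Φ t.src t.tgt t.label := by
  rw [tau, Finsupp.linearCombination_single, one_smul, tauMonomial_eq h1 htr]
  obtain ⟨f, g, h2, h3, h4, -⟩ : GraphMonomial.Iso (Quotient.out t.cls) t := Quotient.mk_out t
  exact permTau_congr g f h2 h3 h4

theorem eval_trivial (t : GraphMonomial A 2) :
    (Context.trivial A).eval Φ t = permTau Φ t.close.src t.close.tgt t.close.label := by
  refine permTau_congr (Equiv.emptySum Empty t.E)
    ⟨Quot.lift (Sum.elim (fun _ => Quot.mk _ t.out) (fun v => Quot.mk _ v)) ?_,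
      Quot.lift (fun v => Quot.mk _ (.inr v)) ?_, ?_, ?_⟩ ?_ ?_ ?_
  · rintro _ _ (⟨rfl, rfl⟩ | ⟨rfl, rfl⟩)
    · rfl
    · exact Quot.sound ⟨rfl, rfl⟩
  · rintro _ _ ⟨rfl, rfl⟩
    exact (Context.plug_head (H := Context.trivial A) t).symm.trans
      (Context.plug_tail (H := Context.trivial A) t)
  · rintro ⟨v | v⟩
    · exact (Context.plug_head (H := Context.trivial A) t).symm
    · rfl
  · rintro ⟨v⟩; rfl
  · rintro (e | e)
    · exact e.elim
    · rfl
  · rintro (e | e)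
    · exact e.elim
    · rfl
  · rintro (e | e)
    · exact e.elim
    · rfl

theorem trafficTrace_eq (h1 : Φ 1 = 1) (htr : ∀ a b : A, Φ (a * b) = Φ (b * a)) :
    trafficTrace Φ = (Context.trivial A).functional Φ := by
  refine graphAlgebra_hom_ext fun t => ?_
  rw [Context.functional_toPoly, eval_trivial, ← tau_cls h1 htr, trafficTrace,
    LinearMap.comp_apply]
  congr 1
  have h : MonoidAlgebra.coeffLinearEquiv ℂ t.toPoly = Finsupp.single t.cls (1 : ℂ) := rfl
  exact (congrArg (Finsupp.mapDomain (Quotient.map GraphMonomial.close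
    fun _ _ h => GraphMonomial.close_iso h)) h).trans Finsupp.mapDomain_single

end Tau

/-! ### Traciality, degrees and alternating words -/

section Freeness

open Equiv Function

variable {A : Type u} [Ring A] [Algebra ℂ A] {Φ : A →ₗ[ℂ] ℂ}

/-- Exchange of the factors in a closed product. -/
def glueCloseSwap {J : Type u} (t s : GraphMonomial J 2) : (t.glue s).close.V → (s.glue t).close.V :=
  Quot.lift (Quot.lift (fun v => Quot.mk _ (Quot.mk _ v.swap)) (by
    rintro _ _ ⟨rfl, rfl⟩
    exact (Quot.sound ⟨rfl, rfl⟩).symm)) (by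
    rintro _ _ ⟨rfl, rfl⟩
    exact (congrArg (Quot.mk _) (Quot.sound ⟨rfl, rfl⟩)).symm)

theorem eval_trivial_glue_comm (t s : GraphMonomial A 2) :
    (Context.trivial A).eval Φ (t.glue s) = (Context.trivial A).eval Φ (s.glue t) := by
  rw [eval_trivial, eval_trivial]
  refine permTau_congr (Equiv.sumComm _ _) ⟨glueCloseSwap t s, glueCloseSwap s t, ?_, ?_⟩ ?_ ?_ ?_
  · rintro ⟨⟨v | v⟩⟩ <;> rfl
  · rintro ⟨⟨v | v⟩⟩ <;> rfl
  · rintro (e | e) <;> rfl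
  · rintro (e | e) <;> rfl
  · rintro (e | e) <;> rfl

theorem trivial_functional_comm (x y : GraphAlgebra A) :
    (Context.trivial A).functional Φ (x * y) = (Context.trivial A).functional Φ (y * x) := by
  induction x using graphAlgebra_induction with
  | add x x' hx hx' => rw [add_mul, mul_add, map_add, map_add, hx, hx']
  | smul c x hx => rw [smul_mul_assoc, mul_smul_comm, map_smul, map_smul, hx]
  | toPoly t =>
    induction y using graphAlgebra_induction with
    | add x x' hx hx' => rw [add_mul, mul_add, map_add, map_add, hx, hx']
    | smul c x hx => rw [smul_mul_assoc, mul_smul_comm, map_smul, map_smul, hx]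
    | toPoly s =>
      rw [toPoly_mul, toPoly_mul, Context.functional_toPoly, Context.functional_toPoly,
        eval_trivial_glue_comm]

/-- A graph monomial is anchored if, once its input and output are identified, the source of any
edge remains connected to them when this edge is removed. -/
def Anchored {J : Type u} (t : GraphMonomial J 2) : Prop :=
  ∀ (f : t.E) (χ : t.V → Prop), (∀ h, h ≠ f → (χ (t.src h) ↔ χ (t.tgt h))) →
    (χ t.out ↔ χ t.inp) → (χ (t.src f) ↔ χ t.out)

/-- The factor not containing `f` stays intact and connects its own input and output, so the closing
condition passes to the other factor. -/
theorem Anchored.glue {J : Type u} {t s : GraphMonomial J 2} (ht : Anchored t) (hs : Anchored s) :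
    Anchored (t.glue s) := by
  intro f χ h1 h2
  let α : t.V → Prop := fun v => χ (Quot.mk _ (.inl v))
  let β : s.V → Prop := fun v => χ (Quot.mk _ (.inr v))
  have hg : α t.inp = β s.out := congrArg χ (Quot.sound ⟨rfl, rfl⟩)
  change α t.out ↔ β s.inp at h2
  rcases f with f | f
  · change α (t.src f) ↔ α t.out
    have hβ := s.mk_eq_of_conn β (fun e => propext (h1 (.inr e) Sum.inr_ne_inl)) s.out s.inp
    refine ht f α (fun h hh => h1 (.inl h) fun h' => hh (Sum.inl_injective h')) ?_
    rw [hg, hβ]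
    exact h2
  · change β (s.src f) ↔ α t.out
    have hα := t.mk_eq_of_conn α (fun e => propext (h1 (.inl e) Sum.inl_ne_inr)) t.out t.inp
    rw [hα, hg] at h2
    rw [hα, hg]
    exact hs f β (fun h hh => h1 (.inr h) fun h' => hh (Sum.inr_injective h')) h2

theorem anchored_unit {J : Type u} : Anchored (GraphMonomial.unit J) := fun f => f.elim

theorem anchored_edge {J : Type u} (a : J) : Anchored (GraphMonomial.edge a) :=
  fun _ _ _ h => h.symm

theorem anchored_revEdge {J : Type u} (a : J) : Anchored (GraphMonomial.revEdge a) :=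
  fun _ _ _ _ => Iff.rfl

theorem anchored_degGraph {J : Type u} (a : J) : Anchored (GraphMonomial.degGraph a) :=
  fun _ _ _ _ => Iff.rfl

/-- After closing, the degree is a pendant edge at the root, which every tight permutation fixes.
Contracting it yields the factor `Φ a`. -/
theorem eval_trivial_glue_degGraph (htr : ∀ a b : A, Φ (a * b) = Φ (b * a))
    {t : GraphMonomial A 2} (ht : Anchored t) (a : A) :
    (Context.trivial A).eval Φ (t.glue (GraphMonomial.degGraph a)) =
      (Context.trivial A).eval Φ t * Φ a := by
  have hoi : (Quot.mk _ t.out : t.close.V) = Quot.mk _ t.inp := Quot.sound ⟨rfl, rfl⟩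
  let src : Option t.E → Option t.close.V := fun e =>
    e.elim (some (Quot.mk _ t.inp)) fun e => some (t.close.src e)
  let tgt : Option t.E → Option t.close.V := fun e => e.elim none fun e => some (t.close.tgt e)
  have hconn : GraphConnected src tgt := by
    have h : ∀ v, Relation.EqvGen (fun v w => ∃ e, src e = v ∧ tgt e = w)
        (some (Quot.mk _ t.inp)) v := by
      rintro (_ | v)
      · exact .rel _ _ ⟨none, rfl, rfl⟩
      · refine eqvGen_of_map some ?_ (t.close.conn.2 (Quot.mk _ t.inp) v)
        rintro _ _ ⟨e, rfl, rfl⟩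
        exact .rel _ _ ⟨some e, rfl, rfl⟩
    exact ⟨⟨none⟩, fun x y => .trans _ _ _ (.symm _ _ (h x)) (h y)⟩
  have h1 : (Context.trivial A).eval Φ (t.glue (GraphMonomial.degGraph a)) =
      permTau Φ src tgt (fun e => e.elim a t.label) := by
    rw [eval_trivial]
    refine permTau_congr
      ⟨Sum.elim some (fun _ => none), fun e => e.elim (.inr ()) .inl,
        by rintro (e | e) <;> rfl, by rintro (_ | e) <;> rfl⟩
      ⟨Quot.lift (Quot.lift (Sum.elim (fun v => some (Quot.mk _ v))
          (![some (Quot.mk _ t.inp), none] : Fin 2 → Option t.close.V)) ?_) ?_,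
        fun v => v.elim (Quot.mk _ (Quot.mk _ (.inr (1 : Fin 2))))
          (Quot.lift (fun v => Quot.mk _ (Quot.mk _ (.inl v))) ?_), ?_, ?_⟩ ?_ ?_ ?_
    · rintro _ _ ⟨rfl, rfl⟩
      rfl
    · rintro _ _ ⟨rfl, rfl⟩
      exact congrArg some hoi
    · rintro _ _ ⟨rfl, rfl⟩
      refine (Quot.sound ⟨rfl, rfl⟩ : _ = Quot.mk _ (Quot.mk _ (.inr (0 : Fin 2)))).trans ?_
      exact (congrArg (Quot.mk _) (Quot.sound ⟨rfl, rfl⟩)).symm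
    · rintro ⟨⟨v | v⟩⟩
      · rfl
      · change Fin 2 at v
        fin_cases v
        · exact congrArg (Quot.mk _) (Quot.sound ⟨rfl, rfl⟩)
        · rfl
    · rintro (_ | v)
      · rfl
      · obtain ⟨v⟩ := v
        rfl
    · rintro (e | e) <;> rfl
    · rintro (e | e) <;> rfl
    · rintro (e | e) <;> rfl
  rw [h1, permTau_contract htr, mul_comm, eval_trivial]
  · congr 1
    refine permTau_congr (Equiv.refl _)
      ⟨Quot.lift (fun v => v.elim (Quot.mk _ t.inp) id) ?_, fun v => Quot.mk _ (some v), ?_,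
        fun _ => rfl⟩ (fun _ => rfl) (fun _ => rfl) (fun _ => rfl)
    · rintro _ _ ⟨rfl, rfl⟩
      rfl
    · rintro ⟨_ | v⟩
      · exact Quot.sound ⟨rfl, rfl⟩
      · rfl
  -- If the pendant edge `none` had another edge `f` in its cycle, the cut at the two would separate
  -- the source of `f` from the root, contrary to `Anchored`.
  · intro σ hσ hne
    exfalso
    obtain ⟨χ, h2, h3, h4, h5, h6, h7⟩ := hσ.exists_cut hconn
      (apply_mem_orbit (mem_orbit_self σ none)) hne
    obtain ⟨f, hf⟩ := Option.ne_none_iff_exists'.1 hne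
    rw [hf] at h3 h5
    have h8 := ht f (fun v => χ (some (Quot.mk _ v)))
      (fun k hk => h3 (some k) (Option.some_ne_none k) fun h => hk (Option.some_injective _ h))
      (iff_of_eq (congrArg (fun v => χ (some v)) hoi))
    refine h6 ?_
    have h9 : χ (some (Quot.mk _ t.out)) := h8.1 h5
    rwa [hoi] at h9

/-- The algebra generated by the anchored graph monomials. -/
noncomputable def anchoredAlg (J : Type u) : Subalgebra ℂ (GraphAlgebra J) :=
  Algebra.adjoin ℂ {x | ∃ t : GraphMonomial J 2, Anchored t ∧ t.toPoly = x}

/-- The algebra generated by the degrees. -/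
noncomputable def degAlg (J : Type u) : Subalgebra ℂ (GraphAlgebra J) :=
  Algebra.adjoin ℂ (Set.range fun a : J => (GraphMonomial.degGraph a).toPoly)

theorem mem_anchoredAlg {J : Type u} {t : GraphMonomial J 2} (h : Anchored t) :
    t.toPoly ∈ anchoredAlg J :=
  Algebra.subset_adjoin ⟨t, h, rfl⟩

theorem degAlg_le (J : Type u) : degAlg J ≤ anchoredAlg J :=
  Algebra.adjoin_le (by
    rintro _ ⟨a, rfl⟩
    exact mem_anchoredAlg (anchored_degGraph a))

theorem anchoredAlg_induction {J : Type u} {p : GraphAlgebra J → Prop}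
    (add : ∀ x y, p x → p y → p (x + y)) (smul : ∀ (c : ℂ) x, p x → p (c • x))
    (toPoly : ∀ t : GraphMonomial J 2, Anchored t → p t.toPoly) {x : GraphAlgebra J}
    (hx : x ∈ anchoredAlg J) : p x := by
  have h : x ∈ Submodule.span ℂ (Submonoid.closure
      {x | ∃ t : GraphMonomial J 2, Anchored t ∧ t.toPoly = x} : Set (GraphAlgebra J)) := by
    rw [← Algebra.adjoin_eq_span]
    exact hx
  clear hx
  induction h using Submodule.span_induction with
  | mem x hx =>
    have : ∃ t : GraphMonomial J 2, Anchored t ∧ t.toPoly = x := by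
      induction hx using Submonoid.closure_induction with
      | mem x hx => exact hx
      | one => exact ⟨_, anchored_unit, toPoly_unit⟩
      | mul x y _ _ hx hy =>
        obtain ⟨t, ht, rfl⟩ := hx
        obtain ⟨s, hs, rfl⟩ := hy
        exact ⟨_, ht.glue hs, (toPoly_mul t s).symm⟩
    obtain ⟨t, ht, rfl⟩ := this
    exact toPoly t ht
  | zero =>
    rw [← zero_smul ℂ (GraphMonomial.unit J).toPoly]
    exact smul _ _ (toPoly _ anchored_unit)
  | add x y _ _ hx hy => exact add _ _ hx hy
  | smul c x _ hx => exact smul _ _ hx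

theorem trivial_functional_one (h1 : Φ 1 = 1) (htr : ∀ a b : A, Φ (a * b) = Φ (b * a)) :
    (Context.trivial A).functional Φ 1 = 1 := by
  rw [← toPoly_unit, Context.functional_toPoly, ← Context.eval_edge_one h1 htr,
    eval_trivial_edge htr, h1]

theorem trivial_functional_mul_deg (htr : ∀ a b : A, Φ (a * b) = Φ (b * a)) {x : GraphAlgebra A}
    (hx : x ∈ anchoredAlg A) (a : A) :
    (Context.trivial A).functional Φ (x * (GraphMonomial.degGraph a).toPoly) =
      (Context.trivial A).functional Φ x * Φ a := by
  refine anchoredAlg_induction (p := fun x => (Context.trivial A).functional Φ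
    (x * (GraphMonomial.degGraph a).toPoly) = (Context.trivial A).functional Φ x * Φ a)
    (fun x y hx hy => ?_) (fun c x hx => ?_) (fun t ht => ?_) hx
  · rw [add_mul, map_add, map_add, hx, hy, add_mul]
  · rw [smul_mul_assoc, map_smul, map_smul, hx, smul_mul_assoc]
  · rw [toPoly_mul, Context.functional_toPoly, Context.functional_toPoly,
      eval_trivial_glue_degGraph htr ht]

/-- Multiplicativity passes from single degrees to the algebra they generate because that algebra is
itself anchored. -/
theorem trivial_functional_mul_degAlg (h1 : Φ 1 = 1) (htr : ∀ a b : A, Φ (a * b) = Φ (b * a))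
    {x y : GraphAlgebra A} (hx : x ∈ anchoredAlg A) (hy : y ∈ degAlg A) :
    (Context.trivial A).functional Φ (x * y) =
      (Context.trivial A).functional Φ x * (Context.trivial A).functional Φ y := by
  induction hy using Algebra.adjoin_induction generalizing x with
  | mem y hy =>
    obtain ⟨a, rfl⟩ := hy
    have h := trivial_functional_mul_deg htr (one_mem (anchoredAlg A)) a
    rw [one_mul, trivial_functional_one h1 htr, one_mul] at h
    rw [h]
    exact trivial_functional_mul_deg htr hx a
  | algebraMap r =>
    rw [Algebra.algebraMap_eq_smul_one, mul_smul_comm, map_smul, map_smul, mul_one,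
      trivial_functional_one h1 htr, smul_eq_mul, smul_eq_mul, mul_one, mul_comm]
  | add y z _ _ hy hz => rw [mul_add, map_add, map_add, hy hx, hz hx, mul_add]
  | mul y z hy' _ hy hz =>
    have hyU := degAlg_le A hy'
    rw [← mul_assoc, hz (mul_mem hx hyU), hy hx, hz hyU, mul_assoc]

/-! #### Alternating words -/

theorem cyc_iff {m : ℕ} (ε : Fin (m + 1) → Bool) (p : Fin (m + 1) → Prop) (k : Fin (m + 1)) :
    (p (cycSrc ε k) ↔ p (cycTgt ε k)) ↔ (p k ↔ p (k + 1)) := by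
  unfold cycSrc cycTgt
  split_ifs
  · rfl
  · exact Iff.comm

/-- In an alternating cycle, a permutation which defines a cactus has a fixed point. -/
theorem Tight.exists_fixed {m : ℕ} {ε : Fin (m + 1) → Bool} {σ : Perm (Fin (m + 1))}
    (h : Tight (cycSrc ε) (cycTgt ε) σ) (hε : ∀ k : Fin m, ε k.castSucc ≠ ε k.succ) :
    ∃ k, σ k = k := by
  by_contra hfix
  push Not at hfix
  -- Descent on the gap between two elements of one orbit. Working with the linear order avoids any
  -- condition on the orientations of the last and first edges.
  have key : ∀ (d : ℕ) (x y : Fin (m + 1)), x < y → y ∈ periodicOrbit σ x →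
      (y : ℕ) - x = d → False := by
    intro d
    induction d using Nat.strong_induction_on with
    | _ d ih =>
    intro x y hxy hy hd
    obtain ⟨χ, h1, h2, h3, h4, h5, h6⟩ := h.exists_cut (cycConn ε) hy hxy.ne'
    have hx1 : ((x + 1 : Fin (m + 1)) : ℕ) = x + 1 :=
      Fin.val_add_one_of_lt (lt_of_lt_of_le hxy (Fin.le_last _))
    have hc : ∀ k, k ≠ x → k ≠ y → (χ k ↔ χ (k + 1)) := fun k hk hk' =>
      (cyc_iff ε χ k).1 (h2 k hk hk')
    have hcx : ¬ (χ x ↔ χ (x + 1)) := fun h => h5 (((cyc_iff ε χ x).2 h).2 h3)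
    have hcy : ¬ (χ y ↔ χ (y + 1)) := fun h => h6 (((cyc_iff ε χ y).2 h).1 h4)
    have hle : x + 1 ≤ y := Fin.add_one_le_of_lt hxy
    rcases hle.eq_or_lt with hxy1 | hlt
    -- Adjacent edges with opposite orientations share their source or share their target, while the
    -- cut separates both the sources and the targets.
    · have hε' : ε x ≠ ε (x + 1) := by
        have hxm : (x : ℕ) < m := lt_of_lt_of_le hxy (Fin.le_last y)
        have h7 := hε ⟨x, hxm⟩
        rwa [← Fin.coeSucc_eq_succ] at h7
      rw [← hxy1] at h4 h6
      unfold cycSrc at h4 h5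
      unfold cycTgt at h3 h6
      cases hex : ε x <;> cases hey : ε (x + 1) <;> simp_all
    · by_cases hk : x + 1 ∈ periodicOrbit σ x
      · exact ih _ (by rw [hx1]; rw [Fin.lt_def] at hxy; rw [Fin.lt_def, hx1] at hlt; omega) x
          (x + 1) (by rw [Fin.lt_def, hx1]; omega) hk rfl
      -- The orbit of `k` avoids both cut edges, so `σ k` is on the side of `k`, strictly between
      -- `x` and `y`. As `σ k ≠ k`, these two form a pair with a smaller gap.
      set k := x + 1 with hkdef
      have hz : σ k ∉ periodicOrbit σ x := fun hz => hk (by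
        rw [mem_orbit_iff, orbit_apply] at hz
        exact mem_orbit_iff.2 hz)
      have hne : ∀ {z}, z ∉ periodicOrbit σ x → z ≠ x ∧ z ≠ y := fun {z} hz =>
        ⟨fun h => hz (h ▸ mem_orbit_self σ z), fun h => hz (h ▸ hy)⟩
      have hends : ∀ {z}, z ∉ periodicOrbit σ x →
          (χ (cycSrc ε z) ↔ χ z) ∧ (χ (cycTgt ε z) ↔ χ z) := by
        intro z hz
        have := hc z (hne hz).1 (hne hz).2
        unfold cycSrc cycTgt
        split_ifs
        · exact ⟨Iff.rfl, this.symm⟩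
        · exact ⟨this.symm, Iff.rfl⟩
      have hχ : χ (σ k) ↔ χ k := (hends hz).2.symm.trans ((h1 k).symm.trans (hends hk).1)
      have hky : χ k ↔ χ y := fin_interval hle fun j hj hj' =>
        hc j (fun h => by rw [h, Fin.le_def, hx1] at hj; omega) hj'.ne
      have hzx : x < σ k := by
        refine lt_of_le_of_ne (le_of_not_gt fun hlt' => hcx ?_) (hne hz).1.symm
        have h8 : χ (σ k) ↔ χ x := fin_interval hlt'.le fun j _ hj' =>
          hc j hj'.ne (hj'.trans hxy).ne
        exact h8.symm.trans hχ
      have hzy : σ k < y := by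
        refine lt_of_le_of_ne (le_of_not_gt fun hlt' => hcy ?_) (hne hz).2
        have hy1 : ((y + 1 : Fin (m + 1)) : ℕ) = y + 1 :=
          Fin.val_add_one_of_lt (lt_of_lt_of_le hlt' (Fin.le_last _))
        have h8 : χ (y + 1) ↔ χ (σ k) :=
          fin_interval (Fin.add_one_le_of_lt hlt') fun j hj _ => hc j
            (fun h => by rw [h, Fin.le_def, hy1] at hj; rw [Fin.lt_def] at hxy; omega)
            (fun h => by rw [h, Fin.le_def, hy1] at hj; omega)
        exact hky.symm.trans (hχ.symm.trans h8.symm)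
      have m1 : σ k ∈ periodicOrbit σ k := apply_mem_orbit (mem_orbit_self σ k)
      rw [Fin.lt_def] at hxy hzx hzy hlt
      rcases lt_or_gt_of_ne (hfix k) with h9 | h9
      · exact ih _ (by omega) _ _ h9 (mem_orbit_comm.1 m1) rfl
      · exact ih _ (by omega) _ _ h9 m1 rfl
  have m1 : σ 0 ∈ periodicOrbit σ 0 := apply_mem_orbit (mem_orbit_self σ 0)
  exact key _ 0 (σ 0) (Fin.pos_iff_ne_zero.2 (hfix 0)) m1 rfl

theorem permTau_alternating (htr : ∀ a b : A, Φ (a * b) = Φ (b * a)) {m : ℕ}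
    {ε : Fin (m + 1) → Bool} (hε : ∀ k : Fin m, ε k.castSucc ≠ ε k.succ) {a : Fin (m + 1) → A}
    (ha : ∀ k, Φ (a k) = 0) : permTau Φ (cycSrc ε) (cycTgt ε) a = 0 := by
  classical
  rw [permTau, finsum_eq_sum_of_fintype]
  refine Finset.sum_eq_zero fun σ _ => ?_
  split_ifs with hσ
  · obtain ⟨k, hk⟩ := hσ.exists_fixed hε
    have ho : IsOrbit σ k [] := ⟨List.nodup_singleton k, by rw [List.map_singleton, hk]; rfl⟩
    rw [permWeight_orbit htr ho, List.map_nil, cum_singleton, ha, zero_mul]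
  · rfl

/-! ### Reduction of letters to single edges, and freeness -/

theorem exists_toNullQuot_edge (h1 : Φ 1 = 1) (htr : ∀ a b : A, Φ (a * b) = Φ (b * a))
    {x : GraphAlgebra A}
    (hx : x ∈ Algebra.adjoin ℂ (Set.range fun a : A => (GraphMonomial.edge a).toPoly)) :
    ∃ a, toNullQuot Φ x = toNullQuot Φ (GraphMonomial.edge a).toPoly := by
  have h : Algebra.adjoin ℂ (Set.range fun a : A => (GraphMonomial.edge a).toPoly) ≤
      (edgeHom h1 htr).range.comap (toNullQuot Φ) := Algebra.adjoin_le (by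
    rintro _ ⟨a, rfl⟩
    exact ⟨a, rfl⟩)
  obtain ⟨a, ha⟩ := h hx
  exact ⟨a, ha.symm⟩

theorem exists_toNullQuot_revEdge (h1 : Φ 1 = 1) (htr : ∀ a b : A, Φ (a * b) = Φ (b * a))
    {x : GraphAlgebra A}
    (hx : x ∈ Algebra.adjoin ℂ (Set.range fun a : A => (GraphMonomial.revEdge a).toPoly)) :
    ∃ a, toNullQuot Φ x = toNullQuot Φ (GraphMonomial.revEdge a).toPoly := by
  induction hx using Algebra.adjoin_induction with
  | mem x hx =>
    obtain ⟨a, rfl⟩ := hx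
    exact ⟨a, rfl⟩
  | algebraMap r =>
    refine ⟨r • 1, ?_⟩
    rw [revEdge_smul htr, revEdge_one h1 htr, AlgHom.commutes, Algebra.algebraMap_eq_smul_one]
  | add x y _ _ hx hy =>
    obtain ⟨a, ha⟩ := hx
    obtain ⟨b, hb⟩ := hy
    exact ⟨a + b, by rw [map_add, ha, hb, revEdge_add htr]⟩
  | mul x y _ _ hx hy =>
    obtain ⟨a, ha⟩ := hx
    obtain ⟨b, hb⟩ := hy
    exact ⟨b * a, by rw [map_mul, ha, hb, revEdge_mul htr]⟩

theorem eval_trivial_dirEdge (htr : ∀ a b : A, Φ (a * b) = Φ (b * a)) (ε : Bool) (a : A) :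
    (Context.trivial A).eval Φ (GraphMonomial.dirEdge ε a) = Φ a := by
  cases ε with
  | false => exact eval_trivial_edge htr a
  | true => exact (eval_revEdge _ a).trans (eval_trivial_edge htr a)

theorem areFree_functional (h1 : Φ 1 = 1) (htr : ∀ a b : A, Φ (a * b) = Φ (b * a)) :
    AreFree ((Context.trivial A).functional Φ)
      ![Algebra.adjoin ℂ (Set.range fun a : A => (GraphMonomial.edge a).toPoly),
        Algebra.adjoin ℂ (Set.range fun a : A => (GraphMonomial.revEdge a).toPoly),
        Algebra.adjoin ℂ (Set.range fun a : A => (GraphMonomial.degGraph a).toPoly)] := by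
  intro n i c hi hc h0
  -- Index `2` is the degree algebra.
  by_cases h2 : ∃ k, i k = 2
  · obtain ⟨k, hk⟩ := h2
    have hD : c k ∈ degAlg A := by
      have := hc k
      rw [hk] at this
      exact this
    have hU : ∀ x ∈ List.ofFn c, x ∈ anchoredAlg A := by
      rintro x hx
      obtain ⟨j, rfl⟩ := (List.mem_ofFn' c x).1 hx
      have hj := hc j
      generalize i j = l at hj
      have hl : (![Algebra.adjoin ℂ (Set.range fun a : A => (GraphMonomial.edge a).toPoly),
        Algebra.adjoin ℂ (Set.range fun a : A => (GraphMonomial.revEdge a).toPoly),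
        Algebra.adjoin ℂ (Set.range fun a : A => (GraphMonomial.degGraph a).toPoly)] :
          Fin 3 → Subalgebra ℂ (GraphAlgebra A)) l ≤ anchoredAlg A := by
        fin_cases l
        · refine Algebra.adjoin_le ?_
          rintro _ ⟨a, rfl⟩
          exact mem_anchoredAlg (anchored_edge a)
        · refine Algebra.adjoin_le ?_
          rintro _ ⟨a, rfl⟩
          exact mem_anchoredAlg (anchored_revEdge a)
        · exact degAlg_le A
      exact hl hj
    obtain ⟨l, l', hl⟩ := List.append_of_mem ((List.mem_ofFn' c (c k)).2 ⟨k, rfl⟩)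
    rw [hl] at hU ⊢
    have hlU : l.prod ∈ anchoredAlg A := Subalgebra.list_prod_mem _ fun x hx =>
      hU x (List.mem_append_left _ hx)
    have hlU' : l'.prod ∈ anchoredAlg A := Subalgebra.list_prod_mem _ fun x hx =>
      hU x (List.mem_append_right _ (List.mem_cons_of_mem _ hx))
    -- Traciality moves the degree factor to the end, where its vanishing trace factors out; this
    -- case does not need the letters to alternate.
    rw [List.prod_append, List.prod_cons, trivial_functional_comm, mul_assoc,
      trivial_functional_comm, trivial_functional_mul_degAlg h1 htr (mul_mem hlU' hlU) hD, h0,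
      mul_zero]
  -- Only indices `0` and `1` remain, so distinct neighbouring indices mean opposite orientations in
  -- the closed path.
  · push Not at h2
    have hdir : ∀ k, ∃ a, toNullQuot Φ (c k) =
        toNullQuot Φ (GraphMonomial.dirEdge (decide (i k = 1)) a).toPoly := by
      intro k
      have hk := hc k
      have hk2 := h2 k
      generalize i k = l at hk hk2
      fin_cases l
      · exact exists_toNullQuot_edge h1 htr hk
      · exact exists_toNullQuot_revEdge h1 htr hk
      · exact absurd rfl hk2
    choose a ha using hdir
    have hΦ : ∀ k, Φ (a k) = 0 := by
      intro k
      rw [← eval_trivial_dirEdge htr (decide (i k = 1)), ← Context.functional_toPoly,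
        ← toNullQuot_eq_iff.1 (ha k), h0]
    have hprod : toNullQuot Φ (List.ofFn c).prod = toNullQuot Φ (List.ofFn fun k =>
        (GraphMonomial.dirEdge (decide (i k = 1)) (a k)).toPoly).prod := by
      rw [map_list_prod, map_list_prod, List.map_ofFn, List.map_ofFn]
      congr 2
      exact funext ha
    rw [toNullQuot_eq_iff.1 hprod, prod_dirEdge, Context.functional_toPoly, eval_trivial_path]
    refine permTau_alternating htr (fun k h => hi k ?_) hΦ
    have hk := h2 k.castSucc
    have hk' := h2 k.succ
    rw [decide_eq_decide] at h
    have key : ∀ x y : Fin 3, x ≠ 2 → y ≠ 2 → (x = 1 ↔ y = 1) → x = y := by decide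
    exact key _ _ hk hk' h

/-- Centred letters lift along `f` to letters that are still centred, since `f` preserves the
functionals. -/
theorem AreFree.of_le_map {B B' : Type*} [Ring B] [Algebra ℂ B] [Ring B'] [Algebra ℂ B']
    {ι : Type*} {φ : B →ₗ[ℂ] ℂ} {φ' : B' →ₗ[ℂ] ℂ} {S : ι → Subalgebra ℂ B}
    {S' : ι → Subalgebra ℂ B'} (f : B →ₐ[ℂ] B') (hf : ∀ x, φ' (f x) = φ x)
    (hS : ∀ i, S' i ≤ (S i).map f) (h : AreFree φ S) : AreFree φ' S' := by
  intro n i c hi hc h0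
  choose b hb hbc using fun k => hS (i k) (hc k)
  have h1 := h n i b hi hb fun k => by
    rw [← hf]
    exact (congrArg φ' (hbc k)).trans (h0 k)
  rw [← hf, map_list_prod, List.map_ofFn] at h1
  rw [← h1]
  congr 3
  exact funext fun k => (hbc k).symm

/-! #### The free `𝒢`-algebra -/

theorem transposeOp_act (a : A) :
    GraphOp.transposeOp.act (fun _ => (GraphMonomial.edge a).toPoly) =
      (GraphMonomial.revEdge a).toPoly := by
  rw [act_toPoly]
  refine toPoly_congr ⟨⟨Quot.lift (Sum.elim (fun v => v) (fun x => (![1, 0] : Fin 2 → Fin 2) x.2)) ?_,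
    fun v => Quot.mk _ (.inl v), ?_, fun _ => rfl⟩,
    ⟨fun _ => (), fun _ => ⟨0, ()⟩, ?_, fun _ => rfl⟩, fun _ => rfl, fun _ => rfl, fun _ => rfl,
    fun i => ?_⟩
  · rintro _ _ (k | k) <;> rfl
  · rintro ⟨v | ⟨k, v⟩⟩
    · rfl
    · change Fin 2 at v
      obtain rfl : k = 0 := Subsingleton.elim _ _
      fin_cases v
      · exact Quot.sound (GraphOp.SubstRel.target (g := GraphOp.transposeOp)
          (t := fun _ => GraphMonomial.edge a) 0)
      · exact Quot.sound (GraphOp.SubstRel.source (g := GraphOp.transposeOp)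
          (t := fun _ => GraphMonomial.edge a) 0)
  · rintro ⟨k, e⟩
    obtain rfl : k = 0 := Subsingleton.elim _ _
    rfl
  · fin_cases i <;> rfl

theorem degOp_act (a : A) :
    GraphOp.degOp.act (fun _ => (GraphMonomial.edge a).toPoly) =
      (GraphMonomial.degGraph a).toPoly := by
  rw [act_toPoly]
  refine toPoly_congr ⟨⟨Quot.lift (Sum.elim (fun v => v) (fun x => (![1, 0] : Fin 2 → Fin 2) x.2)) ?_,
    fun v => Quot.mk _ (.inl v), ?_, fun _ => rfl⟩,
    ⟨fun _ => (), fun _ => ⟨0, ()⟩, ?_, fun _ => rfl⟩, fun _ => rfl, fun _ => rfl, fun _ => rfl,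
    fun i => ?_⟩
  · rintro _ _ (k | k) <;> rfl
  · rintro ⟨v | ⟨k, v⟩⟩
    · rfl
    · change Fin 2 at v
      obtain rfl : k = 0 := Subsingleton.elim _ _
      fin_cases v
      · exact Quot.sound (GraphOp.SubstRel.target (g := GraphOp.degOp)
          (t := fun _ => GraphMonomial.edge a) 0)
      · exact Quot.sound (GraphOp.SubstRel.source (g := GraphOp.degOp)
          (t := fun _ => GraphMonomial.edge a) 0)
  · rintro ⟨k, e⟩
    obtain rfl : k = 0 := Subsingleton.elim _ _
    rfl
  · fin_cases i <;> rfl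

/-- The defining relations hold modulo null elements, so `𝒢(A)` maps to `NullQuot Φ`, on which every
context functional is defined. -/
theorem exists_functional_freeGAlgebra (h1 : Φ 1 = 1) (htr : ∀ a b : A, Φ (a * b) = Φ (b * a))
    (H : Context A) : ∃ Ψ : FreeGAlgebra A →ₗ[ℂ] ℂ,
      ∀ x, Ψ (toFreeGAlgebra x) = H.functional Φ x := by
  obtain ⟨ψ, hψ⟩ := exists_functional_nullQuot (Φ := Φ) H
  refine ⟨ψ ∘ₗ (RingQuot.liftAlgHom ℂ ⟨toNullQuot Φ, fun {x y} h =>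
    toNullQuot_of_freeRel h1 htr h⟩).toLinearMap, fun x => ?_⟩
  rw [LinearMap.comp_apply, AlgHom.toLinearMap_apply, toFreeGAlgebra,
    RingQuot.liftAlgHom_mkAlgHom_apply, hψ]

end Freeness

end Traffic

theorem mainTheorem6 {A : Type*} [Ring A] [Algebra ℂ A] (Φ : A →ₗ[ℂ] ℂ) (hΦ_one : Φ 1 = 1)
    (hΦ_trace : ∀ a b : A, Φ (a * b) = Φ (b * a)) :
    Traffic.AreFree (Traffic.trafficTrace Φ)
      ![Algebra.adjoin ℂ (Set.range fun a : A => (Traffic.GraphMonomial.edge a).toPoly),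
        Algebra.adjoin ℂ (Set.range fun a : A => (Traffic.GraphMonomial.revEdge a).toPoly),
        Algebra.adjoin ℂ (Set.range fun a : A => (Traffic.GraphMonomial.degGraph a).toPoly)] ∧
    ∃ Ψ : Traffic.FreeGAlgebra A →ₗ[ℂ] ℂ,
      (∀ x : Traffic.GraphAlgebra A, Ψ (Traffic.toFreeGAlgebra x) = Traffic.trafficTrace Φ x) ∧
      Traffic.AreFree Ψ
        ![Algebra.adjoin ℂ (Set.range (Traffic.FreeGAlgebra.of (A := A))),
          Algebra.adjoin ℂ (Set.range (Traffic.FreeGAlgebra.transpose (A := A))),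
          Algebra.adjoin ℂ (Set.range (Traffic.FreeGAlgebra.deg (A := A)))] := by
  have hfree := Traffic.areFree_functional hΦ_one hΦ_trace
  obtain ⟨Ψ, hΨ⟩ := Traffic.exists_functional_freeGAlgebra hΦ_one hΦ_trace
    (Traffic.Context.trivial A)
  rw [Traffic.trafficTrace_eq hΦ_one hΦ_trace]
  refine ⟨hfree, Ψ, hΨ, hfree.of_le_map Traffic.toFreeGAlgebra hΨ fun i => ?_⟩
  fin_cases i
  · change Algebra.adjoin ℂ _ ≤ (Algebra.adjoin ℂ _).map _
    rw [AlgHom.map_adjoin, ← Set.range_comp]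
    exact le_rfl
  · change Algebra.adjoin ℂ _ ≤ (Algebra.adjoin ℂ _).map _
    rw [AlgHom.map_adjoin, ← Set.range_comp]
    exact (congrArg (fun f => Algebra.adjoin ℂ (Set.range f)) (funext fun a =>
      congrArg Traffic.toFreeGAlgebra (Traffic.transposeOp_act a))).le
  · change Algebra.adjoin ℂ _ ≤ (Algebra.adjoin ℂ _).map _
    rw [AlgHom.map_adjoin, ← Set.range_comp]
    exact (congrArg (fun f => Algebra.adjoin ℂ (Set.range f)) (funext fun a =>
      congrArg Traffic.toFreeGAlgebra (Traffic.degOp_act a))).le
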